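/- Setting. Let $M=(m_{st})_{s,t\in S}$ be a Coxeter matrix with $m_{st}\in\{2,3,\infty\}$ for $s\neq t$, with Coxeter group $W$, whose defining graph $L$ (vertex set $S$, an edge $\{s,t\}$ whenever $s\ne t$ and $m_{st}<\infty$) is connected. Let $\Delta$ be a locally finite building of type $M$ (a set of chambers with a $W$-valued Weyl distance, all panels finite), and let $\Gamma<\mathrm{Aut}(\Delta)$ be a Singer cyclic lattice of order $q$: a group of type-preserving automorphisms acting freely and transitively on the panels of each type, with $k=q+1<\infty$ orbits on chambers, such that the stabilizer of each $\{s,t\}$-residue with $s\neq t$, $m_{st}<\infty$ is cyclic. Weyl data consist of a set of chambers, for each $s\in S$ a groupoid on the chambers (the panel groupoid of type $s$, whose morphisms are the edges of type $s$), and a set of closed galleries (the defining suites), where a gallery is a path of edges. Homotopy of galleries is the congruence generated by composing edges within a panel groupoid and deleting defining suites. An isomorphism is a bijection on chambers and on edges of each type that is compatible with the panel groupoids and with homotopy in both directions. The fundamental group $\pi_1(\mathcal W,x)$ consists of the homotopy classes of closed galleries at $x$; the universal cover $\widetilde{\mathcal W}$ has as chambers the homotopy classes of galleries issuing from $x$,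 two being $s$-equivalent when they differ by one final edge of type $s$, and $\pi_1(\mathcal W,x)$ acts on it by concatenation. The quotient $\Gamma\backslash\Delta$ is the Weyl graph whose chambers are the $\Gamma$-orbits of chambers, whose edges of type $s$ are the $\Gamma$-orbits of pairs of $s$-equivalent chambers, and whose suites are the images of the closed galleries of $\Delta$ of alternating type $s,t,s,t,\dots$ and length $2m_{st}$ ($s\ne t$, $m_{st}<\infty$) with distinct consecutive chambers. Put $\delta=q^2+q+1$. A difference set of order $q$ is a set $\mathcal D\subseteq\mathbb Z/\delta\mathbb Z$ such that each non-zero $n\in\mathbb Z/\delta\mathbb Z$ is $d-d'$ for exactly one pair $(d,d')\in\mathcal D\times\mathcal D$; it is based if $0\in\mathcal D$. Let $\mathcal C=\mathbb Z/k\mathbb Z$, $\mathcal C^*=\mathcal C\setminus\{0\}=\{1,\dots,q\}$. The Singer cyclic digon $k\backslash\mathbb D(q)$ has chamber set $\mathcal C$, exactly one edge of each of its two types $s,t$ between any two chambers, and defining suites $[0\xrightarrow{s}y\xrightarrow{t}z\xrightarrow{s}z-y\xrightarrow{t}0]$ with $0\ne y\ne z$. For a based difference set $\mathcal D$ the Singer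 cyclic triangle $\delta\backslash\mathcal T(\mathcal D)$ has chamber set $\mathcal D$, exactly one edge of each of its two types between any two chambers, and defining suites $[0\xrightarrow{s}x\xrightarrow{t}y\xrightarrow{s}z\xrightarrow{t}y'\xrightarrow{s}x'\xrightarrow{t}0]$ with $0\neq x\neq y\neq z$ and $y'-x'=x-y+z$. Let $\bar E\subseteq S\times S$ be an orientation of $L$. A gluing matrix of type $M$ and order $q$ is a map $\mathcal M:\mathcal C^*\times\bar E\to\mathbb Z_{\ge1}$ such that for $(s,t)\in\bar E$ the column $\mathcal M(-,(s,t))$ is a permutation of $\mathcal C^*$ if $m_{st}=2$, and a bijection from $\mathcal C^*$ onto $\mathcal D^*=\mathcal D\setminus\{0\}$ for some based difference set $\mathcal D$ of order $q$ if $m_{st}=3$ (residue classes being identified with their least non-negative representatives). Let $\Omega_{st}$ map $0\mapsto0$ and $n\mapsto\mathcal M(n,(s,t))$ for $n\in\mathcal C^*$, with values in $\mathbb Z/k\mathbb Z$ if $m_{st}=2$ and in $\mathbb Z/\delta\mathbb Z$ if $m_{st}=3$. The Weyl graph $\mathcal W_{\mathcal M}$ has chamber set $\mathcal C$, exactly one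 edge of each type $s\in S$ between any two chambers, and as defining suites the $\Omega_{st}$-preimages, for $(s,t)\in\bar E$, of the defining suites of $k\backslash\mathbb D(q)$ (if $m_{st}=2$), resp. of $\delta\backslash\mathcal T(\mathcal D)$ with $\mathcal D=\mathcal M(-,(s,t))\cup\{0\}$ (if $m_{st}=3$). Given a bijection $\iota$ from the chambers of $\Gamma\backslash\Delta$ to $\mathcal C$, the gluing matrix $\mathcal M$ is associated to $\Gamma$ if for each $(s,t)\in\bar E$ the map $\Omega_{st}\circ\iota$ is the chamber map of an isomorphism from the $\{s,t\}$-residue of $\Gamma\backslash\Delta$ to $k\backslash\mathbb D(q)$, resp. $\delta\backslash\mathcal T(\mathcal D)$. Theorem. For every orientation $\bar E$ of $L$ and every bijection $\iota$ as above, there exists a gluing matrix associated to $\Gamma$. If $\mathcal M$ is any gluing matrix associated to $\Gamma$, then $\Gamma\backslash\Delta\cong\mathcal W_{\mathcal M}$. Hence every such lattice arises from the gluing-matrix construction: with $\Gamma_{\mathcal M}=\pi_1(\mathcal W_{\mathcal M},0)$ and $\Delta_{\mathcal M}=\widetilde{\mathcal W_{\mathcal M}}$ based at $0$, there are a group isomorphism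 $\varphi:\Gamma\to\Gamma_{\mathcal M}$ and a bijection $f:\Delta\to\Delta_{\mathcal M}$ on chambers that preserves and reflects $s$-equivalence for every $s\in S$ and satisfies $f(\gamma C)=\varphi(\gamma)f(C)$ for all $\gamma\in\Gamma$ and all chambers $C$. -/

import Mathlib

open scoped Pointwise

universe u v w v' w' u'

/-! ## Panel groupoids and galleries -/

/-- Chambers together with, for every label `s`, a groupoid (the panel groupoid of type `s`)
whose objects are the chambers. Composition is written in path order. -/
structure PanelSystem (S : Type u) where
  Chamber : Type v
  Edge : S → Chamber → Chamber → Type w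
  one : ∀ (s : S) (x : Chamber), Edge s x x
  comp : ∀ {s : S} {x y z : Chamber}, Edge s x y → Edge s y z → Edge s x z
  inv : ∀ {s : S} {x y : Chamber}, Edge s x y → Edge s y x
  one_comp : ∀ {s : S} {x y : Chamber} (e : Edge s x y), comp (one s x) e = e
  comp_one : ∀ {s : S} {x y : Chamber} (e : Edge s x y), comp e (one s y) = e
  assoc : ∀ {s : S} {x y z t : Chamber} (e : Edge s x y) (f : Edge s y z) (g : Edge s z t),
    comp (comp e f) g = comp e (comp f g)
  comp_inv : ∀ {s : S} {x y : Chamber} (e : Edge s x y), comp e (inv e) = one s x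
  inv_comp : ∀ {s : S} {x y : Chamber} (e : Edge s x y), comp (inv e) e = one s y

namespace PanelSystem

/-- A gallery from `x` to `y`: a finite path of labelled edges. -/
inductive Gallery {S : Type u} (P : PanelSystem.{u, v, w} S) :
    P.Chamber → P.Chamber → Type (max u v w)
  | nil (x : P.Chamber) : Gallery P x x
  | cons {x y z : P.Chamber} (s : S) (e : P.Edge s x y) (g : Gallery P y z) : Gallery P x z

namespace Gallery

variable {S : Type u} {P : PanelSystem.{u, v, w} S}

/-- The gallery consisting of one edge. -/
def single {x y : P.Chamber} (s : S) (e : P.Edge s x y) : P.Gallery x y := cons s e (nil y)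

/-- Concatenation of galleries. -/
def append : ∀ {x y z : P.Chamber}, P.Gallery x y → P.Gallery y z → P.Gallery x z
  | _, _, _, nil _, h => h
  | _, _, _, cons s e g, h => cons s e (append g h)

/-- The inverse gallery. -/
def reverse : ∀ {x y : P.Chamber}, P.Gallery x y → P.Gallery y x
  | _, _, nil x => nil x
  | _, _, cons s e g => append (reverse g) (single s (P.inv e))

/-- The list of labels of the edges of a gallery. -/
def types : ∀ {x y : P.Chamber}, P.Gallery x y → List S
  | _, _, nil _ => []
  | _, _, cons s _ g => s :: types g

/-- The list of all chambers visited by a gallery, including both ends. -/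
def chambers : ∀ {x y : P.Chamber}, P.Gallery x y → List P.Chamber
  | _, _, nil x => [x]
  | x, _, cons _ _ g => x :: chambers g

theorem nil_append {x y : P.Chamber} (g : P.Gallery x y) : append (nil x) g = g := rfl

theorem append_nil : ∀ {x y : P.Chamber} (g : P.Gallery x y), append g (nil y) = g
  | _, _, nil _ => rfl
  | _, _, cons s e g => congrArg (cons s e) (append_nil g)

theorem append_assoc : ∀ {x y z t : P.Chamber} (g : P.Gallery x y) (h : P.Gallery y z)
    (k : P.Gallery z t), append (append g h) k = append g (append h k)
  | _, _, _, _, nil _, _, _ => rfl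
  | _, _, _, _, cons s e g, h, k => congrArg (cons s e) (append_assoc g h k)

theorem reverse_append : ∀ {x y z : P.Chamber} (g : P.Gallery x y) (h : P.Gallery y z),
    reverse (append g h) = append (reverse h) (reverse g)
  | _, _, _, nil _, h => (append_nil (reverse h)).symm
  | _, _, _, cons s e g, h => by
      have := reverse_append g h
      simp only [append, reverse, this, append_assoc]

end Gallery

/-- A label-preserving morphism: a map on chambers and functors on the panel groupoids. -/
structure Hom {S : Type u} (P : PanelSystem.{u, v, w} S) (P' : PanelSystem.{u, v', w'} S) where
  chamber : P.Chamber → P'.Chamber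
  edge : ∀ {s : S} {x y : P.Chamber}, P.Edge s x y → P'.Edge s (chamber x) (chamber y)
  edge_comp : ∀ {s : S} {x y z : P.Chamber} (e : P.Edge s x y) (f : P.Edge s y z),
    edge (P.comp e f) = P'.comp (edge e) (edge f)

/-- The image of a gallery under a morphism. -/
def Hom.gallery {S : Type u} {P : PanelSystem.{u, v, w} S} {P' : PanelSystem.{u, v', w'} S}
    (F : P.Hom P') : ∀ {x y : P.Chamber}, P.Gallery x y →
      P'.Gallery (F.chamber x) (F.chamber y)
  | _, _, .nil x => .nil (F.chamber x)
  | _, _, .cons s e g => .cons s (F.edge e) (F.gallery g)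

/-- Keep only the edges whose label is in the range of `f`, relabelled through `f`. -/
def restrict {S : Type u} {I : Type u'} (P : PanelSystem.{u, v, w} S) (f : I → S) :
    PanelSystem.{u', v, w} I where
  Chamber := P.Chamber
  Edge i := P.Edge (f i)
  one i := P.one (f i)
  comp := P.comp
  inv := P.inv
  one_comp := P.one_comp
  comp_one := P.comp_one
  assoc := P.assoc
  comp_inv := P.comp_inv
  inv_comp := P.inv_comp

/-- A gallery of the restricted system, seen in the original one. -/
def unrestrict {S : Type u} {I : Type u'} (P : PanelSystem.{u, v, w} S) (f : I → S) :
    ∀ {x y : P.Chamber}, (P.restrict f).Gallery x y → P.Gallery x y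
  | _, _, .nil x => Gallery.nil (P := P) x
  | _, _, .cons i e g => Gallery.cons (P := P) (f i) e (unrestrict P f g)

/-- The system on a set `C` of chambers in which every panel groupoid is the connected setoid:
there is exactly one edge of each type from any chamber to any chamber. -/
def connectedSetoid (S : Type u) (C : Type v) : PanelSystem.{u, v, 0} S where
  Chamber := C
  Edge _ _ _ := PUnit
  one _ _ := PUnit.unit
  comp _ _ := PUnit.unit
  inv _ := PUnit.unit
  one_comp _ := rfl
  comp_one _ := rfl
  assoc _ _ _ := rfl
  comp_inv _ := rfl
  inv_comp _ := rfl

end PanelSystem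

/-! ## Weyl data, homotopy, isomorphisms, fundamental group and universal cover -/

/-- Weyl data: panel groupoids together with a set of closed galleries, the defining suites. -/
structure WeylData (S : Type u) extends PanelSystem.{u, v, w} S where
  IsSuite : ∀ {x : Chamber}, toPanelSystem.Gallery x x → Prop

namespace WeylData

open PanelSystem

/-- Homotopy of galleries: the congruence generated by the composition of edges inside the panel
groupoids and by deleting defining suites. -/
inductive Homotopic {S : Type u} (W : WeylData.{u, v, w} S) :
    ∀ {x y : W.Chamber}, W.Gallery x y → W.Gallery x y → Prop
  | refl {x y : W.Chamber} (g : W.Gallery x y) : Homotopic W g g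
  | symm {x y : W.Chamber} {g h : W.Gallery x y} : Homotopic W g h → Homotopic W h g
  | trans {x y : W.Chamber} {g h k : W.Gallery x y} :
      Homotopic W g h → Homotopic W h k → Homotopic W g k
  | append {x y z : W.Chamber} {g g' : W.Gallery x y} {h h' : W.Gallery y z} :
      Homotopic W g g' → Homotopic W h h' → Homotopic W (g.append h) (g'.append h')
  | one (s : S) (x : W.Chamber) : Homotopic W (Gallery.single s (W.one s x)) (Gallery.nil x)
  | comp {s : S} {x y z : W.Chamber} (e : W.Edge s x y) (f : W.Edge s y z) :
      Homotopic W (Gallery.cons s e (Gallery.single s f)) (Gallery.single s (W.comp e f))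
  | suite {x : W.Chamber} (g : W.Gallery x x) : W.IsSuite g → Homotopic W g (Gallery.nil x)

/-- An isomorphism of Weyl graphs: bijective on chambers and on the edges of each type, compatible
with the panel groupoids, and identifying the homotopy relations. -/
structure Iso {S : Type u} (W : WeylData.{u, v, w} S) (W' : WeylData.{u, v', w'} S) extends
    Hom W.toPanelSystem W'.toPanelSystem where
  chamber_bijective : Function.Bijective chamber
  edge_bijective : ∀ (s : S) (x y : W.Chamber),
    Function.Bijective (fun e : W.Edge s x y => edge e)
  homotopic_iff : ∀ {x y : W.Chamber} (g h : W.Gallery x y),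
    W.Homotopic g h ↔ W'.Homotopic (toHom.gallery g) (toHom.gallery h)

/-- The part of the Weyl data that only uses the labels `s` and `t`, relabelled by `0` and `1`.
It is the disjoint union of the `{s, t}`-residues; when each panel groupoid is connected
there is only one `{s, t}`-residue, and this is it. -/
def residue {S : Type u} (W : WeylData.{u, v, w} S) (s t : S) : WeylData.{0, v, w} (Fin 2) where
  toPanelSystem := W.toPanelSystem.restrict ![s, t]
  IsSuite {x} g := W.IsSuite (x := x) (W.toPanelSystem.unrestrict ![s, t] g)

section Fundamental

variable {S : Type u} (W : WeylData.{u, v, w} S)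

/-- Homotopy as a setoid. -/
def homotopySetoid (x y : W.Chamber) : Setoid (W.Gallery x y) where
  r := W.Homotopic
  iseqv := ⟨Homotopic.refl, Homotopic.symm, Homotopic.trans⟩

/-- Homotopy classes of galleries from `x` to `y`. -/
def HomotopyClass (x y : W.Chamber) : Type (max u v w) := Quotient (W.homotopySetoid x y)

variable {W}

/-- The class of a gallery. -/
def HomotopyClass.mk {x y : W.Chamber} (g : W.Gallery x y) : W.HomotopyClass x y :=
  Quotient.mk (W.homotopySetoid x y) g

/-- Concatenation of homotopy classes. -/
def HomotopyClass.append {x y z : W.Chamber} :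
    W.HomotopyClass x y → W.HomotopyClass y z → W.HomotopyClass x z :=
  Quotient.map₂ Gallery.append (fun _ _ hg _ _ hh => Homotopic.append hg hh)

theorem homotopic_cons {s : S} {x y z : W.Chamber} (e : W.Edge s x y) {g h : W.Gallery y z}
    (H : W.Homotopic g h) : W.Homotopic (Gallery.cons s e g) (Gallery.cons s e h) :=
  Homotopic.append (Homotopic.refl (Gallery.single s e)) H

theorem homotopic_edge_inv {s : S} {x y : W.Chamber} (e : W.Edge s x y) :
    W.Homotopic (Gallery.cons s e (Gallery.single s (W.inv e))) (Gallery.nil x) := by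
  refine (Homotopic.comp e (W.inv e)).trans ?_
  rw [W.comp_inv]
  exact Homotopic.one s x

theorem homotopic_inv_edge {s : S} {x y : W.Chamber} (e : W.Edge s x y) :
    W.Homotopic (Gallery.cons s (W.inv e) (Gallery.single s e)) (Gallery.nil y) := by
  refine (Homotopic.comp (W.inv e) e).trans ?_
  rw [W.inv_comp]
  exact Homotopic.one s y

theorem homotopic_reverse_append : ∀ {x y : W.Chamber} (g : W.Gallery x y),
    W.Homotopic (g.reverse.append g) (Gallery.nil y)
  | _, _, .nil x => Homotopic.refl _
  | _, _, .cons s e g => by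
      rw [Gallery.reverse, Gallery.append_assoc]
      refine (Homotopic.append (Homotopic.refl _) (h' := g) ?_).trans (homotopic_reverse_append g)
      exact Homotopic.append (homotopic_inv_edge e) (Homotopic.refl g)

theorem homotopic_append_reverse : ∀ {x y : W.Chamber} (g : W.Gallery x y),
    W.Homotopic (g.append g.reverse) (Gallery.nil x)
  | _, _, .nil x => Homotopic.refl _
  | _, _, .cons s e g => by
      rw [Gallery.reverse, Gallery.append, ← Gallery.append_assoc]
      refine (homotopic_cons e
        (Homotopic.append (homotopic_append_reverse g) (Homotopic.refl _))).trans ?_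
      exact homotopic_edge_inv e

theorem homotopic_reverse {x y : W.Chamber} {g h : W.Gallery x y} (H : W.Homotopic g h) :
    W.Homotopic g.reverse h.reverse := by
  have h1 : W.Homotopic (g.reverse.append (h.append h.reverse)) g.reverse := by
    have := Homotopic.append (Homotopic.refl g.reverse) (homotopic_append_reverse h)
    rwa [Gallery.append_nil] at this
  have h2 : W.Homotopic ((g.reverse.append g).append h.reverse) h.reverse :=
    Homotopic.append (homotopic_reverse_append g) (Homotopic.refl h.reverse)
  rw [Gallery.append_assoc] at h2
  refine h1.symm.trans (Homotopic.trans ?_ h2)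
  exact Homotopic.append (Homotopic.refl _) (Homotopic.append H.symm (Homotopic.refl _))

/-- The inverse of a homotopy class. -/
def HomotopyClass.reverse {x y : W.Chamber} : W.HomotopyClass x y → W.HomotopyClass y x :=
  Quotient.map Gallery.reverse (fun _ _ H => homotopic_reverse H)

theorem HomotopyClass.append_assoc {x y z t : W.Chamber} (a : W.HomotopyClass x y)
    (b : W.HomotopyClass y z) (c : W.HomotopyClass z t) :
    (a.append b).append c = a.append (b.append c) := by
  induction a using Quotient.inductionOn
  induction b using Quotient.inductionOn
  induction c using Quotient.inductionOn
  exact congrArg HomotopyClass.mk (Gallery.append_assoc _ _ _)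

theorem HomotopyClass.nil_append {x y : W.Chamber} (a : W.HomotopyClass x y) :
    (HomotopyClass.mk (Gallery.nil x)).append a = a := by
  induction a using Quotient.inductionOn
  rfl

theorem HomotopyClass.append_nil {x y : W.Chamber} (a : W.HomotopyClass x y) :
    a.append (HomotopyClass.mk (Gallery.nil y)) = a := by
  induction a using Quotient.inductionOn
  exact congrArg HomotopyClass.mk (Gallery.append_nil _)

theorem HomotopyClass.reverse_append_self {x y : W.Chamber} (a : W.HomotopyClass x y) :
    a.reverse.append a = HomotopyClass.mk (Gallery.nil y) := by
  induction a using Quotient.inductionOn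
  exact Quotient.sound (homotopic_reverse_append _)

variable (W)

/-- The fundamental group at `x`: homotopy classes of closed galleries at `x`. -/
def FundamentalGroup (x : W.Chamber) : Type (max u v w) := W.HomotopyClass x x

instance (x : W.Chamber) : Mul (W.FundamentalGroup x) :=
  ⟨fun a b => HomotopyClass.append (W := W) (x := x) (y := x) a b⟩

instance (x : W.Chamber) : One (W.FundamentalGroup x) := ⟨HomotopyClass.mk (Gallery.nil x)⟩

instance (x : W.Chamber) : Inv (W.FundamentalGroup x) :=
  ⟨fun a => HomotopyClass.reverse (W := W) (x := x) (y := x) a⟩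

instance (x : W.Chamber) : Group (W.FundamentalGroup x) :=
  Group.ofLeftAxioms (G := W.FundamentalGroup x)
    (fun a b c => HomotopyClass.append_assoc (W := W) (x := x) (y := x) (z := x) (t := x) a b c)
    (fun a => HomotopyClass.nil_append (W := W) (x := x) (y := x) a)
    (fun a => HomotopyClass.reverse_append_self (W := W) (x := x) (y := x) a)

/-- The chambers of the universal cover based at `x`: homotopy classes of galleries issuing
from `x`. -/
def UniversalCover (x : W.Chamber) : Type (max u v w) := Σ y : W.Chamber, W.HomotopyClass x y

/-- Two chambers of the universal cover are `s`-equivalent when they differ by an edge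
of type `s`. -/
def UniversalCover.Adj {x : W.Chamber} (s : S) (a b : W.UniversalCover x) : Prop :=
  ∃ e : W.Edge s a.1 b.1, b.2 = a.2.append (HomotopyClass.mk (Gallery.single s e))

/-- The fundamental group acts on the universal cover by concatenation on the left. -/
instance (x : W.Chamber) : MulAction (W.FundamentalGroup x) (W.UniversalCover x) where
  smul a b := ⟨b.1, HomotopyClass.append (W := W) (x := x) (y := x) a b.2⟩
  one_smul b := Sigma.ext rfl (heq_of_eq (HomotopyClass.nil_append b.2))
  mul_smul a a' b := Sigma.ext rfl (heq_of_eq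
    (HomotopyClass.append_assoc (W := W) (x := x) (y := x) (z := x) a a' b.2))

end Fundamental

end WeylData

/-! ## Buildings of type `M`, their automorphisms and Singer cyclic lattices -/

/-- A building of type `M`, as a set of chambers with a Weyl distance. -/
structure Building {S : Type u} (M : CoxeterMatrix S) where
  Chamber : Type v
  nonempty : Nonempty Chamber
  dist : Chamber → Chamber → M.Group
  dist_eq_one_iff : ∀ C D : Chamber, dist C D = 1 ↔ C = D
  dist_mem : ∀ (s : S) (C' C D : Chamber), dist C' C = M.simple s →
    dist C' D = M.simple s * dist C D ∨ dist C' D = dist C D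
  dist_eq_mul : ∀ (s : S) (C' C D : Chamber), dist C' C = M.simple s →
    M.toCoxeterSystem.length (M.simple s * dist C D) =
      M.toCoxeterSystem.length (dist C D) + 1 →
    dist C' D = M.simple s * dist C D
  exists_dist_eq : ∀ (s : S) (C D : Chamber), ∃ C' : Chamber,
    dist C' C = M.simple s ∧ dist C' D = M.simple s * dist C D

namespace Building

variable {S : Type u} {M : CoxeterMatrix S} (Δ : Building.{u, v} M)

/-- `s`-equivalence of chambers. -/
def Adj (s : S) (C D : Δ.Chamber) : Prop := Δ.dist C D = 1 ∨ Δ.dist C D = M.simple s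

/-- The panel of type `s` containing `C`. -/
def panel (s : S) (C : Δ.Chamber) : Set Δ.Chamber := {D | Δ.Adj s C D}

/-- The `{s, t}`-residue containing `C`. -/
def residue (s t : S) (C : Δ.Chamber) : Set Δ.Chamber :=
  {D | Δ.dist C D ∈ Subgroup.closure {M.simple s, M.simple t}}

/-- All panels are finite. -/
def LocallyFinite : Prop := ∀ (s : S) (C : Δ.Chamber), (Δ.panel s C).Finite

/-- The group of type-preserving automorphisms: permutations of the chambers that preserve the
Weyl distance. -/
def Aut : Subgroup (Equiv.Perm Δ.Chamber) where
  carrier := {f | ∀ C D, Δ.dist (f C) (f D) = Δ.dist C D}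
  mul_mem' {f g} hf hg C D := by
    rw [Equiv.Perm.mul_apply, Equiv.Perm.mul_apply, hf, hg]
  one_mem' _ _ := rfl
  inv_mem' {f} hf C D := by
    have := hf (f⁻¹ C) (f⁻¹ D)
    simpa using this.symm

/-- `Γ` acts regularly (freely and transitively) on the set of panels of each type. -/
def PanelRegular (Γ : Subgroup Δ.Aut) : Prop :=
  ∀ (s : S) (C D : Δ.Chamber), ∃! γ : Γ, γ • Δ.panel s C = Δ.panel s D

/-- `Γ` is a Singer cyclic lattice of order `q`: it is panel-regular, the quotient has `q + 1`
chambers, and the stabilizers of the spherical `2`-residues are cyclic. -/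
structure IsSingerCyclicLattice (Γ : Subgroup Δ.Aut) (q : ℕ) : Prop where
  panelRegular : Δ.PanelRegular Γ
  card_quotient : Nat.card (MulAction.orbitRel.Quotient Γ Δ.Chamber) = q + 1
  isCyclic_stabilizer : ∀ (s t : S) (C : Δ.Chamber), s ≠ t → M s t ≠ 0 →
    IsCyclic (MulAction.stabilizer Γ (Δ.residue s t C))

/-- Only the identity of `Γ` fixes a chamber. -/
def ChamberFree (Γ : Subgroup Δ.Aut) : Prop :=
  ∀ (γ : Γ) (C : Δ.Chamber), γ • C = C → γ = 1

variable {Δ}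

theorem adj_refl (s : S) (C : Δ.Chamber) : Δ.Adj s C C :=
  Or.inl ((Δ.dist_eq_one_iff C C).2 rfl)

theorem adj_symm {s : S} {C D : Δ.Chamber} (h : Δ.Adj s C D) : Δ.Adj s D C := by
  rcases h with h | h
  · obtain rfl := (Δ.dist_eq_one_iff C D).1 h
    exact adj_refl s C
  · have h1 : Δ.dist C C = 1 := (Δ.dist_eq_one_iff C C).2 rfl
    rcases Δ.dist_mem s C D C h with h2 | h2
    · right
      rw [h1] at h2
      have h3 := eq_inv_of_mul_eq_one_right h2.symm
      rw [h3]
      exact M.toCoxeterSystem.inv_simple s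
    · left
      rw [← h2, h1]

theorem adj_trans {s : S} {C D E : Δ.Chamber} (h : Δ.Adj s C D) (h' : Δ.Adj s D E) :
    Δ.Adj s C E := by
  rcases h with h | h
  · obtain rfl := (Δ.dist_eq_one_iff C D).1 h
    exact h'
  · rcases h' with h' | h' <;> rcases Δ.dist_mem s C D E h with h2 | h2 <;> rw [h'] at h2
    · right
      rw [h2, mul_one]
    · exact Or.inl h2
    · left
      rw [h2]
      exact M.toCoxeterSystem.simple_mul_simple_self s
    · exact Or.inr h2

theorem adj_smul {Γ : Subgroup Δ.Aut} (γ : Γ) {s : S} {C D : Δ.Chamber} (h : Δ.Adj s C D) :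
    Δ.Adj s (γ • C) (γ • D) := by
  have h1 : Δ.dist (γ • C) (γ • D) = Δ.dist C D := γ.1.2 C D
  unfold Adj
  rw [h1]
  exact h

theorem smul_panel {Γ : Subgroup Δ.Aut} (γ : Γ) (s : S) (C : Δ.Chamber) :
    γ • Δ.panel s C = Δ.panel s (γ • C) := by
  ext D
  rw [Set.mem_smul_set_iff_inv_smul_mem]
  constructor
  · intro h
    have h1 := adj_smul γ (show Δ.Adj s C (γ⁻¹ • D) from h)
    rwa [smul_inv_smul] at h1
  · intro h
    have h1 := adj_smul γ⁻¹ (show Δ.Adj s (γ • C) D from h)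
    rwa [inv_smul_smul] at h1

theorem PanelRegular.chamberFree {Γ : Subgroup Δ.Aut} (h : Δ.PanelRegular Γ) (hS : Nonempty S) :
    Δ.ChamberFree Γ := by
  intro γ C hC
  obtain ⟨s⟩ := hS
  refine (h s C C).unique ?_ (one_smul _ _)
  rw [smul_panel, hC]

variable (Δ)

/-- The panel system of a building: a unique edge of type `s` between any two `s`-equivalent
chambers. -/
def toPanelSystem : PanelSystem.{u, v, 0} S where
  Chamber := Δ.Chamber
  Edge s C D := PLift (Δ.Adj s C D)
  one s C := ⟨adj_refl s C⟩
  comp e f := ⟨adj_trans e.down f.down⟩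
  inv e := ⟨adj_symm e.down⟩
  one_comp _ := rfl
  comp_one _ := rfl
  assoc _ _ _ := rfl
  comp_inv _ := rfl
  inv_comp _ := rfl

/-- A suite of a building: a closed gallery without repeated consecutive chambers whose type
is `s, t, s, t, …` of length `2 m_{st}`, where `m_{st}` is finite. -/
def IsSuite {C : Δ.Chamber} (g : Δ.toPanelSystem.Gallery C C) : Prop :=
  ∃ s t : S, s ≠ t ∧ M s t ≠ 0 ∧ g.types = CoxeterSystem.alternatingWord s t (2 * M s t) ∧
    List.IsChain (· ≠ ·) g.chambers

/-! ### The quotient of a building by a chamber-free group -/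

/-- Pairs of `s`-equivalent chambers, the first in the orbit `X` and the second in
the orbit `Y`. -/
def OrbitPair (Γ : Subgroup Δ.Aut) (s : S) (X Y : MulAction.orbitRel.Quotient Γ Δ.Chamber) :
    Type v :=
  {p : Δ.Chamber × Δ.Chamber //
    (Quotient.mk _ p.1 : MulAction.orbitRel.Quotient Γ Δ.Chamber) = X ∧
    (Quotient.mk _ p.2 : MulAction.orbitRel.Quotient Γ Δ.Chamber) = Y ∧ Δ.Adj s p.1 p.2}

/-- The diagonal orbit relation on pairs of chambers. -/
def orbitPairSetoid (Γ : Subgroup Δ.Aut) (s : S)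
    (X Y : MulAction.orbitRel.Quotient Γ Δ.Chamber) : Setoid (Δ.OrbitPair Γ s X Y) where
  r p p' := ∃ γ : Γ, γ • p.1.1 = p'.1.1 ∧ γ • p.1.2 = p'.1.2
  iseqv :=
    { refl := fun p => ⟨1, one_smul _ _, one_smul _ _⟩
      symm := fun {p p'} ⟨γ, h1, h2⟩ => ⟨γ⁻¹, by rw [← h1, inv_smul_smul],
        by rw [← h2, inv_smul_smul]⟩
      trans := fun {p p' p''} ⟨γ, h1, h2⟩ ⟨γ', h1', h2'⟩ => ⟨γ' * γ,
        by rw [mul_smul, h1, h1'], by rw [mul_smul, h2, h2']⟩ }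

/-- The edges of type `s` of the quotient: orbits of pairs of `s`-equivalent chambers. -/
def OrbitEdge (Γ : Subgroup Δ.Aut) (s : S) (X Y : MulAction.orbitRel.Quotient Γ Δ.Chamber) :
    Type v :=
  Quotient (Δ.orbitPairSetoid Γ s X Y)

variable {Δ}

theorem orbit_mk_eq {Γ : Subgroup Δ.Aut} {C D : Δ.Chamber}
    (h : (Quotient.mk _ C : MulAction.orbitRel.Quotient Γ Δ.Chamber) = Quotient.mk _ D) :
    ∃ γ : Γ, γ • D = C :=
  Quotient.exact h

theorem orbit_mk_smul {Γ : Subgroup Δ.Aut} (γ : Γ) (C : Δ.Chamber) :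
    (Quotient.mk _ (γ • C) : MulAction.orbitRel.Quotient Γ Δ.Chamber) = Quotient.mk _ C :=
  Quotient.sound ⟨γ, rfl⟩

theorem ChamberFree.eq_of_smul_eq {Γ : Subgroup Δ.Aut} (h : Δ.ChamberFree Γ) {γ γ' : Γ}
    {C : Δ.Chamber} (H : γ • C = γ' • C) : γ = γ' := by
  have h1 : (γ'⁻¹ * γ) • C = C := by rw [mul_smul, H, inv_smul_smul]
  have h2 := h _ _ h1
  rwa [inv_mul_eq_one, eq_comm] at h2

/-- The orbit of a pair of `s`-equivalent chambers. -/
def OrbitEdge.mk (Γ : Subgroup Δ.Aut) {s : S} {C D : Δ.Chamber} (h : Δ.Adj s C D) :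
    Δ.OrbitEdge Γ s (Quotient.mk _ C) (Quotient.mk _ D) :=
  Quotient.mk (Δ.orbitPairSetoid Γ s _ _) ⟨(C, D), rfl, rfl, h⟩

theorem OrbitPair.exists_smul {Γ : Subgroup Δ.Aut} {s : S}
    {X Y Z : MulAction.orbitRel.Quotient Γ Δ.Chamber}
    (p : Δ.OrbitPair Γ s X Y) (r : Δ.OrbitPair Γ s Y Z) : ∃ γ : Γ, γ • r.1.1 = p.1.2 :=
  orbit_mk_eq (p.2.2.1.trans r.2.1.symm)

/-- Compose `(C, D)` and `(D', E)`, where `D = γ D'`, to `(C, γ E)`. -/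
noncomputable def OrbitPair.comp {Γ : Subgroup Δ.Aut} {s : S}
    {X Y Z : MulAction.orbitRel.Quotient Γ Δ.Chamber}
    (p : Δ.OrbitPair Γ s X Y) (r : Δ.OrbitPair Γ s Y Z) : Δ.OrbitPair Γ s X Z :=
  ⟨(p.1.1, (p.exists_smul r).choose • r.1.2), p.2.1, (orbit_mk_smul _ _).trans r.2.2.1,
    adj_trans p.2.2.2 (by
      have h := adj_smul (p.exists_smul r).choose r.2.2.2
      rwa [(p.exists_smul r).choose_spec] at h)⟩

/-- Composition of edges of the quotient, by matching representatives. -/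
noncomputable def OrbitEdge.comp {Γ : Subgroup Δ.Aut} (hfree : Δ.ChamberFree Γ) {s : S}
    {X Y Z : MulAction.orbitRel.Quotient Γ Δ.Chamber} :
    Δ.OrbitEdge Γ s X Y → Δ.OrbitEdge Γ s Y Z → Δ.OrbitEdge Γ s X Z :=
  Quotient.map₂ OrbitPair.comp (by
    rintro p p' ⟨γ, h1, h2⟩ r r' ⟨γ', h1', h2'⟩
    refine ⟨γ, h1, ?_⟩
    have h3 := (p.exists_smul r).choose_spec
    have h4 := (p'.exists_smul r').choose_spec
    change γ • (p.exists_smul r).choose • r.1.2 = (p'.exists_smul r').choose • r'.1.2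
    have h5 : γ * (p.exists_smul r).choose = (p'.exists_smul r').choose * γ' := by
      refine hfree.eq_of_smul_eq (C := r.1.1) ?_
      rw [mul_smul, h3, h2, mul_smul, h1', h4]
    rw [← mul_smul, h5, mul_smul, h2'])

theorem OrbitEdge.exists_rep {Γ : Subgroup Δ.Aut} {s : S} {C : Δ.Chamber}
    {Y : MulAction.orbitRel.Quotient Γ Δ.Chamber}
    (e : Δ.OrbitEdge Γ s (Quotient.mk _ C) Y) :
    ∃ (D : Δ.Chamber) (h : Δ.Adj s C D) (hY : Quotient.mk _ D = Y),
      e = hY ▸ OrbitEdge.mk Γ h := by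
  induction e using Quotient.inductionOn with
  | h p =>
    obtain ⟨⟨A, B⟩, h1, h2, h3⟩ := p
    obtain ⟨γ, hγ⟩ := orbit_mk_eq h1.symm
    have hD : Δ.Adj s C (γ • B) := by
      have := adj_smul γ h3
      rwa [hγ] at this
    subst h2
    have hY : (Quotient.mk _ (γ • B) : MulAction.orbitRel.Quotient Γ Δ.Chamber) =
      Quotient.mk _ B := orbit_mk_smul γ B
    refine ⟨γ • B, hD, hY, ?_⟩
    have key : ∀ (Y' : MulAction.orbitRel.Quotient Γ Δ.Chamber) (hY' : Quotient.mk _ (γ • B) = Y'),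
        (hY' ▸ OrbitEdge.mk Γ hD : Δ.OrbitEdge Γ s (Quotient.mk _ C) Y') =
          Quotient.mk (Δ.orbitPairSetoid Γ s _ _) ⟨(C, γ • B), rfl, hY', hD⟩ := by
      rintro _ rfl
      rfl
    rw [key]
    exact Quotient.sound ⟨γ, hγ, rfl⟩

theorem OrbitEdge.mk_comp {Γ : Subgroup Δ.Aut} (hfree : Δ.ChamberFree Γ) {s : S}
    {C D E : Δ.Chamber} (h : Δ.Adj s C D) (h' : Δ.Adj s D E) :
    OrbitEdge.comp hfree (OrbitEdge.mk Γ h) (OrbitEdge.mk Γ h') =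
      OrbitEdge.mk Γ (adj_trans h h') := by
  refine Quotient.sound ⟨1, one_smul _ _, ?_⟩
  set p : Δ.OrbitPair Γ s (Quotient.mk _ C) (Quotient.mk _ D) := ⟨(C, D), rfl, rfl, h⟩
  set r : Δ.OrbitPair Γ s (Quotient.mk _ D) (Quotient.mk _ E) := ⟨(D, E), rfl, rfl, h'⟩
  have h1 : (p.exists_smul r).choose • D = D := (p.exists_smul r).choose_spec
  have h2 := hfree _ _ h1
  change (1 : Γ) • (p.exists_smul r).choose • E = E
  rw [h2, one_smul, one_smul]

/-- The inverse of an edge of the quotient. -/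
def OrbitEdge.inv {Γ : Subgroup Δ.Aut} {s : S}
    {X Y : MulAction.orbitRel.Quotient Γ Δ.Chamber} :
    Δ.OrbitEdge Γ s X Y → Δ.OrbitEdge Γ s Y X :=
  Quotient.map (fun p => ⟨(p.1.2, p.1.1), p.2.2.1, p.2.1, adj_symm p.2.2.2⟩)
    (fun _ _ ⟨γ, h1, h2⟩ => ⟨γ, h2, h1⟩)

/-- The identity edges of the quotient. -/
noncomputable def OrbitEdge.one (Γ : Subgroup Δ.Aut) (s : S)
    (X : MulAction.orbitRel.Quotient Γ Δ.Chamber) : Δ.OrbitEdge Γ s X X :=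
  Quotient.mk (Δ.orbitPairSetoid Γ s _ _)
    ⟨(X.out, X.out), Quotient.out_eq X, Quotient.out_eq X, adj_refl s _⟩

theorem OrbitEdge.one_mk (Γ : Subgroup Δ.Aut) (s : S) (C : Δ.Chamber) :
    OrbitEdge.one Γ s (Quotient.mk _ C) = OrbitEdge.mk Γ (adj_refl s C) := by
  obtain ⟨γ, hγ⟩ := orbit_mk_eq
    (Quotient.out_eq (Quotient.mk _ C : MulAction.orbitRel.Quotient Γ Δ.Chamber)).symm
  exact Quotient.sound ⟨γ, hγ, hγ⟩

variable (Δ)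

/-- The panel system of the quotient `Γ \ Δ`. -/
noncomputable def quotientPanelSystem (Γ : Subgroup Δ.Aut) (hfree : Δ.ChamberFree Γ) :
    PanelSystem.{u, v, v} S where
  Chamber := MulAction.orbitRel.Quotient Γ Δ.Chamber
  Edge := Δ.OrbitEdge Γ
  one := OrbitEdge.one Γ
  comp := OrbitEdge.comp hfree
  inv := OrbitEdge.inv
  one_comp {s X Y} e := by
    induction X using Quotient.inductionOn
    obtain ⟨D, h, rfl, rfl⟩ := e.exists_rep
    rw [OrbitEdge.one_mk]
    exact OrbitEdge.mk_comp hfree _ _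
  comp_one {s X Y} e := by
    induction X using Quotient.inductionOn
    obtain ⟨D, h, rfl, rfl⟩ := e.exists_rep
    rw [OrbitEdge.one_mk]
    exact OrbitEdge.mk_comp hfree _ _
  assoc {s X Y Z T} e f g := by
    induction X using Quotient.inductionOn
    obtain ⟨D, h, rfl, rfl⟩ := e.exists_rep
    obtain ⟨E, h', rfl, rfl⟩ := f.exists_rep
    obtain ⟨F, h'', rfl, rfl⟩ := g.exists_rep
    simp only [OrbitEdge.mk_comp]
  comp_inv {s X Y} e := by
    induction X using Quotient.inductionOn
    obtain ⟨D, h, rfl, rfl⟩ := e.exists_rep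
    rw [OrbitEdge.one_mk]
    exact OrbitEdge.mk_comp hfree h (adj_symm h)
  inv_comp {s X Y} e := by
    induction X using Quotient.inductionOn
    obtain ⟨D, h, rfl, rfl⟩ := e.exists_rep
    rw [OrbitEdge.one_mk]
    exact OrbitEdge.mk_comp hfree (adj_symm h) h

/-- The quotient map `Δ → Γ \ Δ`. -/
noncomputable def quotientMap (Γ : Subgroup Δ.Aut) (hfree : Δ.ChamberFree Γ) :
    Δ.toPanelSystem.Hom (Δ.quotientPanelSystem Γ hfree) where
  chamber C := Quotient.mk _ C
  edge e := OrbitEdge.mk Γ e.down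
  edge_comp e f := (OrbitEdge.mk_comp hfree e.down f.down).symm

/-- The suites of `Γ \ Δ` are the images of the suites of `Δ`. -/
inductive IsQuotientSuite (Γ : Subgroup Δ.Aut) (hfree : Δ.ChamberFree Γ) :
    ∀ {X : (Δ.quotientPanelSystem Γ hfree).Chamber},
      (Δ.quotientPanelSystem Γ hfree).Gallery X X → Prop
  | mk {C : Δ.Chamber} (g : Δ.toPanelSystem.Gallery C C) (hg : Δ.IsSuite g) :
      IsQuotientSuite Γ hfree ((Δ.quotientMap Γ hfree).gallery g)

/-- The quotient Weyl graph `Γ \ Δ`. -/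
noncomputable def quotient (Γ : Subgroup Δ.Aut) (hfree : Δ.ChamberFree Γ) :
    WeylData.{u, v, v} S where
  toPanelSystem := Δ.quotientPanelSystem Γ hfree
  IsSuite g := Δ.IsQuotientSuite Γ hfree g

end Building

/-! ## Difference sets and the Singer cyclic digons and triangles -/

/-- A (cyclic) difference set of order `q`: every non-zero residue modulo `q² + q + 1` is
a difference of exactly one pair of elements. -/
def IsDifferenceSet (q : ℕ) (D : Set (ZMod (q ^ 2 + q + 1))) : Prop :=
  ∀ n : ZMod (q ^ 2 + q + 1), n ≠ 0 →
    ∃! p : ZMod (q ^ 2 + q + 1) × ZMod (q ^ 2 + q + 1), p.1 ∈ D ∧ p.2 ∈ D ∧ p.1 - p.2 = n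

/-- The chambers `0, y, z, z - y, 0` visited by the defining suites of the Singer cyclic digon. -/
def IsDigonCycle (q : ℕ) (l : List (ZMod (q + 1))) : Prop :=
  ∃ y z : ZMod (q + 1), 0 ≠ y ∧ y ≠ z ∧ l = [0, y, z, z - y, 0]

/-- The chambers `0, x, y, z, y', x', 0` visited by the defining suites of a Singer cyclic
triangle, where `y' - x' = x - y + z`. -/
def IsTriangleCycle (q : ℕ) (l : List (ZMod (q ^ 2 + q + 1))) : Prop :=
  ∃ x y z y' x' : ZMod (q ^ 2 + q + 1), 0 ≠ x ∧ x ≠ y ∧ y ≠ z ∧ y' - x' = x - y + z ∧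
    l = [0, x, y, z, y', x', 0]

/-- The Singer cyclic digon of order `q`, with chambers `ℤ/(q+1)`. -/
def singerDigon (q : ℕ) : WeylData.{0, 0, 0} (Fin 2) where
  toPanelSystem := PanelSystem.connectedSetoid (Fin 2) (ZMod (q + 1))
  IsSuite g := g.types = [0, 1, 0, 1] ∧ IsDigonCycle q g.chambers

/-- The Singer cyclic triangle of a based difference set `D` of order `q`, with chambers `D`. -/
def singerTriangle (q : ℕ) (D : Set (ZMod (q ^ 2 + q + 1))) : WeylData.{0, 0, 0} (Fin 2) where
  toPanelSystem := PanelSystem.connectedSetoid (Fin 2) D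
  IsSuite g := g.types = [0, 1, 0, 1, 0, 1] ∧
    IsTriangleCycle q (List.map (fun d : D => (d : ZMod (q ^ 2 + q + 1))) g.chambers)

/-! ## Gluing matrices and their Weyl graphs -/

/-- The defining graph of `M`: `s` and `t` are adjacent when `m_{st}` is finite (Mathlib encodes
the entry `∞` by `0`). -/
def definingGraph {S : Type u} (M : CoxeterMatrix S) : SimpleGraph S where
  Adj s t := s ≠ t ∧ M s t ≠ 0
  symm := ⟨fun s t h => ⟨h.1.symm, by rw [M.symmetric]; exact h.2⟩⟩
  loopless := ⟨fun _ h => h.1 rfl⟩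

/-- An orientation of the defining graph. -/
structure DefiningOrientation {S : Type u} (M : CoxeterMatrix S) where
  edges : Set (S × S)
  adj_of_mem : ∀ s t : S, (s, t) ∈ edges → (definingGraph M).Adj s t
  xor_mem : ∀ s t : S, (definingGraph M).Adj s t → Xor ((s, t) ∈ edges) ((t, s) ∈ edges)

/-- A gluing matrix of type `M` and order `q`. Residue classes are identified with their
least non-negative representatives. -/
structure GluingMatrix {S : Type u} (M : CoxeterMatrix S) (E : DefiningOrientation M) (q : ℕ) where
  entry : {n : ZMod (q + 1) // n ≠ 0} → E.edges → ℕ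
  entry_pos : ∀ n e, 1 ≤ entry n e
  digon : ∀ e : E.edges, M e.1.1 e.1.2 = 2 →
    Function.Injective (fun n => entry n e) ∧ Set.range (fun n => entry n e) = Set.Icc 1 q
  triangle : ∀ e : E.edges, M e.1.1 e.1.2 = 3 →
    ∃ D : Set (ZMod (q ^ 2 + q + 1)), IsDifferenceSet q D ∧ 0 ∈ D ∧
      Function.Injective (fun n => entry n e) ∧
      Set.range (fun n => entry n e) = ZMod.val '' (D \ {0})

namespace GluingMatrix

variable {S : Type u} {M : CoxeterMatrix S} {E : DefiningOrientation M} {q : ℕ}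

/-- The map `Ω_{st}`, with values read modulo `N`: it sends `0` to `0` and `n` to `n(st)`. -/
def Omega (A : GluingMatrix M E q) (N : ℕ) (e : E.edges) (x : ZMod (q + 1)) : ZMod N :=
  if h : x ≠ 0 then (A.entry ⟨x, h⟩ e : ZMod N) else 0

/-- The set `𝓜(-, (s,t)) ∪ {0}`, for an edge labelled `3`. -/
def diffSet (A : GluingMatrix M E q) (e : E.edges) : Set (ZMod (q ^ 2 + q + 1)) :=
  Set.range (A.Omega (q ^ 2 + q + 1) e)

/-- The Weyl graph of a gluing matrix: chambers `ℤ/(q+1)`, connected setoids as panel groupoids,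
and as defining suites the preimages under the maps `Ω_{st}` of the defining suites of the
Singer cyclic digons and triangles. -/
def weylGraph (A : GluingMatrix M E q) : WeylData.{u, 0, 0} S where
  toPanelSystem := PanelSystem.connectedSetoid S (ZMod (q + 1))
  IsSuite g := ∃ e : E.edges,
    (M e.1.1 e.1.2 = 2 ∧ g.types = [e.1.1, e.1.2, e.1.1, e.1.2] ∧
      IsDigonCycle q (List.map (A.Omega (q + 1) e) g.chambers)) ∨
    (M e.1.1 e.1.2 = 3 ∧ g.types = [e.1.1, e.1.2, e.1.1, e.1.2, e.1.1, e.1.2] ∧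
      IsTriangleCycle q (List.map (A.Omega (q ^ 2 + q + 1) e) g.chambers))

/-- The chamber `0` of the Weyl graph of a gluing matrix. -/
def base (A : GluingMatrix M E q) : A.weylGraph.Chamber := (0 : ZMod (q + 1))

/-- `A` is a gluing matrix associated to the Weyl graph `Q` (meant for `Q = Γ \ Δ`), whose chambers
are identified with `ℤ/(q+1)` by `ι`: every `Ω_{st}` is, on chambers, an isomorphism from
the `{s, t}`-residue of `Q` to the Singer cyclic digon, respectively to the Singer cyclic triangle
of the based difference set `𝓜(-, (s,t)) ∪ {0}`. -/
structure IsAssociated (A : GluingMatrix M E q) (Q : WeylData.{u, v, w} S)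
    (ι : Q.Chamber ≃ ZMod (q + 1)) : Prop where
  digon : ∀ e : E.edges, M e.1.1 e.1.2 = 2 →
    ∃ F : (Q.residue e.1.1 e.1.2).Iso (singerDigon q),
      ∀ X : Q.Chamber, (F.chamber X : ZMod (q + 1)) = A.Omega (q + 1) e (ι X)
  triangle : ∀ e : E.edges, M e.1.1 e.1.2 = 3 →
    ∃ F : (Q.residue e.1.1 e.1.2).Iso (singerTriangle q (A.diffSet e)),
      ∀ X : Q.Chamber, (show A.diffSet e from F.chamber X).1 =
        A.Omega (q ^ 2 + q + 1) e (ι X)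

end GluingMatrix

-- A panel-regular group meets every panel of `Δ` in exactly one chamber of each orbit. Hence the
-- quotient has exactly one edge of each type between any two chambers, its galleries are determined
-- by their types and chambers, and each of them lifts uniquely to `Δ` once the starting chamber is
-- fixed. For two Weyl data with such panel groupoids, a bijection of chambers is an isomorphism as
-- soon as it carries the suites of either one to null-homotopic galleries of the other. Everything
-- is thereby reduced to suites, that is, to residues of rank two.
--
-- Fix a chamber `C₀`. Panels of type `s` are indexed by the elements of `Γ` that move the panel of
-- `C₀` to them (`mover`). For a chamber `C` the quotient of its `s`-mover and its `t`-mover lies in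
-- the stabilizer of the `{s,t}`-residue of `C₀` and depends only on the orbit of `C` (`position`).
-- Along alternating galleries these quotients telescope, so that closing up is the vanishing of an
-- alternating product (`adj_iff_four`, `adj_iff_six`), and after a logarithm on the cyclic
-- stabilizer that of an alternating sum. For `m = 2` the positions fill the stabilizer. For `m = 3`
-- the residue is a projective plane, and the unique line through two distinct points makes the
-- positions a difference set, as in Singer's theorem (`existsUnique_position_of_three`). In the
-- Singer digons and triangles, conversely, alternating sum zero implies null-homotopic: collapsing
-- the edges of one label turns homotopy into a relation in a group (`homotopic_nil_iff_holonomy`),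
-- and all required relations follow from the defining ones (`digon_relation`, `triangle_relation`).
-- The coordinates so obtained are the columns of a gluing matrix.
--
-- For the last claim, `Δ` is simply connected: galleries with the same ends are homotopic through
-- suites (`homotopic_of_same_ends`). This rests on the fact that an element of `W` with two left
-- descents `s`, `t` starts with the longest element of the dihedral group they generate, and that
-- this group is finite; the exchange condition and an integral reflection representation give both.
-- Hence homotopy of galleries of the Weyl graph is detected by the ends of their lifts
-- (`homotopic_iff_dev_eq`), and lifting identifies the universal cover with `Δ` and the fundamental
-- group with `Γ`.

universe u'' v'' w''

/-! ### The exchange condition in Coxeter groups. -/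

namespace CoxeterSystem

open List

section Exchange

variable {B : Type*} {W : Type*} [Group W] {M : CoxeterMatrix B} (cs : CoxeterSystem M W)

open Classical in
/-- The action of a simple reflection on `W × ℤ/2` which records inversions. -/
noncomputable def inversionAct (i : B) : Function.End (W × ZMod 2) :=
  fun p => (cs.simple i * p.1 * cs.simple i, p.2 + if p.1 = cs.simple i then 1 else 0)

-- The second coordinate counts modulo 2 how often the given element occurs among the right
-- inversions of the word; this is why an action can detect inversions.
open Classical in
theorem prod_map_inversionAct (ω : List B) (p : W × ZMod 2) :
    (ω.map cs.inversionAct).prod p =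
      (cs.wordProd ω * p.1 * (cs.wordProd ω)⁻¹, p.2 + (cs.rightInvSeq ω).count p.1) := by
  induction ω with
  | nil =>
    change p = _
    simp
  | cons i ω ih =>
    rw [List.map_cons, List.prod_cons]
    change cs.inversionAct i ((ω.map cs.inversionAct).prod p) = _
    rw [ih]
    have h : (cs.wordProd ω * p.1 * (cs.wordProd ω)⁻¹ = cs.simple i) ↔
        ((cs.wordProd ω)⁻¹ * cs.simple i * cs.wordProd ω = p.1) := by
      constructor
      · intro h; rw [← h]; group
      · intro h; rw [← h]; group
    simp only [inversionAct, cs.wordProd_cons, mul_inv_rev, cs.inv_simple, rightInvSeq,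
      List.count_cons, beq_iff_eq, h, Prod.mk.injEq]
    refine ⟨by simp only [mul_assoc], ?_⟩
    split_ifs <;> simp [add_assoc]

/-- Deleting the `n`-th letter multiplies the product by the `n`-th right inversion on the right, or
by the `n`-th left inversion on the left. When the product is trivial, the two must agree. -/
theorem rightInvSeq_eq_leftInvSeq {ω : List B} (h : cs.wordProd ω = 1) :
    cs.rightInvSeq ω = cs.leftInvSeq ω := by
  refine List.ext_getElem (by simp) fun n h1 h2 => ?_
  have h3 := cs.wordProd_mul_getD_rightInvSeq ω n
  have h4 := cs.getD_leftInvSeq_mul_wordProd ω n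
  rw [h, one_mul, List.getD_eq_getElem _ _ h1] at h3
  rw [h, mul_one, List.getD_eq_getElem _ _ h2] at h4
  rw [h3, h4]

theorem wordProd_alternatingWord_two_mul (i j : B) (n : ℕ) :
    cs.wordProd (alternatingWord i j (2 * n)) = (cs.simple i * cs.simple j) ^ n := by
  rw [cs.prod_alternatingWord_eq_mul_pow]
  simp

theorem wordProd_alternatingWord_two_mul_succ (i j : B) (n : ℕ) :
    cs.wordProd (alternatingWord i j (2 * n + 1)) =
      cs.simple j * (cs.simple i * cs.simple j) ^ n := by
  rw [cs.prod_alternatingWord_eq_mul_pow]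
  have h1 : ¬ Even (2 * n + 1) := by simp
  have h2 : (2 * n + 1) / 2 = n := by omega
  rw [if_neg h1, h2]

theorem map_alternatingWord_prod {G : Type*} [Monoid G] (f : B → G) (i j : B) (n : ℕ) :
    ((alternatingWord i j (2 * n)).map f).prod = (f i * f j) ^ n := by
  induction n with
  | zero => simp [alternatingWord]
  | succ n ih =>
    rw [show 2 * (n + 1) = 2 * n + 1 + 1 by ring, alternatingWord_succ, alternatingWord_succ]
    simp [ih, pow_succ]

/-- The inversions of the relator `(ij)^m` repeat with period `m`, so each reflection is met an even
number of times and the mod 2 count vanishes. For `m = ∞`, encoded by `0`, the relator is empty. -/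
theorem inversionAct_isLiftable : M.IsLiftable cs.inversionAct := by
  classical
  intro i j
  rw [← map_alternatingWord_prod]
  funext p
  rw [cs.prod_map_inversionAct]
  have h1 : cs.wordProd (alternatingWord i j (2 * M i j)) = 1 := by
    rw [cs.wordProd_alternatingWord_two_mul, cs.simple_mul_simple_pow]
  rw [cs.rightInvSeq_eq_leftInvSeq h1, h1]
  have h2 : cs.leftInvSeq (alternatingWord i j (2 * M i j)) =
      (List.range (M i j + M i j)).map fun k => cs.wordProd (alternatingWord j i (2 * k + 1)) := by
    refine List.ext_getElem (by simp [two_mul]) fun n h1 h2 => ?_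
    rw [cs.getElem_leftInvSeq_alternatingWord i j (M i j) n (by simpa using h1)]
    simp
  have h3 : ∀ k, cs.wordProd (alternatingWord j i (2 * (M i j + k) + 1)) =
      cs.wordProd (alternatingWord j i (2 * k + 1)) := by
    intro k
    rw [cs.wordProd_alternatingWord_two_mul_succ, cs.wordProd_alternatingWord_two_mul_succ,
      pow_add, cs.simple_mul_simple_pow', one_mul]
  rw [h2, List.range_add, List.map_append, List.map_map]
  have h4 : ((fun k => cs.wordProd (alternatingWord j i (2 * k + 1))) ∘ fun x => M i j + x) =
      fun k => cs.wordProd (alternatingWord j i (2 * k + 1)) := funext h3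
  rw [h4, List.count_append]
  push_cast
  rw [CharTwo.add_self_eq_zero]
  change _ = p
  simp

-- The action factors through the group, so the parity of an inversion count depends on the element
-- and not on the word.
open Classical in
theorem count_rightInvSeq_eq {ω ω' : List B} (h : cs.wordProd ω = cs.wordProd ω') (t : W) :
    ((cs.rightInvSeq ω).count t : ZMod 2) = (cs.rightInvSeq ω').count t := by
  have key : ∀ ω : List B, cs.lift ⟨_, cs.inversionAct_isLiftable⟩ (cs.wordProd ω) =
      (ω.map cs.inversionAct).prod := by
    intro ω
    rw [wordProd, map_list_prod, List.map_map]
    congr 1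
    refine List.map_congr_left fun i _ => ?_
    exact cs.lift_apply_simple cs.inversionAct_isLiftable i
  have h1 := (key ω).symm.trans ((congrArg _ h).trans (key ω'))
  have h2 := congrFun h1 (t, 0)
  rw [cs.prod_map_inversionAct, cs.prod_map_inversionAct] at h2
  simpa using congrArg Prod.snd h2

/-- The strong exchange property for a simple reflection on the right. -/
theorem mem_rightInvSeq_of_isRightDescent {ω : List B} {i : B}
    (h : cs.IsRightDescent (cs.wordProd ω) i) : cs.simple i ∈ cs.rightInvSeq ω := by
  classical
  obtain ⟨ω', h1, h2⟩ := cs.exists_isReduced (cs.wordProd ω * cs.simple i)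
  have h3 : cs.wordProd (ω' ++ [i]) = cs.wordProd ω := by
    rw [cs.wordProd_append, cs.wordProd_singleton, ← h2, mul_assoc, cs.simple_mul_simple_self,
      mul_one]
  by_contra hn
  have h4 := cs.count_rightInvSeq_eq h3 (cs.simple i)
  -- Appending `i` conjugates the previous inversions by `i`, which fixes `i` itself, and adds `i`
  -- once at the end.
  rw [List.count_eq_zero_of_not_mem hn, ← List.concat_eq_append, cs.rightInvSeq_concat,
    List.concat_eq_append, List.count_append] at h4
  have h5 : cs.simple i = MulAut.conj (cs.simple i) (cs.simple i) := by simp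
  have h6 : (List.map (MulAut.conj (cs.simple i)) (cs.rightInvSeq ω')).count (cs.simple i) =
      (cs.rightInvSeq ω').count (cs.simple i) := by
    have h7 := List.count_map_of_injective (cs.rightInvSeq ω') _
      (MulAut.conj (cs.simple i)).injective (cs.simple i)
    rwa [← h5] at h7
  rw [h6] at h4
  -- An inversion `i` of the reduced word `ω'` would make the original element shorter than its
  -- product with `i`, against the descent hypothesis.
  have h7 : cs.simple i ∉ cs.rightInvSeq ω' := by
    intro h8
    have h9 := (cs.isRightInversion_of_mem_rightInvSeq h1 h8).2
    rw [← h2, mul_assoc, cs.simple_mul_simple_self, mul_one] at h9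
    exact absurd h (not_lt.2 h9.le)
  rw [List.count_eq_zero_of_not_mem h7] at h4
  simp at h4

theorem mem_leftInvSeq_of_isLeftDescent {ω : List B} {i : B}
    (h : cs.IsLeftDescent (cs.wordProd ω) i) : cs.simple i ∈ cs.leftInvSeq ω := by
  have h1 : cs.IsRightDescent (cs.wordProd ω.reverse) i := by
    rw [cs.wordProd_reverse]
    exact cs.isRightDescent_inv_iff.2 h
  have h2 := cs.mem_rightInvSeq_of_isRightDescent h1
  rwa [cs.rightInvSeq_reverse, List.mem_reverse] at h2

/-- Exchange for a product: if `i` is a left descent of `u * w`, where `u` is given by a word,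
then either `i` is a left inversion of the word, or it can be moved past `u`
to shorten `w`. -/
theorem mem_leftInvSeq_or_exists {ω : List B} {w : W} {i : B}
    (h : cs.IsLeftDescent (cs.wordProd ω * w) i) :
    cs.simple i ∈ cs.leftInvSeq ω ∨
      ∃ w', cs.length w' < cs.length w ∧ cs.simple i * (cs.wordProd ω * w) = cs.wordProd ω * w' := by
  obtain ⟨ω', h1, rfl⟩ := cs.exists_isReduced w
  rw [← cs.wordProd_append] at h
  obtain ⟨n, hn, h2⟩ := List.mem_iff_getElem.1 (cs.mem_leftInvSeq_of_isLeftDescent h)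
  rw [cs.length_leftInvSeq] at hn
  -- The letter deleted by the exchange lies either in `ω`, where it exhibits `i` as an inversion of
  -- `ω`, or in the reduced word of `w`, which becomes shorter.
  by_cases h3 : n < ω.length
  · left
    rw [← h2]
    have h4 : cs.leftInvSeq ω = (cs.leftInvSeq (ω ++ ω')).take ω.length := by
      rw [← cs.leftInvSeq_take, List.take_left]
    rw [h4]
    exact List.mem_take_iff_getElem.2 ⟨n, by rw [cs.length_leftInvSeq]; exact lt_min h3 hn, rfl⟩
  · right
    refine ⟨cs.wordProd (ω'.eraseIdx (n - ω.length)), ?_, ?_⟩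
    · refine (cs.length_wordProd_le _).trans_lt ?_
      rw [List.length_append] at hn
      rw [h1.eq, List.length_eraseIdx_of_lt (by omega)]
      omega
    · rw [← cs.wordProd_append, ← cs.wordProd_append, ← List.eraseIdx_append_of_length_le (by omega),
        ← cs.getD_leftInvSeq_mul_wordProd, List.getD_eq_getElem _ _ (by simpa using hn), h2]

end Exchange

end CoxeterSystem

/-! ### An integral reflection representation for the entries 2, 3, ∞. -/

namespace CoxeterMatrix

section Geometric

variable {S : Type*} (M : CoxeterMatrix S)

/-- The Coxeter matrix has off-diagonal entries `2`, `3`, `∞` only. -/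
def IsTwoThreeInfty : Prop := ∀ s t : S, s ≠ t → M s t = 2 ∨ M s t = 3 ∨ M s t = 0

/-- The integral Cartan matrix of a Coxeter matrix with entries `2`, `3`, `∞`. -/
def cartanEntry (s t : S) : ℤ :=
  if M s t = 1 then 2 else if M s t = 2 then 0 else if M s t = 3 then -1 else -2

/-- The simple reflections of the (dual) geometric representation. -/
def geomReflection (s : S) : Function.End (S → ℤ) :=
  fun f u => f u - M.cartanEntry s u * f s

theorem cartanEntry_symm (s t : S) : M.cartanEntry s t = M.cartanEntry t s := by
  simp [cartanEntry, M.symmetric s t]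

theorem geomReflection_apply (s : S) (f : S → ℤ) (u : S) :
    M.geomReflection s f u = f u - M.cartanEntry s u * f s := rfl

variable {M}

/-- For `m = 2, 3, ∞` the numbers `-2 cos (π / m)` are the integers `0, -1, -2`, so the
representation is integral and each braid relation is a polynomial identity. -/
theorem geomReflection_isLiftable (hM : M.IsTwoThreeInfty) : M.IsLiftable M.geomReflection := by
  intro s t
  have hs : M.cartanEntry s s = 2 := by simp [cartanEntry]
  have ht : M.cartanEntry t t = 2 := by simp [cartanEntry]
  by_cases hst : s = t
  · subst hst
    rw [M.diagonal, pow_one]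
    funext f u
    change M.geomReflection s (M.geomReflection s f) u = f u
    simp only [geomReflection_apply, hs]
    ring
  · have hsymm := M.cartanEntry_symm s t
    rcases hM s t hst with h | h | h
    · have h1 : M.cartanEntry s t = 0 := by simp [cartanEntry, h]
      rw [h]
      funext f u
      change M.geomReflection s (M.geomReflection t (M.geomReflection s (M.geomReflection t f))) u =
        f u
      simp only [geomReflection_apply, hs, ht, ← hsymm, h1]
      ring
    · have h1 : M.cartanEntry s t = -1 := by simp [cartanEntry, h]
      rw [h]
      funext f u
      change M.geomReflection s (M.geomReflection t (M.geomReflection s (M.geomReflection t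
        (M.geomReflection s (M.geomReflection t f))))) u = f u
      simp only [geomReflection_apply, hs, ht, ← hsymm, h1]
      ring
    · rw [h, pow_zero]

/-- The dual geometric representation. -/
noncomputable def geomRep (hM : M.IsTwoThreeInfty) : M.Group →* Function.End (S → ℤ) :=
  M.toCoxeterSystem.lift ⟨_, geomReflection_isLiftable hM⟩

theorem geomRep_simple (hM : M.IsTwoThreeInfty) (s : S) :
    geomRep hM (M.toCoxeterSystem.simple s) = M.geomReflection s :=
  M.toCoxeterSystem.lift_apply_simple (geomReflection_isLiftable hM) s

/-- On the delta function at `s`, the first reflection changes the sign of the `s`-coordinate and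
the second one preserves it. -/
theorem simple_ne_simple (hM : M.IsTwoThreeInfty) {s t : S} (hst : s ≠ t) :
    M.toCoxeterSystem.simple s ≠ M.toCoxeterSystem.simple t := by
  classical
  intro h
  have h1 := congrArg (geomRep hM) h
  rw [geomRep_simple, geomRep_simple] at h1
  have h2 := congrFun (congrFun h1 (Pi.single s 1)) s
  have hs : M.cartanEntry s s = 2 := by simp [cartanEntry]
  simp [geomReflection_apply, hs, hst.symm] at h2

theorem simple_mul_simple_ne_one (hM : M.IsTwoThreeInfty) {s t : S} (hst : s ≠ t) :
    M.toCoxeterSystem.simple s * M.toCoxeterSystem.simple t ≠ 1 := by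
  intro h
  rw [mul_eq_one_iff_eq_inv, M.toCoxeterSystem.inv_simple] at h
  exact simple_ne_simple hM hst h

/-- Powers of `st` move the delta function at `s` linearly: its `t`-coordinate after `n` steps is
`2n`, so no positive power acts trivially. -/
theorem simple_mul_simple_pow_ne_one (hM : M.IsTwoThreeInfty) {s t : S} (hst : M s t = 0) (n : ℕ) :
    (M.toCoxeterSystem.simple s * M.toCoxeterSystem.simple t) ^ (n + 1) ≠ 1 := by
  classical
  have hne : s ≠ t := by
    rintro rfl
    simp at hst
  have hs : M.cartanEntry s s = 2 := by simp [cartanEntry]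
  have ht : M.cartanEntry t t = 2 := by simp [cartanEntry]
  have h1 : M.cartanEntry s t = -2 := by simp [cartanEntry, hst]
  have h2 : M.cartanEntry t s = -2 := by rw [M.cartanEntry_symm, h1]
  have key : ∀ n : ℕ, ((M.geomReflection s * M.geomReflection t) ^ n) (Pi.single s 1) s = 1 - 2 * n ∧
      ((M.geomReflection s * M.geomReflection t) ^ n) (Pi.single s 1) t = 2 * n := by
    intro n
    induction n with
    | zero =>
      rw [pow_zero]
      change (Pi.single s 1 : S → ℤ) s = _ ∧ (Pi.single s 1 : S → ℤ) t = _
      simp [hne.symm]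
    | succ n ih =>
      rw [pow_succ']
      change M.geomReflection s (M.geomReflection t
        (((M.geomReflection s * M.geomReflection t) ^ n) (Pi.single s 1))) s = _ ∧
        M.geomReflection s (M.geomReflection t
        (((M.geomReflection s * M.geomReflection t) ^ n) (Pi.single s 1))) t = _
      simp only [geomReflection_apply, hs, ht, h1, h2, ih.1, ih.2]
      push_cast
      constructor <;> ring
  intro h
  have h3 := congrArg (geomRep hM) h
  rw [map_pow, map_mul, geomRep_simple, geomRep_simple, map_one] at h3
  have h4 := (key (n + 1)).2
  rw [h3] at h4
  change (Pi.single s 1 : S → ℤ) t = _ at h4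
  simp [hne.symm] at h4
  omega

end Geometric

end CoxeterMatrix

/-! ### Elements with two left descents. -/

namespace CoxeterSystem

section Descents

variable {S : Type*} {M : CoxeterMatrix S}

local notation "cs" => M.toCoxeterSystem

/-- Exchange for `t` against the factorization `w = s (s w)`: as `t ≠ s`, the letter removed comes
from `s w`, which gives `t w = s w'`. -/
theorem exists_shorter_of_two_leftDescents (hM : M.IsTwoThreeInfty) {s t : S} (hst : s ≠ t)
    {w : M.Group} (hs : (cs).IsLeftDescent w s) (ht : (cs).IsLeftDescent w t) :
    ∃ w', w = (cs).simple t * ((cs).simple s * w') ∧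
      (cs).length w' + 2 = (cs).length w := by
  have h1 : w = (cs).wordProd [s] * ((cs).simple s * w) := by
    rw [(cs).wordProd_singleton, (cs).simple_mul_simple_cancel_left]
  have h2 := (cs).isLeftDescent_iff.1 hs
  rw [h1] at ht
  rcases (cs).mem_leftInvSeq_or_exists ht with h | ⟨w', h3, h4⟩
  · rw [(cs).leftInvSeq_singleton, List.mem_singleton] at h
    exact absurd h.symm (CoxeterMatrix.simple_ne_simple hM hst)
  · rw [← h1, (cs).wordProd_singleton] at h4
    have h5 : w = (cs).simple t * ((cs).simple s * w') := by
      rw [← h4, (cs).simple_mul_simple_cancel_left]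
    refine ⟨w', h5, ?_⟩
    have h6 := (cs).length_mul_le ((cs).simple t) ((cs).simple s * w')
    have h7 := (cs).length_mul_le ((cs).simple s) w'
    rw [(cs).length_simple] at h6 h7
    rw [← h5] at h6
    omega

/-- Here `w` starts with `ts`, the longest element of the dihedral group and an involution;
multiplying by it strips it off. -/
theorem length_of_two_leftDescents_of_two (hM : M.IsTwoThreeInfty) {s t : S} (hst : s ≠ t)
    {w : M.Group} (hs : (cs).IsLeftDescent w s) (ht : (cs).IsLeftDescent w t) (h : M s t = 2) :
    (cs).length ((cs).simple t * ((cs).simple s * w)) + 2 = (cs).length w := by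
  obtain ⟨w', h1, h2⟩ := exists_shorter_of_two_leftDescents hM hst hs ht
  have h3 := (cs).simple_mul_simple_pow s t
  rw [h, pow_two] at h3
  rw [h1, show (cs).simple t * ((cs).simple s * ((cs).simple t * ((cs).simple s * w'))) =
    (cs).simple t * ((cs).simple s * (cs).simple t * ((cs).simple s * (cs).simple t)) *
      (cs).simple t * w' by
      have := (cs).simple_mul_simple_self t
      simp only [mul_assoc]
      rw [(cs).simple_mul_simple_cancel_left], h3, mul_one, (cs).simple_mul_simple_self, one_mul,
      ← h1, h2]

/-- A second exchange, of `s` against the prefix `ts`, shows that `w` starts with `sts`, which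
multiplication by the same involution then removes. -/
theorem length_of_two_leftDescents_of_three (hM : M.IsTwoThreeInfty) {s t : S} (hst : s ≠ t)
    {w : M.Group} (hs : (cs).IsLeftDescent w s) (ht : (cs).IsLeftDescent w t) (h : M s t = 3) :
    (cs).length ((cs).simple s * ((cs).simple t * ((cs).simple s * w))) + 3 = (cs).length w := by
  obtain ⟨w', h1, h2⟩ := exists_shorter_of_two_leftDescents hM hst hs ht
  have h3 := (cs).simple_mul_simple_pow s t
  rw [h, pow_succ, pow_two] at h3
  have h4 : w = (cs).wordProd [t, s] * w' := by
    rw [h1]; simp [wordProd, mul_assoc]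
  have hs' := hs
  rw [h4] at hs'
  have hlen : (cs).length ((cs).simple s * w) + 1 = (cs).length w := (cs).isLeftDescent_iff.1 hs
  rcases (cs).mem_leftInvSeq_or_exists hs' with h5 | ⟨w'', h5, h6⟩
  -- The left inversions of `ts` are `t` and `tst`. If `s = tst`, then `s` and `t` commute and
  -- `(st)^3 = 1` reduces to `st = 1`.
  · exfalso
    simp only [leftInvSeq, List.map_cons, List.map_nil, List.mem_cons, List.not_mem_nil,
      or_false, MulAut.conj_apply, (cs).inv_simple] at h5
    rcases h5 with h5 | h5
    · exact CoxeterMatrix.simple_ne_simple hM hst h5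
    · have h6 : (cs).simple s * (cs).simple t = (cs).simple t * (cs).simple s := by
        conv_lhs => rw [h5]
        rw [mul_assoc, (cs).simple_mul_simple_self, mul_one]
      have h7 : (cs).simple s * (cs).simple t * ((cs).simple t * (cs).simple s) *
          ((cs).simple s * (cs).simple t) = 1 := by
        rw [← h6]; exact h3
      apply CoxeterMatrix.simple_mul_simple_ne_one hM hst
      simpa only [mul_assoc, (cs).simple_mul_simple_cancel_left] using h7
  · have h7 : w = (cs).simple s * ((cs).simple t * ((cs).simple s * w'')) := by
      rw [← h4] at h6
      rw [← (cs).simple_mul_simple_cancel_left (w := w) s, h6]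
      simp [wordProd, mul_assoc]
    have h8 : (cs).simple s * ((cs).simple t * ((cs).simple s * w)) = w'' := by
      rw [h7]
      simp only [(cs).simple_mul_simple_cancel_left]
    rw [h8]
    have l1 := (cs).length_mul_le ((cs).simple s) ((cs).simple t * ((cs).simple s * w''))
    have l2 := (cs).length_mul_le ((cs).simple t) ((cs).simple s * w'')
    have l3 := (cs).length_mul_le ((cs).simple s) w''
    simp only [(cs).length_simple] at l1 l2 l3
    rw [← h7] at l1
    omega

/-- Repeated exchange shows that `w` starts, with additive lengths, with alternating words of every
length, which is absurd. -/
theorem not_two_leftDescents_of_infinite (hM : M.IsTwoThreeInfty) {s t : S}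
    {w : M.Group} (hs : (cs).IsLeftDescent w s) (ht : (cs).IsLeftDescent w t) : M s t ≠ 0 := by
  intro h
  have key : ∀ n : ℕ, ∃ w', w = (cs).wordProd (alternatingWord s t n) * w' ∧
      (cs).length w' + n = (cs).length w := by
    intro n
    induction n with
    | zero => exact ⟨w, by simp [alternatingWord], rfl⟩
    | succ n ih =>
      obtain ⟨w', h1, h2⟩ := ih
      rw [alternatingWord_succ']
      set c : S := if Even n then t else s with hc
      have hdes : (cs).IsLeftDescent w c := by
        rw [hc]; split_ifs <;> assumption
      rw [h1] at hdes
      rcases (cs).mem_leftInvSeq_or_exists hdes with h3 | ⟨w'', h3, h4⟩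
      -- Inversions of alternating words are odd alternating words. If one of them is the next
      -- letter, a positive power of the product of the two reflections is trivial.
      · exfalso
        rcases Nat.even_or_odd n with hn | hn
        · rw [hc, if_pos hn] at h3
          obtain ⟨m, rfl⟩ := hn
          rw [← two_mul] at h3
          obtain ⟨k, hk, h4⟩ := List.mem_iff_getElem.1 h3
          rw [(cs).getElem_leftInvSeq_alternatingWord s t m k (by simpa using hk),
            (cs).wordProd_alternatingWord_two_mul_succ] at h4
          apply CoxeterMatrix.simple_mul_simple_pow_ne_one hM
            (show M t s = 0 by rw [M.symmetric, h]) k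
          rw [pow_succ', mul_assoc, h4, (cs).simple_mul_simple_self]
        · rw [hc, if_neg (Nat.not_even_iff_odd.2 hn)] at h3
          obtain ⟨m, rfl⟩ := hn
          -- The odd word is completed by one letter, because the formula for the inversions is
          -- stated for even alternating words.
          have h5 : (cs).simple s ∈ (cs).leftInvSeq (alternatingWord t s (2 * (m + 1))) := by
            rw [show 2 * (m + 1) = 2 * m + 1 + 1 by ring, alternatingWord_succ,
              (cs).leftInvSeq_concat, List.concat_eq_append]
            exact List.mem_append_left _ h3
          obtain ⟨k, hk, h4⟩ := List.mem_iff_getElem.1 h5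
          rw [(cs).getElem_leftInvSeq_alternatingWord t s (m + 1) k (by simpa using hk),
            (cs).wordProd_alternatingWord_two_mul_succ] at h4
          apply CoxeterMatrix.simple_mul_simple_pow_ne_one hM h k
          rw [pow_succ', mul_assoc, h4, (cs).simple_mul_simple_self]
      · rw [← h1] at h4
        have h5 : w = (cs).wordProd (c :: alternatingWord s t n) * w'' := by
          rw [(cs).wordProd_cons, mul_assoc, ← h4, (cs).simple_mul_simple_cancel_left]
        refine ⟨w'', h5, ?_⟩
        have h6 := (cs).length_mul_le ((cs).wordProd (c :: alternatingWord s t n)) w''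
        have h7 := (cs).length_wordProd_le (c :: alternatingWord s t n)
        rw [← h5] at h6
        rw [List.length_cons, length_alternatingWord] at h7
        omega
  obtain ⟨w', -, h2⟩ := key ((cs).length w + 1)
  omega

end Descents

end CoxeterSystem

/-! ### Lengths and braid relations in rank two. -/

namespace CoxeterSystem

variable {S : Type u} {M : CoxeterMatrix S}

local notation "cs" => M.toCoxeterSystem

theorem length_simple_mul_simple (hM : M.IsTwoThreeInfty) {s t : S} (hst : s ≠ t) :
    (cs).length (M.simple s * M.simple t) = 2 := by
  rcases (cs).length_mul_simple (M.simple s) t with h | h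
  · rw [M.toCoxeterSystem_simple] at h
    rw [h]
    have := (cs).length_simple s
    rw [M.toCoxeterSystem_simple] at this
    omega
  · have h1 := (cs).length_simple s
    rw [M.toCoxeterSystem_simple] at h h1
    have h2 : (cs).length (M.simple s * M.simple t) = 0 := by omega
    exact absurd ((cs).length_eq_zero_iff.1 h2) (CoxeterMatrix.simple_mul_simple_ne_one hM hst)

theorem length_simple_mul_simple_mul_simple (hM : M.IsTwoThreeInfty) {s t : S} (hst : s ≠ t)
    (h : M s t = 3) : (cs).length (M.simple s * (M.simple t * M.simple s)) = 3 := by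
  have h2 := length_simple_mul_simple hM hst.symm
  rcases (cs).length_simple_mul (M.simple t * M.simple s) s with h1 | h1
  · rw [M.toCoxeterSystem_simple] at h1
    omega
  -- If `s` shortened `ts`, then `ts` would have both left descents, hence length at least 3.
  · exfalso
    have hs : (cs).IsLeftDescent (M.simple t * M.simple s) s := (cs).isLeftDescent_iff.2 h1
    have ht : (cs).IsLeftDescent (M.simple t * M.simple s) t := by
      rw [IsLeftDescent, h2, ← M.toCoxeterSystem_simple, (cs).simple_mul_simple_cancel_left,
        (cs).length_simple]
      omega
    have := length_of_two_leftDescents_of_three hM hst hs ht h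
    omega

theorem braid_two {s t : S} (h : M s t = 2) :
    M.simple s * M.simple t = M.simple t * M.simple s := by
  have h1 := (cs).wordProd_braidWord_eq s t
  rw [braidWord, braidWord, M.symmetric t s, h] at h1
  simpa [alternatingWord, wordProd] using h1

theorem braid_three {s t : S} (h : M s t = 3) :
    M.simple s * (M.simple t * M.simple s) = M.simple t * (M.simple s * M.simple t) := by
  have h1 := (cs).wordProd_braidWord_eq s t
  rw [braidWord, braidWord, M.symmetric t s, h] at h1
  simpa [alternatingWord, wordProd] using h1.symm

end CoxeterSystem

/-! ### Simple connectivity of buildings. -/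

namespace PanelSystem.Gallery

variable {S : Type u} {P : PanelSystem.{u, v, w} S}

theorem length_types_cons {x y z : P.Chamber} (s : S) (e : P.Edge s x y) (g : P.Gallery y z) :
    (cons s e g).types.length = g.types.length + 1 := rfl

end PanelSystem.Gallery

namespace WeylData

open PanelSystem

variable {S : Type u} {W : WeylData.{u, v, w} S}

/-- Turns a null-homotopic closed gallery, such as a suite, into a homotopy between its two halves.
-/
theorem homotopic_of_append_reverse {x y : W.Chamber} {g h : W.Gallery x y}
    (H : W.Homotopic (g.append h.reverse) (Gallery.nil x)) : W.Homotopic g h := by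
  have h1 : W.Homotopic (g.append (h.reverse.append h)) g := by
    have := Homotopic.append (Homotopic.refl g) (homotopic_reverse_append h)
    rwa [Gallery.append_nil] at this
  rw [← Gallery.append_assoc] at h1
  exact h1.symm.trans (Homotopic.append H (Homotopic.refl h))

end WeylData

theorem isChain_five {α : Type*} {a b c d e : α} (h₁ : a ≠ b) (h₂ : b ≠ c) (h₃ : c ≠ d)
    (h₄ : d ≠ e) : List.IsChain (· ≠ ·) [a, b, c, d, e] := by
  simp [h₁, h₂, h₃, h₄]

theorem isChain_seven {α : Type*} {a b c d e f g : α} (h₁ : a ≠ b) (h₂ : b ≠ c) (h₃ : c ≠ d)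
    (h₄ : d ≠ e) (h₅ : e ≠ f) (h₆ : f ≠ g) : List.IsChain (· ≠ ·) [a, b, c, d, e, f, g] := by
  simp [h₁, h₂, h₃, h₄, h₅, h₆]

namespace Building

open PanelSystem

variable {S : Type u} {M : CoxeterMatrix S} (Δ : Building.{u, v} M)

local notation "cs" => M.toCoxeterSystem

/-- A building as Weyl data, with its suites. -/
def toWeylData : WeylData.{u, v, 0} S where
  toPanelSystem := Δ.toPanelSystem
  IsSuite g := Δ.IsSuite g

variable {Δ}

theorem simple_ne_one (s : S) : M.simple s ≠ 1 := by
  intro h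
  have := (cs).length_simple s
  rw [M.toCoxeterSystem_simple, h, (cs).length_one] at this
  omega

theorem dist_self (C : Δ.Chamber) : Δ.dist C C = 1 := (Δ.dist_eq_one_iff C C).2 rfl

theorem dist_simple_symm {s : S} {C D : Δ.Chamber} (h : Δ.dist C D = M.simple s) :
    Δ.dist D C = M.simple s := by
  rcases adj_symm (Or.inr h : Δ.Adj s C D) with h1 | h1
  · obtain rfl := (Δ.dist_eq_one_iff D C).1 h1
    exact h
  · exact h1

theorem ne_of_dist_simple {s : S} {C D : Δ.Chamber} (h : Δ.dist C D = M.simple s) : C ≠ D := by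
  rintro rfl
  rw [dist_self] at h
  exact simple_ne_one s h.symm

theorem dist_mem_of_adj {s : S} {C C' : Δ.Chamber} (h : Δ.Adj s C C') (D : Δ.Chamber) :
    Δ.dist C D = M.simple s * Δ.dist C' D ∨ Δ.dist C D = Δ.dist C' D := by
  rcases h with h | h
  · obtain rfl := (Δ.dist_eq_one_iff C C').1 h
    exact Or.inr rfl
  · exact Δ.dist_mem s C C' D h

theorem edge_eq {s : S} {C D : Δ.toPanelSystem.Chamber} :
    ∀ e f : Δ.toPanelSystem.Edge s C D, e = f
  | ⟨_⟩, ⟨_⟩ => rfl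

theorem length_simple_mul_le (s : S) (w : M.Group) :
    (cs).length (M.simple s * w) ≤ (cs).length w + 1 := by
  have := (cs).length_simple_mul w s
  rw [M.toCoxeterSystem_simple] at this
  omega

theorem length_dist_le_of_adj {s : S} {C C' : Δ.Chamber} (h : Δ.Adj s C C') (D : Δ.Chamber) :
    (cs).length (Δ.dist C D) ≤ (cs).length (Δ.dist C' D) + 1 := by
  rcases dist_mem_of_adj h D with h | h <;> rw [h]
  · exact length_simple_mul_le s _
  · omega

theorem length_dist_le {C D : Δ.toPanelSystem.Chamber} (g : Δ.toPanelSystem.Gallery C D) :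
    (cs).length (Δ.dist C D) ≤ g.types.length := by
  induction g with
  | nil x =>
    rw [show Δ.dist x x = 1 from dist_self x, (cs).length_one]
    exact Nat.zero_le _
  | cons s e g ih =>
    rw [Gallery.length_types_cons]
    exact (length_dist_le_of_adj e.down _).trans (Nat.add_le_add_right ih 1)

/-- A chamber of a panel which is closer to `D` than some other chamber of the panel is unique. -/
theorem eq_of_length_dist_lt {s : S} {C C₁ C₂ D : Δ.Chamber} (h₁ : Δ.Adj s C C₁)
    (h₂ : Δ.Adj s C C₂) (l₁ : (cs).length (Δ.dist C₁ D) < (cs).length (Δ.dist C D))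
    (l₂ : (cs).length (Δ.dist C₂ D) < (cs).length (Δ.dist C D)) : C₁ = C₂ := by
  have key : ∀ {C' : Δ.Chamber}, Δ.Adj s C C' →
      (cs).length (Δ.dist C' D) < (cs).length (Δ.dist C D) →
      Δ.dist C D = M.simple s * Δ.dist C' D := by
    intro C' h l
    rcases dist_mem_of_adj h D with h | h
    · exact h
    · rw [h] at l
      exact absurd l (lt_irrefl _)
  have k₁ := key h₁ l₁
  have k₂ := key h₂ l₂
  -- Two distinct such chambers would be at distance `s` and have the same distance to `D`, which
  -- `s` lengthens. The building axiom then gives one of them the distance from `C` to `D`, which is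
  -- too long.
  rcases adj_trans (adj_symm h₁) h₂ with h | h
  · exact (Δ.dist_eq_one_iff _ _).1 h
  · have h3 : Δ.dist C₁ D = Δ.dist C₂ D := mul_left_cancel (k₁.symm.trans k₂)
    have h4 := Δ.dist_eq_mul s C₁ C₂ D h (by
      have h5 := (cs).length_simple_mul (Δ.dist C₂ D) s
      rw [M.toCoxeterSystem_simple, ← k₂] at h5
      rw [← k₂]
      omega)
    rw [h4, ← k₂] at l₁
    exact absurd l₁ (lt_irrefl _)

theorem exists_gallery_length_eq (C D : Δ.Chamber) :
    ∃ g : Δ.toPanelSystem.Gallery C D, g.types.length = (cs).length (Δ.dist C D) := by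
  induction h : (cs).length (Δ.dist C D) generalizing C with
  | zero =>
    obtain rfl := (Δ.dist_eq_one_iff C D).1 ((cs).length_eq_zero_iff.1 h)
    exact ⟨Gallery.nil (P := Δ.toPanelSystem) C, rfl⟩
  | succ n ih =>
    have h1 : Δ.dist C D ≠ 1 := by
      intro h1
      rw [h1, (cs).length_one] at h
      omega
    obtain ⟨s, hs⟩ := (cs).exists_leftDescent_of_ne_one h1
    obtain ⟨C', h2, h3⟩ := Δ.exists_dist_eq s C D
    have h4 := (cs).isLeftDescent_iff.1 hs
    rw [M.toCoxeterSystem_simple, ← h3, h] at h4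
    obtain ⟨g, hg⟩ := ih C' (by omega)
    exact ⟨Gallery.cons (P := Δ.toPanelSystem) s ⟨Or.inr (dist_simple_symm h2)⟩ g,
      by
      change g.types.length + 1 = _
      omega⟩

theorem dist_mul_of_length {s : S} {C C' D : Δ.Chamber} {w : M.Group}
    (h : Δ.dist C C' = M.simple s) (h' : Δ.dist C' D = w)
    (hl : (cs).length (M.simple s * w) = (cs).length w + 1) :
    Δ.dist C D = M.simple s * w := by
  subst h'
  exact Δ.dist_eq_mul s C C' D h hl

/-- In the situation where `D` is reached from `C` by two shortest galleries starting in different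
directions `s` and `t`, both initial steps can be completed to a suite, and all its chambers are on
shortest galleries to `D`. -/
theorem homotopic_of_length_eq (hM : M.IsTwoThreeInfty) {C D : Δ.toPanelSystem.Chamber}
    (g h : Δ.toPanelSystem.Gallery C D) (hg : g.types.length = (cs).length (Δ.dist C D))
    (hh : h.types.length = (cs).length (Δ.dist C D)) : Δ.toWeylData.Homotopic g h := by
  induction hn : (cs).length (Δ.dist C D) generalizing C with
  | zero =>
    cases g with
    | nil =>
      cases h with
      | nil => exact WeylData.Homotopic.refl _
      | cons s e h => simp [Gallery.types, hn] at hh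
    | cons s e g => simp [Gallery.types, hn] at hg
  | succ n ih =>
    cases g with
    | nil => simp [Gallery.types, hn] at hg
    | @cons _ C₁ _ s e g =>
    cases h with
    | nil => simp [Gallery.types, hn] at hh
    | @cons _ C₂ _ t f h =>
    rw [hn, Gallery.length_types_cons, Nat.add_right_cancel_iff] at hg hh
    have a₁ : Δ.Adj s C C₁ := e.down
    have a₂ : Δ.Adj t C C₂ := f.down
    have l₁ : (cs).length (Δ.dist C₁ D) = n := by
      have h1 := length_dist_le_of_adj a₁ D
      have h2 : (cs).length (Δ.dist C₁ D) ≤ _ := length_dist_le g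
      omega
    have l₂ : (cs).length (Δ.dist C₂ D) = n := by
      have h1 := length_dist_le_of_adj a₂ D
      have h2 : (cs).length (Δ.dist C₂ D) ≤ _ := length_dist_le h
      omega
    by_cases hst : s = t
    · subst hst
      obtain rfl : C₁ = C₂ := eq_of_length_dist_lt a₁ a₂ (D := D) (by omega) (by omega)
      obtain rfl : e = f := edge_eq e f
      exact WeylData.homotopic_cons (W := Δ.toWeylData) e (ih g h (hg.trans l₁.symm)
        (hh.trans l₂.symm) l₁)
    have d₁ : Δ.dist C C₁ = M.simple s := by
      rcases a₁ with h1 | h1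
      · obtain rfl := (Δ.dist_eq_one_iff _ _).1 h1
        omega
      · exact h1
    have d₂ : Δ.dist C C₂ = M.simple t := by
      rcases a₂ with h1 | h1
      · obtain rfl := (Δ.dist_eq_one_iff _ _).1 h1
        omega
      · exact h1
    have e₁ : Δ.dist C₁ D = M.simple s * Δ.dist C D := by
      rcases Δ.dist_mem s C₁ C D (dist_simple_symm d₁) with h1 | h1
      · exact h1
      · rw [h1] at l₁; omega
    have e₂ : Δ.dist C₂ D = M.simple t * Δ.dist C D := by
      rcases Δ.dist_mem t C₂ C D (dist_simple_symm d₂) with h1 | h1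
      · exact h1
      · rw [h1] at l₂; omega
    have hs : (cs).IsLeftDescent (Δ.dist C D) s := by
      rw [CoxeterSystem.IsLeftDescent, M.toCoxeterSystem_simple, ← e₁]; omega
    have ht : (cs).IsLeftDescent (Δ.dist C D) t := by
      rw [CoxeterSystem.IsLeftDescent, M.toCoxeterSystem_simple, ← e₂]; omega
    have ls : (cs).length (M.simple s) = 1 := (cs).length_simple s
    have lt : (cs).length (M.simple t) = 1 := (cs).length_simple t
    have lst := CoxeterSystem.length_simple_mul_simple hM hst
    have lts := CoxeterSystem.length_simple_mul_simple hM (Ne.symm hst)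
    have ss : ∀ (s : S) (w : M.Group), M.simple s * (M.simple s * w) = w := fun s w =>
      (cs).simple_mul_simple_cancel_left s
    rcases hM s t hst with hm | hm | hm
    · have l := CoxeterSystem.length_of_two_leftDescents_of_two hM hst hs ht hm
      rw [M.toCoxeterSystem_simple, ← e₁] at l
      -- `X` is the chamber of the residue opposite to `C`, closest to `D`. The braid relation
      -- supplies a second path `C, Y, X` of type `t, s`; since `Y` is closer to `D` than `C` is, it
      -- must be `C₂`.
      obtain ⟨X, hX1, hX2⟩ := Δ.exists_dist_eq t C₁ D
      have hCX : Δ.dist C X = M.simple t * M.simple s := by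
        rw [dist_mul_of_length d₁ (dist_simple_symm hX1) (by rw [lst, lt]),
          CoxeterSystem.braid_two hm]
      obtain ⟨Y, hY1, hY2⟩ := Δ.exists_dist_eq t C X
      rw [hCX, ss] at hY2
      have aX : Δ.Adj s Y X := Or.inr hY2
      have aY : Δ.Adj t C Y := Or.inr (dist_simple_symm hY1)
      have lX : (cs).length (Δ.dist X D) + 1 = n := by rw [hX2]; omega
      obtain rfl : C₂ = Y := by
        refine eq_of_length_dist_lt a₂ aY (D := D) (by omega) ?_
        have := length_dist_le_of_adj aX D
        omega
      obtain ⟨k, hk⟩ := exists_gallery_length_eq X D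
      have b₁ := ih g (Gallery.cons (P := Δ.toPanelSystem) t ⟨Or.inr (dist_simple_symm hX1)⟩ k)
        (hg.trans l₁.symm) (by change k.types.length + 1 = _; omega) l₁
      have b₂ := ih h (Gallery.cons (P := Δ.toPanelSystem) s ⟨aX⟩ k)
        (hh.trans l₂.symm) (by change k.types.length + 1 = _; omega) l₂
      refine (WeylData.homotopic_cons (W := Δ.toWeylData) e b₁).trans
        (.trans ?_ (WeylData.homotopic_cons (W := Δ.toWeylData) f b₂).symm)
      have key : Δ.toWeylData.Homotopic
          (Gallery.cons (P := Δ.toPanelSystem) s e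
            (Gallery.single (P := Δ.toPanelSystem) t ⟨Or.inr (dist_simple_symm hX1)⟩))
          (Gallery.cons (P := Δ.toPanelSystem) t f
            (Gallery.single (P := Δ.toPanelSystem) s ⟨aX⟩)) := by
        refine WeylData.homotopic_of_append_reverse (WeylData.Homotopic.suite _ ?_)
        refine ⟨s, t, hst, by omega, ?_, ?_⟩
        · rw [hm]
          rfl
        · change List.IsChain (· ≠ ·) [C, C₁, X, C₂, C]
          exact isChain_five (ne_of_dist_simple d₁) (ne_of_dist_simple hX1).symm
            (ne_of_dist_simple hY2).symm (ne_of_dist_simple hY1)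
      exact WeylData.Homotopic.append key (WeylData.Homotopic.refl (W := Δ.toWeylData) k)
    · have l := CoxeterSystem.length_of_two_leftDescents_of_three hM hst hs ht hm
      rw [M.toCoxeterSystem_simple, ← e₁] at l
      have lsts := CoxeterSystem.length_simple_mul_simple_mul_simple hM hst hm
      have br := CoxeterSystem.braid_three hm
      -- The same with a hexagon: `C, C₁, X, Z` has type `s, t, s`, the braid relation gives `C, Y,
      -- Y', Z` of type `t, s, t`, and length estimates backwards from `Z` force `Y = C₂`.
      obtain ⟨X, hX1, hX2⟩ := Δ.exists_dist_eq t C₁ D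
      obtain ⟨Z, hZ1, hZ2⟩ := Δ.exists_dist_eq s X D
      have hXZ := dist_simple_symm hZ1
      have hC₁Z := dist_mul_of_length (dist_simple_symm hX1) hXZ (by rw [lts, ls])
      have hCZ := dist_mul_of_length d₁ hC₁Z (by rw [lsts, lts])
      rw [br] at hCZ
      obtain ⟨Y, hY1, hY2⟩ := Δ.exists_dist_eq t C Z
      rw [hCZ, ss] at hY2
      obtain ⟨Y', hY1', hY2'⟩ := Δ.exists_dist_eq s Y Z
      rw [hY2, ss] at hY2'
      have aZ : Δ.Adj t Y' Z := Or.inr hY2'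
      have aY' : Δ.Adj s Y Y' := Or.inr (dist_simple_symm hY1')
      have aY : Δ.Adj t C Y := Or.inr (dist_simple_symm hY1)
      have aC₁ : Δ.Adj t C₁ X := Or.inr (dist_simple_symm hX1)
      have aX : Δ.Adj s X Z := Or.inr hXZ
      have lZ : (cs).length (Δ.dist Z D) + 2 = n := by rw [hZ2, hX2]; omega
      have lY' := length_dist_le_of_adj aZ D
      have lY := length_dist_le_of_adj aY' D
      obtain rfl : C₂ = Y := eq_of_length_dist_lt a₂ aY (D := D) (by omega) (by omega)
      obtain ⟨k, hk⟩ := exists_gallery_length_eq Z D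
      have b₁ := ih g (Gallery.cons (P := Δ.toPanelSystem) t ⟨aC₁⟩
        (Gallery.cons (P := Δ.toPanelSystem) s ⟨aX⟩ k))
        (hg.trans l₁.symm) (by change k.types.length + 1 + 1 = _; omega) l₁
      have b₂ := ih h (Gallery.cons (P := Δ.toPanelSystem) s ⟨aY'⟩
        (Gallery.cons (P := Δ.toPanelSystem) t ⟨aZ⟩ k))
        (hh.trans l₂.symm) (by change k.types.length + 1 + 1 = _; omega) l₂
      refine (WeylData.homotopic_cons (W := Δ.toWeylData) e b₁).trans
        (.trans ?_ (WeylData.homotopic_cons (W := Δ.toWeylData) f b₂).symm)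
      have key : Δ.toWeylData.Homotopic
          (Gallery.cons (P := Δ.toPanelSystem) s e (Gallery.cons (P := Δ.toPanelSystem) t ⟨aC₁⟩
            (Gallery.single (P := Δ.toPanelSystem) s ⟨aX⟩)))
          (Gallery.cons (P := Δ.toPanelSystem) t f (Gallery.cons (P := Δ.toPanelSystem) s ⟨aY'⟩
            (Gallery.single (P := Δ.toPanelSystem) t ⟨aZ⟩))) := by
        refine WeylData.homotopic_of_append_reverse (WeylData.Homotopic.suite _ ?_)
        refine ⟨s, t, hst, by omega, ?_, ?_⟩
        · rw [hm]
          rfl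
        · change List.IsChain (· ≠ ·) [C, C₁, X, Z, Y', C₂, C]
          exact isChain_seven (ne_of_dist_simple d₁) (ne_of_dist_simple hX1).symm
            (ne_of_dist_simple hXZ) (ne_of_dist_simple hY2').symm (ne_of_dist_simple hY1')
            (ne_of_dist_simple hY1)
      exact WeylData.Homotopic.append key (WeylData.Homotopic.refl (W := Δ.toWeylData) k)
    · exact absurd hm (CoxeterSystem.not_two_leftDescents_of_infinite hM hs ht)

/-- Induction on the gallery. A new first edge either starts in front of a minimal gallery from the
chamber of its panel closest to `D`, or else the remainder can be rerouted through that closest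
chamber and the two edges in the same panel composed. -/
theorem homotopic_minimal (hM : M.IsTwoThreeInfty) {C D : Δ.toPanelSystem.Chamber}
    (g h : Δ.toPanelSystem.Gallery C D) (hh : h.types.length = (cs).length (Δ.dist C D)) :
    Δ.toWeylData.Homotopic g h := by
  induction g with
  | nil x =>
    refine homotopic_of_length_eq hM _ h ?_ hh
    rw [show Δ.dist x x = 1 from dist_self x, (cs).length_one]
    rfl
  | @cons C C₁ D s e g ih =>
    have a : Δ.Adj s C C₁ := e.down
    -- When `s` shortens the distance from `C₁` to `D`, `X` is the chamber of the panel closest to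
    -- `D`; otherwise `C₁` itself is.
    obtain ⟨X, hX1, hX2⟩ := Δ.exists_dist_eq s C₁ D
    rcases (cs).length_simple_mul (Δ.dist C₁ D) s with h1 | h1
    · obtain ⟨k, hk⟩ := exists_gallery_length_eq C₁ D
      rcases a with a | a
      · obtain rfl := (Δ.dist_eq_one_iff C C₁).1 a
        exact (WeylData.Homotopic.append (W := Δ.toWeylData)
          (WeylData.Homotopic.one (W := Δ.toWeylData) s C)
          (WeylData.Homotopic.refl (W := Δ.toWeylData) g)).trans (ih h hh)
      · refine (WeylData.homotopic_cons (W := Δ.toWeylData) e (ih k hk)).trans ?_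
        refine homotopic_of_length_eq hM _ h ?_ hh
        change k.types.length + 1 = _
        rw [hk, ← h1]
        exact congrArg _ (Δ.dist_eq_mul s C C₁ D a h1).symm
    · rw [M.toCoxeterSystem_simple, ← hX2] at h1
      have aX : Δ.Adj s C₁ X := Or.inr (dist_simple_symm hX1)
      obtain ⟨k, hk⟩ := exists_gallery_length_eq X D
      have h2 := ih (Gallery.cons (P := Δ.toPanelSystem) s ⟨aX⟩ k)
        (by change k.types.length + 1 = _; omega)
      refine (WeylData.homotopic_cons (W := Δ.toWeylData) e h2).trans ?_
      refine (WeylData.Homotopic.append (W := Δ.toWeylData)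
        (WeylData.Homotopic.comp (W := Δ.toWeylData) e ⟨aX⟩)
        (WeylData.Homotopic.refl (W := Δ.toWeylData) k)).trans ?_
      rcases adj_trans a aX with b | b
      · obtain rfl := (Δ.dist_eq_one_iff C X).1 b
        exact (WeylData.Homotopic.append (W := Δ.toWeylData)
          (WeylData.Homotopic.one (W := Δ.toWeylData) s C)
          (WeylData.Homotopic.refl (W := Δ.toWeylData) k)).trans
            (homotopic_of_length_eq hM _ h hk hh)
      · refine homotopic_of_length_eq hM _ h ?_ hh
        have h3 : M.simple s * Δ.dist X D = Δ.dist C₁ D := by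
          rw [hX2]; exact (cs).simple_mul_simple_cancel_left s
        have h4 := Δ.dist_eq_mul s C X D b (by
          rw [h3]; exact h1.symm)
        rw [h3] at h4
        change k.types.length + 1 = (cs).length (Δ.dist C D)
        rw [h4, hk, h1]

/-- Buildings are simply connected: galleries with the same ends are homotopic. -/
theorem homotopic_of_same_ends (hM : M.IsTwoThreeInfty) {C D : Δ.Chamber}
    (g h : Δ.toPanelSystem.Gallery C D) : Δ.toWeylData.Homotopic g h := by
  obtain ⟨k, hk⟩ := exists_gallery_length_eq C D
  exact (homotopic_minimal hM g k hk).trans (homotopic_minimal hM h k hk).symm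

end Building

/-! ### Galleries when there is one edge of each type between any two chambers. -/

namespace PanelSystem

/-- There is exactly one edge of each type between any two chambers. -/
def Full {S : Type u} (P : PanelSystem.{u, v, w} S) : Prop :=
  ∀ (s : S) (x y : P.Chamber), Nonempty (P.Edge s x y) ∧ Subsingleton (P.Edge s x y)

theorem connectedSetoid_full (S : Type u) (C : Type v) : (connectedSetoid S C).Full :=
  fun _ _ _ => ⟨⟨PUnit.unit⟩, ⟨fun _ _ => rfl⟩⟩

namespace Gallery

variable {S : Type u} {P : PanelSystem.{u, v, w} S} {I : Type u'} {P' : PanelSystem.{u', v', w'} I}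

theorem chambers_eq_cons : ∀ {x y : P.Chamber} (g : P.Gallery x y), ∃ l, g.chambers = x :: l
  | _, _, nil _ => ⟨[], rfl⟩
  | _, _, cons _ _ g => ⟨g.chambers, rfl⟩

/-- Edges carry no information, so equality of galleries is tested on two lists. All later
comparisons of galleries with dependent endpoints go through this. -/
theorem ext_of_full (hP : P.Full) : ∀ {x y : P.Chamber} (g h : P.Gallery x y),
    g.types = h.types → g.chambers = h.chambers → g = h
  | _, _, nil _, nil _, _, _ => rfl
  | _, _, nil _, cons _ _ _, ht, _ => by simp [types] at ht
  | _, _, cons _ _ _, nil _, ht, _ => by simp [types] at ht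
  | x, _, @cons _ _ _ y _ s e g, @cons _ _ _ y' _ s' e' g', ht, hc => by
    simp only [types, List.cons.injEq] at ht
    simp only [chambers, List.cons.injEq, true_and] at hc
    obtain ⟨rfl, ht⟩ := ht
    obtain ⟨l, hl⟩ := g.chambers_eq_cons
    obtain ⟨l', hl'⟩ := g'.chambers_eq_cons
    obtain rfl : y = y' := by
      rw [hl, hl'] at hc
      exact (List.cons.inj hc).1
    rw [ext_of_full hP g g' ht hc, (hP s x y).2.elim e e']

theorem exists_relabel (hP' : P'.Full) (k : P.Chamber → P'.Chamber) :
    ∀ {x y : P.Chamber} (g : P.Gallery x y) (l : List I), l.length = g.types.length →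
      ∃ g' : P'.Gallery (k x) (k y), g'.types = l ∧ g'.chambers = g.chambers.map k
  | _, _, nil x, l, hl => by
    obtain rfl := List.length_eq_zero_iff.1 hl
    exact ⟨nil (k x), rfl, rfl⟩
  | _, _, cons _ _ _, [], hl => by simp [types] at hl
  | x, _, @cons _ _ _ y _ _ _ g, i :: l, hl => by
    simp only [types, List.length_cons, Nat.add_right_cancel_iff] at hl
    obtain ⟨g', h1, h2⟩ := exists_relabel hP' k g l hl
    exact ⟨cons i (hP' i (k x) (k y)).1.some g', by simp [types, h1], by simp [chambers, h2]⟩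

/-- The image of a gallery under a map of labels and a map of chambers. -/
noncomputable def map (hP' : P'.Full) (f : S → I) (k : P.Chamber → P'.Chamber) :
    ∀ {x y : P.Chamber}, P.Gallery x y → P'.Gallery (k x) (k y)
  | _, _, nil x => nil (k x)
  | x, _, @cons _ _ _ y _ s _ g => cons (f s) (hP' (f s) (k x) (k y)).1.some (map hP' f k g)

variable (hP' : P'.Full) (f : S → I) (k : P.Chamber → P'.Chamber)

theorem types_map : ∀ {x y : P.Chamber} (g : P.Gallery x y),
    (g.map hP' f k).types = g.types.map f
  | _, _, nil _ => rfl
  | _, _, cons s _ g => congrArg (List.cons (f s)) (types_map g)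

theorem chambers_map : ∀ {x y : P.Chamber} (g : P.Gallery x y),
    (g.map hP' f k).chambers = g.chambers.map k
  | _, _, nil _ => rfl
  | x, _, cons _ _ g => congrArg (List.cons (k x)) (chambers_map g)

theorem types_map_id {P' : PanelSystem.{u, v', w'} S} (hP' : P'.Full) (k : P.Chamber → P'.Chamber)
    {x y : P.Chamber} (g : P.Gallery x y) : (g.map hP' id k).types = g.types :=
  (types_map hP' id k g).trans (List.map_id _)

theorem map_append : ∀ {x y z : P.Chamber} (g : P.Gallery x y) (h : P.Gallery y z),
    (g.append h).map hP' f k = (g.map hP' f k).append (h.map hP' f k)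
  | _, _, _, nil _, _ => rfl
  | _, _, _, cons s _ g, h => congrArg (cons (f s) _) (map_append g h)

theorem map_map {J : Type u''} {P'' : PanelSystem.{u'', v'', w''} J} (hP'' : P''.Full) (f' : I → J)
    (k' : P'.Chamber → P''.Chamber) {x y : P.Chamber} (g : P.Gallery x y) :
    (g.map hP' f k).map hP'' f' k' = g.map hP'' (f' ∘ f) (k' ∘ k) := by
  refine ext_of_full hP'' _ _ ?_ ?_
  · rw [types_map, types_map, types_map, List.map_map]
  · rw [chambers_map, chambers_map, chambers_map, List.map_map]

end Gallery

section

variable {S : Type u} {P : PanelSystem.{u, v, w} S}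

theorem Hom.types_gallery {P' : PanelSystem.{u, v', w'} S} (F : P.Hom P') :
    ∀ {x y : P.Chamber} (g : P.Gallery x y), (F.gallery g).types = g.types
  | _, _, .nil _ => rfl
  | _, _, .cons s _ g => congrArg (List.cons s) (F.types_gallery g)

theorem Hom.chambers_gallery {P' : PanelSystem.{u, v', w'} S} (F : P.Hom P') :
    ∀ {x y : P.Chamber} (g : P.Gallery x y), (F.gallery g).chambers = g.chambers.map F.chamber
  | _, _, .nil _ => rfl
  | x, _, .cons _ _ g => congrArg (List.cons (F.chamber x)) (F.chambers_gallery g)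

theorem Hom.gallery_eq_map {P' : PanelSystem.{u, v', w'} S} (hP' : P'.Full) (F : P.Hom P')
    {x y : P.Chamber} (g : P.Gallery x y) : F.gallery g = g.map hP' id F.chamber := by
  refine Gallery.ext_of_full hP' _ _ ?_ ?_
  · rw [F.types_gallery, Gallery.types_map, List.map_id]
  · rw [F.chambers_gallery, Gallery.chambers_map]

theorem restrict_full {I : Type u'} (hP : P.Full) (f : I → S) : (P.restrict f).Full :=
  fun i x y => hP (f i) x y

theorem types_unrestrict {I : Type u'} (f : I → S) :
    ∀ {x y : P.Chamber} (g : (P.restrict f).Gallery x y),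
      (P.unrestrict f g).types = g.types.map f
  | _, _, .nil _ => rfl
  | _, _, .cons i _ g => congrArg (List.cons (f i)) (types_unrestrict f g)

theorem chambers_unrestrict {I : Type u'} (f : I → S) :
    ∀ {x y : P.Chamber} (g : (P.restrict f).Gallery x y),
      (P.unrestrict f g).chambers = g.chambers
  | _, _, .nil _ => rfl
  | x, _, .cons _ _ g => congrArg (List.cons x) (chambers_unrestrict f g)

theorem unrestrict_eq_map {I : Type u'} (hP : P.Full) (f : I → S) {x y : (P.restrict f).Chamber}
    (g : (P.restrict f).Gallery x y) :
    P.unrestrict f g = Gallery.map (P := P.restrict f) hP f id g := by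
  refine Gallery.ext_of_full hP _ _ ?_ ?_
  · exact (types_unrestrict f g).trans (Gallery.types_map (P := P.restrict f) hP f id g).symm
  · exact (chambers_unrestrict f g).trans
      ((Gallery.chambers_map (P := P.restrict f) hP f id g).trans (List.map_id _)).symm

end

end PanelSystem

/-! ### Transport of homotopies along maps of labels and chambers. -/

namespace WeylData

open PanelSystem

section Transfer

variable {S : Type u} {W : WeylData.{u, v, w} S} {I : Type u'} {W' : WeylData.{u', v', w'} I}

/-- With unique edges in the target, identities and compositions are preserved automatically; only
the suites impose a condition. -/
theorem homotopic_map (hW' : W'.Full) (f : S → I) (k : W.Chamber → W'.Chamber)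
    (H : ∀ (x : W.Chamber) (g : W.Gallery x x), W.IsSuite g →
      W'.Homotopic (g.map hW' f k) (Gallery.nil (k x))) {x y : W.Chamber} {g h : W.Gallery x y}
    (hgh : W.Homotopic g h) : W'.Homotopic (g.map hW' f k) (h.map hW' f k) := by
  induction hgh with
  | refl g => exact Homotopic.refl _
  | symm _ ih => exact ih.symm
  | trans _ _ ih1 ih2 => exact ih1.trans ih2
  | append _ _ ih1 ih2 =>
    rw [Gallery.map_append, Gallery.map_append]
    exact Homotopic.append ih1 ih2
  | one s x =>
    have : (hW' (f s) (k x) (k x)).1.some = W'.one (f s) (k x) :=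
      (hW' (f s) (k x) (k x)).2.elim _ _
    change W'.Homotopic (Gallery.single (f s) (hW' (f s) (k x) (k x)).1.some) _
    rw [this]
    exact Homotopic.one (f s) (k x)
  | @comp s x y z e e' =>
    have : (hW' (f s) (k x) (k z)).1.some = W'.comp (hW' (f s) (k x) (k y)).1.some
        (hW' (f s) (k y) (k z)).1.some :=
      (hW' (f s) (k x) (k z)).2.elim _ _
    change W'.Homotopic _ (Gallery.single (f s) (hW' (f s) (k x) (k z)).1.some)
    rw [this]
    exact Homotopic.comp _ _
  | suite g hg => exact H _ g hg

/-- Stated for a map that is the identity only pointwise, since it is applied to composites of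
mutually inverse maps. -/
theorem homotopic_map_id_iff (hW : W.Full) {k : W.Chamber → W.Chamber} (hk : ∀ x, k x = x)
    {x y : W.Chamber} {g h : W.Gallery x y} :
    W.Homotopic (g.map hW id k) (h.map hW id k) ↔ W.Homotopic g h := by
  obtain rfl : k = id := funext hk
  have key : ∀ g : W.Gallery x y, g.map hW id id = g := fun g =>
    Gallery.ext_of_full hW _ _ (by rw [Gallery.types_map, List.map_id])
      (by rw [Gallery.chambers_map]; exact List.map_id _)
  rw [key, key]

end Transfer

section Iso

variable {S : Type u} {W : WeylData.{u, v, w} S} {W' : WeylData.{u, v', w'} S}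

/-- Full Weyl data with matching suites are isomorphic. -/
theorem exists_iso (hW : W.Full) (hW' : W'.Full) (k : W.Chamber ≃ W'.Chamber)
    (H : ∀ (x : W.Chamber) (g : W.Gallery x x), W.IsSuite g →
      W'.Homotopic (g.map hW' id k) (Gallery.nil (k x)))
    (H' : ∀ (x : W'.Chamber) (g : W'.Gallery x x), W'.IsSuite g →
      W.Homotopic (g.map hW id k.symm) (Gallery.nil (k.symm x))) :
    ∃ F : W.Iso W', ∀ x, F.chamber x = k x := by
  let F₀ : Hom W.toPanelSystem W'.toPanelSystem :=
    { chamber := k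
      edge := fun {s x y} _ => (hW' s (k x) (k y)).1.some
      edge_comp := fun _ _ => (hW' _ _ _).2.elim _ _ }
  refine ⟨{ toHom := F₀, chamber_bijective := k.bijective, edge_bijective := ?_,
            homotopic_iff := ?_ }, fun _ => rfl⟩
  · intro s x y
    have h1 := (hW s x y).2
    have h2 := (hW' s (k x) (k y)).2
    exact ⟨fun a b _ => Subsingleton.elim a b,
      fun b => ⟨(hW s x y).1.some, h2.elim _ _⟩⟩
  · intro x y g h
    rw [F₀.gallery_eq_map hW', F₀.gallery_eq_map hW']
    refine ⟨homotopic_map hW' id k H, fun h1 => ?_⟩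
    have h2 := homotopic_map hW id k.symm H' h1
    rw [Gallery.map_map, Gallery.map_map] at h2
    exact (homotopic_map_id_iff hW (k := k.symm ∘ k) (fun x => k.symm_apply_apply x)).1 h2

theorem Iso.homotopic_map_iff (F : W.Iso W') (hW' : W'.Full) {x y : W.Chamber}
    (g h : W.Gallery x y) : W'.Homotopic (g.map hW' id F.chamber) (h.map hW' id F.chamber) ↔
      W.Homotopic g h := by
  rw [F.homotopic_iff, F.gallery_eq_map hW', F.gallery_eq_map hW']

theorem Iso.homotopic_map_inverse (F : W.Iso W') (hW : W.Full) (hW' : W'.Full)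
    {k : W'.Chamber → W.Chamber} (hk : ∀ x, F.chamber (k x) = x) {x y : W'.Chamber}
    {g h : W'.Gallery x y} (H : W'.Homotopic g h) :
    W.Homotopic (g.map hW id k) (h.map hW id k) := by
  rw [← F.homotopic_map_iff hW', Gallery.map_map, Gallery.map_map]
  exact (homotopic_map_id_iff hW' (k := F.chamber ∘ k) hk).2 H

theorem residue_full (hW : W.Full) (s t : S) : (W.residue s t).Full :=
  restrict_full hW _

theorem homotopic_of_residue (hW : W.Full) {s t : S} {x y : (W.residue s t).Chamber}
    {g h : (W.residue s t).Gallery x y} (H : (W.residue s t).Homotopic g h) :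
    W.Homotopic (g.map hW ![s, t] id) (h.map hW ![s, t] id) := by
  refine homotopic_map (W := W.residue s t) hW _ id (fun x g hg => ?_) H
  refine Homotopic.suite _ ?_
  have h1 : W.IsSuite (W.toPanelSystem.unrestrict ![s, t] g) := hg
  exact (congrArg (fun h : W.Gallery x x => W.IsSuite h)
    (unrestrict_eq_map hW ![s, t] g)).mp h1

end Iso

end WeylData

/-! ### Panels and edges of the quotient by a panel-regular group. -/

namespace Building

open PanelSystem

variable {S : Type u} {M : CoxeterMatrix S} {Δ : Building.{u, v} M} {Γ : Subgroup Δ.Aut}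

theorem panel_eq_iff {s : S} {C D : Δ.Chamber} : Δ.panel s C = Δ.panel s D ↔ Δ.Adj s C D := by
  constructor
  · intro h
    have : D ∈ Δ.panel s D := adj_refl s D
    rwa [← h] at this
  · intro h
    ext E
    exact ⟨fun h' => adj_trans (adj_symm h) h', fun h' => adj_trans h h'⟩

/-- A chamber of the orbit of `E` in the panel of `C` is a translate of `E` by an element moving the
panel of `E` to that of `C`; there is exactly one such element. -/
theorem PanelRegular.existsUnique_adj (h : Δ.PanelRegular Γ) (s : S) (C : Δ.Chamber)
    (Y : MulAction.orbitRel.Quotient Γ Δ.Chamber) :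
    ∃! D : Δ.Chamber, Δ.Adj s C D ∧ Quotient.mk _ D = Y := by
  induction Y using Quotient.inductionOn with
  | h E =>
    obtain ⟨γ, hγ, -⟩ := h s E C
    rw [smul_panel, panel_eq_iff] at hγ
    refine ⟨γ • E, ⟨adj_symm hγ, orbit_mk_smul γ E⟩, ?_⟩
    rintro D ⟨h1, h2⟩
    obtain ⟨γ', rfl⟩ := orbit_mk_eq h2
    rw [(h s E C).unique (y₁ := γ') (y₂ := γ)]
    · rw [smul_panel, panel_eq_iff]
      exact adj_symm h1
    · rw [smul_panel, panel_eq_iff]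
      exact hγ

theorem PanelRegular.quotient_full (h : Δ.PanelRegular Γ) (hfree : Δ.ChamberFree Γ) :
    (Δ.quotient Γ hfree).Full := by
  intro s X Y
  change Nonempty (Δ.OrbitEdge Γ s X Y) ∧ Subsingleton (Δ.OrbitEdge Γ s X Y)
  induction X using Quotient.inductionOn with
  | h C =>
    constructor
    · obtain ⟨D, ⟨h1, rfl⟩, -⟩ := h.existsUnique_adj s C Y
      exact ⟨OrbitEdge.mk Γ h1⟩
    · refine ⟨fun e e' => ?_⟩
      obtain ⟨D, h1, hY, rfl⟩ := e.exists_rep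
      obtain ⟨D', h1', hY', rfl⟩ := e'.exists_rep
      obtain rfl := (h.existsUnique_adj s C Y).unique ⟨h1, hY⟩ ⟨h1', hY'⟩
      rfl

end Building

/-! ### Unique lifting of galleries and the universal cover. -/

namespace Building

open PanelSystem

variable {S : Type u} {M : CoxeterMatrix S} {Δ : Building.{u, v} M}

/-- A map on the chambers of `Δ` which is bijective on every panel. -/
def IsPanelBijective {X : Type w} (Δ : Building.{u, v} M) (κ : Δ.Chamber → X) : Prop :=
  ∀ (s : S) (C : Δ.Chamber) (x : X), ∃! D : Δ.Chamber, Δ.Adj s C D ∧ κ D = x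

namespace IsPanelBijective

section Next

variable {X : Type w} {κ : Δ.Chamber → X} (hκ : Δ.IsPanelBijective κ)

/-- The chamber over `x` in the panel of type `s` of `C`. -/
noncomputable def next (s : S) (C : Δ.Chamber) (x : X) : Δ.Chamber := (hκ s C x).choose

theorem adj_next (s : S) (C : Δ.Chamber) (x : X) : Δ.Adj s C (hκ.next s C x) :=
  (hκ s C x).choose_spec.1.1

theorem map_next (s : S) (C : Δ.Chamber) (x : X) : κ (hκ.next s C x) = x :=
  (hκ s C x).choose_spec.1.2

theorem next_eq {s : S} {C D : Δ.Chamber} {x : X} (h : Δ.Adj s C D) (hx : κ D = x) :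
    hκ.next s C x = D :=
  (hκ s C x).unique ⟨hκ.adj_next s C x, hκ.map_next s C x⟩ ⟨h, hx⟩

end Next

section Development

variable {W : WeylData.{u, v', w'} S} {κ : Δ.Chamber → W.Chamber} (hκ : Δ.IsPanelBijective κ)

/-- The end of the lift of a gallery that starts at a given chamber. -/
noncomputable def dev : ∀ {x y : W.Chamber}, W.Gallery x y → Δ.Chamber → Δ.Chamber
  | _, _, .nil _, C => C
  | _, _, @Gallery.cons _ _ _ y _ s _ g, C => dev g (hκ.next s C y)

theorem map_dev : ∀ {x y : W.Chamber} (g : W.Gallery x y) {C : Δ.Chamber}, κ C = x →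
    κ (hκ.dev g C) = y
  | _, _, .nil _, _, h => h
  | _, _, .cons s _ g, C, _ => map_dev g (hκ.map_next s C _)

theorem dev_append : ∀ {x y z : W.Chamber} (g : W.Gallery x y) (h : W.Gallery y z) (C : Δ.Chamber),
    hκ.dev (g.append h) C = hκ.dev h (hκ.dev g C)
  | _, _, _, .nil _, _, _ => rfl
  | _, _, _, .cons s _ g, h, C => dev_append g h (hκ.next s C _)

/-- The translate of a lift is a lift, and lifts are unique. -/
theorem dev_smul {Γ : Subgroup Δ.Aut} (hΓ : ∀ (γ : Γ) (C : Δ.Chamber), κ (γ • C) = κ C) (γ : Γ) :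
    ∀ {x y : W.Chamber} (g : W.Gallery x y) (C : Δ.Chamber),
      hκ.dev g (γ • C) = γ • hκ.dev g C
  | _, _, .nil _, _ => rfl
  | _, _, @Gallery.cons _ _ _ y _ s _ g, C => by
    have h1 : hκ.next s (γ • C) y = γ • hκ.next s C y :=
      hκ.next_eq (adj_smul γ (hκ.adj_next s C y)) ((hΓ γ _).trans (hκ.map_next s C y))
    change hκ.dev g (hκ.next s (γ • C) y) = _
    rw [h1, dev_smul hΓ γ g]
    rfl

theorem exists_lift : ∀ {x y : W.Chamber} (g : W.Gallery x y) {C : Δ.Chamber}, κ C = x →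
    ∃ g' : Δ.toPanelSystem.Gallery C (hκ.dev g C),
      g'.types = g.types ∧ g'.chambers.map κ = g.chambers
  | _, _, .nil _, C, h => ⟨Gallery.nil (P := Δ.toPanelSystem) C, rfl, by rw [← h]; rfl⟩
  | x, _, @Gallery.cons _ _ _ y _ s _ g, C, h => by
    obtain ⟨g', h1, h2⟩ := exists_lift g (hκ.map_next s C y)
    refine ⟨Gallery.cons (P := Δ.toPanelSystem) s ⟨hκ.adj_next s C y⟩ g', ?_, ?_⟩
    · exact congrArg (List.cons s) h1
    · exact congrArg₂ List.cons h h2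

theorem dev_eq_of_lift : ∀ {x y : W.Chamber} (g : W.Gallery x y) {C D : Δ.toPanelSystem.Chamber}
    (g' : Δ.toPanelSystem.Gallery C D), g'.types = g.types → g'.chambers.map κ = g.chambers →
    hκ.dev g C = D
  | _, _, .nil _, _, _, .nil _, _, _ => rfl
  | _, _, .nil _, _, _, .cons _ _ _, ht, _ => by simp [Gallery.types] at ht
  | _, _, .cons _ _ _, _, _, .nil _, ht, _ => by simp [Gallery.types] at ht
  | _, _, @Gallery.cons _ _ _ y _ s e g, _, _, @Gallery.cons _ _ C C' _ s' e' g', ht, hc => by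
    have ht' : s' :: g'.types = s :: g.types := ht
    have hc' : κ C :: g'.chambers.map κ = _ :: g.chambers := hc
    obtain ⟨hs, htt⟩ := List.cons.inj ht'
    subst hs
    have hc' := (List.cons.inj hc').2
    have hy : κ C' = y := by
      obtain ⟨l, hl⟩ := g.chambers_eq_cons
      obtain ⟨l', hl'⟩ := g'.chambers_eq_cons
      rw [hl, hl'] at hc'
      exact (List.cons.inj hc').1
    have h1 : hκ.next s' C y = C' := hκ.next_eq e'.down hy
    change hκ.dev g (hκ.next s' C y) = _
    rw [h1]
    exact dev_eq_of_lift g g' htt hc'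

/-- Identities and compositions of edges lift within one panel, so homotopy invariance of the end
needs only that the lifts of suites close. -/
theorem dev_eq_of_homotopic
    (H : ∀ (x : W.Chamber) (g : W.Gallery x x), W.IsSuite g → ∀ C, κ C = x → hκ.dev g C = C)
    {x y : W.Chamber} {g h : W.Gallery x y} (hgh : W.Homotopic g h) :
    ∀ {C : Δ.Chamber}, κ C = x → hκ.dev g C = hκ.dev h C := by
  induction hgh with
  | refl g => exact fun _ => rfl
  | symm _ ih => exact fun h => (ih h).symm
  | trans _ _ ih1 ih2 => exact fun h => (ih1 h).trans (ih2 h)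
  | append _ _ ih1 ih2 =>
    intro C h
    rw [dev_append, dev_append, ih1 h]
    exact ih2 (hκ.map_dev _ h)
  | one s x => exact fun h => hκ.next_eq (adj_refl s _) h
  | comp e f =>
    exact fun {C} h => (hκ.next_eq (adj_trans (hκ.adj_next _ C _) (hκ.adj_next _ _ _))
      (hκ.map_next _ _ _)).symm
  | suite g hg => exact fun h => H _ g hg _ h

/-- Two lifts with the same ends are homotopic in the simply connected `Δ`; the homotopy is then
projected. -/
theorem homotopic_of_dev_eq (hM : M.IsTwoThreeInfty) (hW : W.Full)
    (H : ∀ (C : Δ.toPanelSystem.Chamber) (g : Δ.toPanelSystem.Gallery C C), Δ.IsSuite g →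
      W.Homotopic (g.map hW id κ) (Gallery.nil (κ C)))
    {x y : W.Chamber} {g h : W.Gallery x y} {C : Δ.Chamber} (hC : κ C = x)
    (hgh : hκ.dev g C = hκ.dev h C) : W.Homotopic g h := by
  have hy := hκ.map_dev g hC
  obtain ⟨g', h1, h2⟩ := hκ.exists_lift g hC
  have h3 : ∃ h' : Δ.toPanelSystem.Gallery C (hκ.dev g C),
      h'.types = h.types ∧ h'.chambers.map κ = h.chambers := by
    rw [hgh]
    exact hκ.exists_lift h hC
  obtain ⟨h', h4, h5⟩ := h3
  -- The common end depends on `g`; generalizing it allows the endpoints downstairs to be replaced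
  -- by images of the endpoints upstairs.
  revert g' h'
  generalize hκ.dev g C = D at hy
  intro g' h1 h2 h' h4 h5
  subst hC hy
  have e1 : g'.map hW id κ = g := Gallery.ext_of_full hW _ _
    ((Gallery.types_map_id hW κ g').trans h1) ((Gallery.chambers_map hW id κ g').trans h2)
  have e2 : h'.map hW id κ = h := Gallery.ext_of_full hW _ _
    ((Gallery.types_map_id hW κ h').trans h4) ((Gallery.chambers_map hW id κ h').trans h5)
  rw [← e1, ← e2]
  exact WeylData.homotopic_map (W := Δ.toWeylData) hW id κ H (homotopic_of_same_ends hM g' h')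

open WeylData in
/-- If homotopy is detected by the development, then `Δ` is the universal cover and `Γ` is the
fundamental group. -/
theorem exists_universalCover {Γ : Subgroup Δ.Aut} (hfree : Δ.ChamberFree Γ) (hW : W.Full)
    (horb : ∀ C D : Δ.Chamber, κ C = κ D ↔ ∃ γ : Γ, γ • C = D)
    (hdev : ∀ {x y : W.Chamber} (g h : W.Gallery x y) (C : Δ.Chamber), κ C = x →
      (W.Homotopic g h ↔ hκ.dev g C = hκ.dev h C))
    (C₀ : Δ.Chamber) (x₀ : W.Chamber) (h₀ : κ C₀ = x₀) :
    ∃ (φ : Γ ≃* W.FundamentalGroup x₀) (f : Δ.Chamber ≃ W.UniversalCover x₀),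
      (∀ (s : S) (C D : Δ.Chamber), Δ.Adj s C D ↔ UniversalCover.Adj W s (f C) (f D)) ∧
      ∀ (γ : Γ) (C : Δ.Chamber), f (γ • C) = φ γ • f C := by
  have hinv : ∀ (γ : Γ) (C : Δ.Chamber), κ (γ • C) = κ C := fun γ C =>
    ((horb _ _).2 ⟨γ, rfl⟩).symm
  let d : ∀ {y : W.Chamber}, W.HomotopyClass x₀ y → Δ.Chamber := fun a =>
    Quotient.lift (fun g => hκ.dev g C₀) (fun g h H => (hdev g h C₀ h₀).1 H) a
  have κd : ∀ {y : W.Chamber} (a : W.HomotopyClass x₀ y), κ (d a) = y := by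
    intro y a
    induction a using Quotient.inductionOn
    exact hκ.map_dev _ h₀
  have d_inj : ∀ {y : W.Chamber} {a b : W.HomotopyClass x₀ y}, d a = d b → a = b := by
    intro y a b
    induction a using Quotient.inductionOn
    induction b using Quotient.inductionOn
    exact fun h => Quotient.sound ((hdev _ _ C₀ h₀).2 h)
  have d_append : ∀ {y z : W.Chamber} (a : W.HomotopyClass x₀ y) (h : W.Gallery y z),
      d (a.append (HomotopyClass.mk h)) = hκ.dev h (d a) := by
    intro y z a h
    induction a using Quotient.inductionOn
    exact hκ.dev_append _ _ _
  let D : W.UniversalCover x₀ → Δ.Chamber := fun b => d b.2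
  have hD : Function.Bijective D := by
    constructor
    · rintro ⟨y, a⟩ ⟨y', a'⟩ (h : d a = d a')
      obtain rfl : y = y' := by rw [← κd a, ← κd a', h]
      rw [d_inj h]
    · intro E
      obtain ⟨g, -⟩ := exists_gallery_length_eq C₀ E
      subst h₀
      exact ⟨⟨κ E, HomotopyClass.mk (g.map hW id κ)⟩, hκ.dev_eq_of_lift _ g
        (Gallery.types_map_id hW κ g).symm (Gallery.chambers_map hW id κ g).symm⟩
  -- The lift of a closed gallery ends in the orbit of `C₀`, and freeness makes the corresponding
  -- element of `Γ` unique.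
  have hψ : ∀ a : W.FundamentalGroup x₀, ∃ γ : Γ,
      γ • C₀ = d (a : W.HomotopyClass x₀ x₀) := fun a =>
    (horb _ _).1 (h₀.trans (κd (a : W.HomotopyClass x₀ x₀)).symm)
  choose ψ hψ using hψ
  -- Lifting `a` followed by `b` means lifting `b` from `ψ a • C₀`, which is the translate by `ψ a`
  -- of the lift from `C₀`. Hence `ψ` preserves the order of products.
  have d_smul : ∀ (a : W.FundamentalGroup x₀) {y : W.Chamber} (b : W.HomotopyClass x₀ y),
      d (HomotopyClass.append (a : W.HomotopyClass x₀ x₀) b) = ψ a • d b := by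
    intro a y b
    induction b using Quotient.inductionOn with
    | h h =>
      refine (d_append _ h).trans ?_
      rw [← hψ a]
      exact hκ.dev_smul hinv _ _ _
  let Ψ : W.FundamentalGroup x₀ →* Γ := MonoidHom.mk' ψ (by
    intro a b
    refine hfree.eq_of_smul_eq (C := C₀) ?_
    rw [hψ, mul_smul, hψ]
    exact d_smul a _)
  have hΨ : Function.Bijective Ψ := by
    constructor
    · intro a b (h : ψ a = ψ b)
      have h1 : d (a : W.HomotopyClass x₀ x₀) = d (b : W.HomotopyClass x₀ x₀) := by
        rw [← hψ a, ← hψ b, h]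
      exact d_inj h1
    · intro γ
      obtain ⟨⟨y, a⟩, (h : d a = γ • C₀)⟩ := hD.2 (γ • C₀)
      obtain rfl : y = x₀ := by rw [← κd a, h, hinv, h₀]
      refine ⟨a, hfree.eq_of_smul_eq (C := C₀) ?_⟩
      rw [← h]
      exact hψ a
  let f : W.UniversalCover x₀ ≃ Δ.Chamber := Equiv.ofBijective D hD
  refine ⟨(MulEquiv.ofBijective Ψ hΨ).symm, f.symm, ?_, ?_⟩
  · have key : ∀ (s : S) (a b : W.UniversalCover x₀), Δ.Adj s (f a) (f b) ↔
        UniversalCover.Adj W s a b := by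
      rintro s ⟨y, a⟩ ⟨z, b⟩
      change Δ.Adj s (d a) (d b) ↔ ∃ e : W.Edge s y z,
        b = a.append (HomotopyClass.mk (Gallery.single s e))
      constructor
      · intro h
        refine ⟨(hW s y z).1.some, d_inj ?_⟩
        rw [d_append]
        exact (hκ.next_eq h (κd b)).symm
      · rintro ⟨e, rfl⟩
        rw [d_append]
        exact hκ.adj_next s (d a) z
    intro s C E
    rw [← key, Equiv.apply_symm_apply, Equiv.apply_symm_apply]
  · intro γ C
    obtain ⟨a, rfl⟩ := hΨ.2 γ
    obtain ⟨b, rfl⟩ := f.surjective C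
    rw [Equiv.symm_apply_apply, f.symm_apply_eq]
    have h1 : (MulEquiv.ofBijective Ψ hΨ).symm (Ψ a) = a :=
      (MulEquiv.ofBijective Ψ hΨ).symm_apply_apply a
    rw [h1]
    exact (d_smul a b.2).symm

end Development

end IsPanelBijective

end Building

/-! ### Group relations implied by the defining suites. -/

section Algebra

variable {G A : Type*} [Group G] [AddCommGroup A]

/-- The suites, with the degenerate cases covered by `f 0 = 1`, say that `(f y)⁻¹ * f z = f (z -
y)`. The alternating product therefore depends only on the two differences, which are opposite. -/
theorem digon_relation {f : A → G} (h0 : f 0 = 1)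
    (h : ∀ y z, 0 ≠ y → y ≠ z → (f y)⁻¹ * f z * ((f (z - y))⁻¹ * f 0) = 1) {x₀ x₁ x₂ x₃ : A}
    (hx : x₀ - x₁ + x₂ - x₃ = 0) : (f x₁)⁻¹ * f x₂ * ((f x₃)⁻¹ * f x₀) = 1 := by
  have key : ∀ y z, (f y)⁻¹ * f z = f (z - y) := by
    intro y z
    by_cases hy : y = 0
    · simp [hy, h0]
    by_cases hyz : y = z
    · simp [hyz, h0]
    have := h y z (Ne.symm hy) hyz
    rwa [h0, mul_one, mul_inv_eq_one] at this
  have h1 : ∀ a, f a * f (-a) = 1 := by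
    intro a
    have := key a 0
    rw [h0, zero_sub, mul_one] at this
    rw [← this, mul_inv_cancel]
  rw [key, key, show x₀ - x₃ = -(x₂ - x₁) by
    rw [← sub_eq_zero, ← hx]; abel]
  exact h1 _

/-- The suites make `(f x)⁻¹ * f y * (f z)⁻¹` a function of `x - y + z` alone, computed from a
representation of that residue as a difference. A hexagon with alternating sum zero splits into two
such triples with the same value. -/
theorem triangle_relation {D : Set A} (zero_mem : 0 ∈ D)
    (hD : ∀ n : A, n ≠ 0 → ∃! p : A × A, p.1 ∈ D ∧ p.2 ∈ D ∧ p.1 - p.2 = n) {f : D → G}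
    (h0 : f ⟨0, zero_mem⟩ = 1)
    (h : ∀ x y z y' x' : D, (0 : A) ≠ x → (x : A) ≠ y → (y : A) ≠ z → (y' - x' : A) = x - y + z →
      (f x)⁻¹ * f y * ((f z)⁻¹ * f y' * ((f x')⁻¹ * f ⟨0, zero_mem⟩)) = 1)
    {x₀ x₁ x₂ x₃ x₄ x₅ : D} (hx : (x₀ - x₁ + x₂ - x₃ + x₄ - x₅ : A) = 0) :
    (f x₁)⁻¹ * f x₂ * ((f x₃)⁻¹ * f x₄ * ((f x₅)⁻¹ * f x₀)) = 1 := by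
  have uniq : ∀ a b c d : D, (a - b : A) = c - d → a ≠ b → a = c ∧ b = d := by
    intro a b c d hab hne
    have h1 := (hD (a - b : A) (sub_ne_zero.2 fun h => hne (Subtype.ext h))).unique
      (y₁ := (↑a, ↑b)) (y₂ := (↑c, ↑d)) ⟨a.2, b.2, rfl⟩ ⟨c.2, d.2, hab.symm⟩
    exact ⟨Subtype.ext (congrArg Prod.fst h1), Subtype.ext (congrArg Prod.snd h1)⟩
  have key : ∀ x y z y' x' : D, (y' - x' : A) = x - y + z →
      (f x)⁻¹ * f y * (f z)⁻¹ = f x' * (f y')⁻¹ := by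
    intro x y z y' x' hxyz
    -- The suites omit `0 = x`, `x = y` and `y = z`. There `x - y + z` is already a visible
    -- difference, and uniqueness of differences forces `y'` and `x'`, or `y' = x'` if it is zero.
    by_cases hx : (0 : A) = x
    · obtain rfl : x = ⟨0, zero_mem⟩ := Subtype.ext hx.symm
      rw [h0]
      by_cases hyz : z = y
      · subst hyz
        have : y' = x' := Subtype.ext (sub_eq_zero.1 (by rw [hxyz]; simp))
        simp [this]
      · obtain ⟨rfl, rfl⟩ := uniq z y y' x' (by rw [hxyz]; simp [sub_eq_neg_add]) hyz
        simp
    by_cases hxy : x = y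
    · subst hxy
      by_cases hz : z = ⟨0, zero_mem⟩
      · subst hz
        have : y' = x' := Subtype.ext (sub_eq_zero.1 (by rw [hxyz]; simp))
        simp [this, h0]
      · obtain ⟨rfl, rfl⟩ := uniq z ⟨0, zero_mem⟩ y' x' (by rw [hxyz]; simp) hz
        simp [h0]
    by_cases hyz : y = z
    · subst hyz
      obtain ⟨rfl, rfl⟩ := uniq x ⟨0, zero_mem⟩ y' x' (by rw [hxyz]; simp)
        (fun h => hx (by rw [h]))
      simp [h0]
    have h1 := h x y z y' x' hx (fun h => hxy (Subtype.ext h)) (fun h => hyz (Subtype.ext h)) hxyz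
    rw [h0, mul_one, ← mul_assoc, ← mul_assoc, mul_inv_eq_one, ← eq_mul_inv_iff_mul_eq] at h1
    exact h1
  have hex : ∀ n : A, ∃ a b : D, (a - b : A) = n := by
    intro n
    by_cases hn : n = 0
    · exact ⟨⟨0, zero_mem⟩, ⟨0, zero_mem⟩, by simp [hn]⟩
    · obtain ⟨p, ⟨h1, h2, h3⟩, -⟩ := hD n hn
      exact ⟨⟨p.1, h1⟩, ⟨p.2, h2⟩, h3⟩
  obtain ⟨a, b, hab⟩ := hex (x₁ - x₂ + x₃)
  have k1 := key x₁ x₂ x₃ a b hab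
  have k2 := key x₀ x₅ x₄ a b (by
    rw [hab, ← sub_eq_zero, ← neg_eq_zero, ← hx]; abel)
  calc (f x₁)⁻¹ * f x₂ * ((f x₃)⁻¹ * f x₄ * ((f x₅)⁻¹ * f x₀))
      = ((f x₁)⁻¹ * f x₂ * (f x₃)⁻¹) * ((f x₀)⁻¹ * f x₅ * (f x₄)⁻¹)⁻¹ := by group
    _ = 1 := by rw [k1, k2, mul_inv_cancel]

end Algebra

/-! ### Null-homotopic galleries in rank two, by collapsing the edges of one label. -/

namespace WeylData

open PanelSystem

section Holonomy

variable {W : WeylData.{0, v, w} (Fin 2)} (hW : W.Full) (o : W.Chamber)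

/-- The class of the edge of type `i` from `x` to `y`. -/
noncomputable def edgeClass (i : Fin 2) (x y : W.Chamber) : W.HomotopyClass x y :=
  HomotopyClass.mk (Gallery.single i (hW i x y).1.some)

theorem mk_cons {i : Fin 2} {x y z : W.Chamber} (e : W.Edge i x y) (g : W.Gallery y z) :
    (HomotopyClass.mk (Gallery.cons i e g) : W.HomotopyClass x z) =
      (edgeClass hW i x y).append (HomotopyClass.mk g) := by
  rw [show e = (hW i x y).1.some from (hW i x y).2.elim _ _]
  rfl

theorem edgeClass_append (i : Fin 2) (x y z : W.Chamber) :
    (edgeClass hW i x y).append (edgeClass hW i y z) = edgeClass hW i x z := by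
  refine Quotient.sound ?_
  rw [show (hW i x z).1.some = W.comp (hW i x y).1.some (hW i y z).1.some from
    (hW i x z).2.elim _ _]
  exact Homotopic.comp _ _

theorem edgeClass_append_append (i : Fin 2) (x y z t : W.Chamber) (a : W.HomotopyClass z t) :
    (edgeClass hW i x y).append ((edgeClass hW i y z).append a) =
      (edgeClass hW i x z).append a := by
  rw [← HomotopyClass.append_assoc, edgeClass_append]

theorem edgeClass_self (i : Fin 2) (x : W.Chamber) :
    edgeClass hW i x x = HomotopyClass.mk (Gallery.nil x) := by
  refine Quotient.sound ?_
  rw [show (hW i x x).1.some = W.one i x from (hW i x x).2.elim _ _]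
  exact Homotopic.one _ _

/-- The loop at `o` through `x` with the labels `1` and `0`. -/
noncomputable def bigon (x : W.Chamber) : W.FundamentalGroup o :=
  (edgeClass hW 1 o x).append (edgeClass hW 0 x o)

theorem bigon_self : bigon hW o o = 1 := by
  rw [bigon, edgeClass_self, edgeClass_self, HomotopyClass.nil_append]
  rfl

/-- The loop at `o` which joins a gallery to `o` by edges with label `0`. -/
noncomputable def closeUp {x y : W.Chamber} (a : W.HomotopyClass x y) : W.FundamentalGroup o :=
  (edgeClass hW 0 o x).append (a.append (edgeClass hW 0 y o))

/-- The edges labelled `0` serve as a maximal tree: the detour to `o` and back at `y` cancels. -/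
theorem closeUp_append {x y z : W.Chamber} (a : W.HomotopyClass x y) (b : W.HomotopyClass y z) :
    closeUp hW o (a.append b) = closeUp hW o a * closeUp hW o b := by
  change _ = HomotopyClass.append (closeUp hW o a) (closeUp hW o b)
  simp only [closeUp, HomotopyClass.append_assoc]
  rw [edgeClass_append_append, edgeClass_self, HomotopyClass.nil_append]

theorem closeUp_nil (x : W.Chamber) : closeUp hW o (HomotopyClass.mk (Gallery.nil x)) = 1 := by
  rw [closeUp, HomotopyClass.nil_append, edgeClass_append, edgeClass_self]
  rfl

theorem closeUp_zero (x y : W.Chamber) : closeUp hW o (edgeClass hW 0 x y) = 1 := by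
  rw [closeUp, edgeClass_append, edgeClass_append, edgeClass_self]
  rfl

theorem closeUp_one (x y : W.Chamber) :
    closeUp hW o (edgeClass hW 1 x y) = (bigon hW o x)⁻¹ * bigon hW o y := by
  rw [eq_inv_mul_iff_mul_eq]
  change HomotopyClass.append (bigon hW o x) (closeUp hW o (edgeClass hW 1 x y)) = _
  simp only [closeUp, bigon, HomotopyClass.append_assoc]
  rw [edgeClass_append_append, edgeClass_self, HomotopyClass.nil_append, edgeClass_append_append]

/-- The product of the contributions of the edges with label `1`. -/
def holonomy {X G : Type*} [Group G] (f : X → G) : List (Fin 2) → List X → G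
  | i :: l, x :: y :: m => (if i = 0 then 1 else (f x)⁻¹ * f y) * holonomy f l (y :: m)
  | _, _ => 1

theorem closeUp_mk : ∀ {x y : W.Chamber} (g : W.Gallery x y),
    closeUp hW o (HomotopyClass.mk g) = holonomy (bigon hW o) g.types g.chambers
  | _, _, .nil x => closeUp_nil hW o x
  | x, _, @Gallery.cons _ _ _ y _ i e g => by
    rw [mk_cons hW, closeUp_append, closeUp_mk g]
    obtain ⟨l, hl⟩ := g.chambers_eq_cons
    change _ = holonomy (bigon hW o) (i :: g.types) (x :: g.chambers)
    rw [hl, holonomy]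
    congr 1
    fin_cases i
    · exact closeUp_zero hW o x y
    · exact closeUp_one hW o x y

/-- Joining a closed gallery to `o` by edges labelled `0` is a conjugation, so no information is
lost, and the resulting loop is a product of bigons contributed by the edges labelled `1`. -/
theorem homotopic_nil_iff_holonomy {x : W.Chamber} (g : W.Gallery x x) :
    W.Homotopic g (Gallery.nil x) ↔ holonomy (bigon hW o) g.types g.chambers = 1 := by
  rw [← closeUp_mk]
  constructor
  · intro h
    rw [show (HomotopyClass.mk g : W.HomotopyClass x x) = HomotopyClass.mk (Gallery.nil x) from
      Quotient.sound h, closeUp_nil]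
  · intro h
    have h1 : (edgeClass hW 0 x o).append (HomotopyClass.append (closeUp hW o (HomotopyClass.mk g))
        (edgeClass hW 0 o x)) = HomotopyClass.mk g := by
      simp only [closeUp, HomotopyClass.append_assoc]
      rw [edgeClass_append_append, edgeClass_append, edgeClass_self,
        HomotopyClass.nil_append, HomotopyClass.append_nil]
    rw [h] at h1
    refine Quotient.exact (h1.symm.trans ?_)
    change (edgeClass hW 0 x o).append ((HomotopyClass.mk (Gallery.nil o)).append _) = _
    rw [HomotopyClass.nil_append, edgeClass_append, edgeClass_self]
    rfl

end Holonomy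

end WeylData

/-! ### Null-homotopic galleries in Singer digons and triangles. -/

section Singer

open PanelSystem WeylData

theorem singerDigon_full (q : ℕ) : (singerDigon q).Full := connectedSetoid_full _ _

theorem singerTriangle_full (q : ℕ) (D : Set (ZMod (q ^ 2 + q + 1))) :
    (singerTriangle q D).Full := connectedSetoid_full _ _

/-- Closed galleries of the Singer cyclic digon with alternating sum zero are null-homotopic. -/
theorem singerDigon_homotopic_nil {q : ℕ} {x : (singerDigon q).Chamber}
    (g : (singerDigon q).Gallery x x) {x₀ x₁ x₂ x₃ : ZMod (q + 1)}
    (ht : g.types = [0, 1, 0, 1] ∨ g.types = [1, 0, 1, 0]) (hc : g.chambers = [x₀, x₁, x₂, x₃, x₀])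
    (hx : x₀ - x₁ + x₂ - x₃ = 0) : (singerDigon q).Homotopic g (Gallery.nil x) := by
  let o : (singerDigon q).Chamber := (0 : ZMod (q + 1))
  let f : ZMod (q + 1) → (singerDigon q).FundamentalGroup o := bigon (singerDigon_full q) o
  have h0 : f 0 = 1 := bigon_self (singerDigon_full q) o
  -- The holonomies of the defining suites are the relations assumed in `digon_relation`.
  have h : ∀ y z, 0 ≠ y → y ≠ z → (f y)⁻¹ * f z * ((f (z - y))⁻¹ * f 0) = 1 := by
    intro y z hy hyz
    let k : (singerDigon q).Gallery o o :=
      .cons (y := (y : ZMod (q + 1))) 0 PUnit.unit (.cons (y := (z : ZMod (q + 1))) 1 PUnit.unit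
        (.cons (y := (z - y : ZMod (q + 1))) 0 PUnit.unit (.single 1 PUnit.unit)))
    have hk : (singerDigon q).Homotopic k (Gallery.nil o) :=
      Homotopic.suite _ ⟨rfl, y, z, hy, hyz, rfl⟩
    have := (homotopic_nil_iff_holonomy (singerDigon_full q) o k).1 hk
    change 1 * ((f y)⁻¹ * f z * (1 * ((f (z - y))⁻¹ * f 0 * 1))) = 1 at this
    simpa only [one_mul, mul_one] using this
  rw [homotopic_nil_iff_holonomy (singerDigon_full q) o]
  rcases ht with ht | ht <;> rw [ht, hc]
  · change 1 * ((f x₁)⁻¹ * f x₂ * (1 * ((f x₃)⁻¹ * f x₀ * 1))) = 1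
    simp only [one_mul, mul_one]
    exact digon_relation h0 h hx
  -- Starting with the label `1` shifts the contributing edges by one place, which changes the sign
  -- of the alternating sum.
  · change (f x₀)⁻¹ * f x₁ * (1 * ((f x₂)⁻¹ * f x₃ * (1 * 1))) = 1
    simp only [one_mul, mul_one]
    refine digon_relation h0 h ?_
    rw [← neg_eq_zero, ← hx]
    abel

/-- Closed galleries of the Singer cyclic triangle with alternating sum zero are
null-homotopic. -/
theorem singerTriangle_homotopic_nil {q : ℕ} {D : Set (ZMod (q ^ 2 + q + 1))}
    (hD : IsDifferenceSet q D) (zero_mem : 0 ∈ D) {x : (singerTriangle q D).Chamber}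
    (g : (singerTriangle q D).Gallery x x) {x₀ x₁ x₂ x₃ x₄ x₅ : D}
    (ht : g.types = [0, 1, 0, 1, 0, 1] ∨ g.types = [1, 0, 1, 0, 1, 0])
    (hc : g.chambers = [x₀, x₁, x₂, x₃, x₄, x₅, x₀])
    (hx : (x₀ - x₁ + x₂ - x₃ + x₄ - x₅ : ZMod (q ^ 2 + q + 1)) = 0) :
    (singerTriangle q D).Homotopic g (Gallery.nil x) := by
  let o : (singerTriangle q D).Chamber := (⟨0, zero_mem⟩ : D)
  let f : D → (singerTriangle q D).FundamentalGroup o := bigon (singerTriangle_full q D) o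
  have h0 : f ⟨0, zero_mem⟩ = 1 := bigon_self (singerTriangle_full q D) o
  have h : ∀ x y z y' x' : D, (0 : ZMod (q ^ 2 + q + 1)) ≠ x → (x : ZMod (q ^ 2 + q + 1)) ≠ y →
      (y : ZMod (q ^ 2 + q + 1)) ≠ z → (y' - x' : ZMod (q ^ 2 + q + 1)) = x - y + z →
      (f x)⁻¹ * f y * ((f z)⁻¹ * f y' * ((f x')⁻¹ * f ⟨0, zero_mem⟩)) = 1 := by
    intro x y z y' x' h1 h2 h3 h4
    let k : (singerTriangle q D).Gallery o o :=
      .cons (y := (x : D)) 0 PUnit.unit (.cons (y := (y : D)) 1 PUnit.unit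
        (.cons (y := (z : D)) 0 PUnit.unit (.cons (y := (y' : D)) 1 PUnit.unit
          (.cons (y := (x' : D)) 0 PUnit.unit (.single 1 PUnit.unit)))))
    have hk : (singerTriangle q D).Homotopic k (Gallery.nil o) :=
      Homotopic.suite _ ⟨rfl, x, y, z, y', x', h1, h2, h3, h4, rfl⟩
    have := (homotopic_nil_iff_holonomy (singerTriangle_full q D) o k).1 hk
    change 1 * ((f x)⁻¹ * f y * (1 * ((f z)⁻¹ * f y' *
      (1 * ((f x')⁻¹ * f ⟨0, zero_mem⟩ * 1))))) = 1 at this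
    simpa only [one_mul, mul_one] using this
  rw [homotopic_nil_iff_holonomy (singerTriangle_full q D) o]
  rcases ht with ht | ht <;> rw [ht, hc]
  · change 1 * ((f x₁)⁻¹ * f x₂ * (1 * ((f x₃)⁻¹ * f x₄ * (1 * ((f x₅)⁻¹ * f x₀ * 1))))) = 1
    simp only [one_mul, mul_one]
    exact triangle_relation zero_mem hD h0 h hx
  · change (f x₀)⁻¹ * f x₁ * (1 * ((f x₂)⁻¹ * f x₃ * (1 * ((f x₄)⁻¹ * f x₅ * (1 * 1))))) = 1
    simp only [one_mul, mul_one]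
    refine triangle_relation zero_mem hD h0 h ?_
    rw [← neg_eq_zero, ← hx]
    abel

end Singer

/-! ### Residues of types 2 and 3 in the building. -/

namespace Building

open PanelSystem

variable {S : Type u} {M : CoxeterMatrix S} {Δ : Building.{u, v} M} {Γ : Subgroup Δ.Aut}

section Residues

/-- Products of this shape are stable under left multiplication by the two commuting involutions. -/
theorem mem_closure_of_two {s t : S} (h : M s t = 2) {w : M.Group}
    (hw : w ∈ Subgroup.closure {M.simple s, M.simple t}) :
    ∃ a b : M.Group, (a = 1 ∨ a = M.simple s) ∧ (b = 1 ∨ b = M.simple t) ∧ w = a * b := by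
  have hs : M.simple s * M.simple s = 1 := M.toCoxeterSystem.simple_mul_simple_self s
  have ht : M.simple t * M.simple t = 1 := M.toCoxeterSystem.simple_mul_simple_self t
  have hc := CoxeterSystem.braid_two h
  have key : ∀ x ∈ ({M.simple s, M.simple t} : Set M.Group), ∀ w : M.Group,
      (∃ a b : M.Group, (a = 1 ∨ a = M.simple s) ∧ (b = 1 ∨ b = M.simple t) ∧ w = a * b) →
      ∃ a b : M.Group, (a = 1 ∨ a = M.simple s) ∧ (b = 1 ∨ b = M.simple t) ∧ x * w = a * b := by
    rintro x (rfl | rfl) w ⟨a, b, ha, hb, rfl⟩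
    · refine ⟨M.simple s * a, b, ?_, hb, (mul_assoc _ _ _).symm⟩
      rcases ha with rfl | rfl
      · exact Or.inr (mul_one _)
      · exact Or.inl hs
    · refine ⟨a, M.simple t * b, ha, ?_, ?_⟩
      · rcases hb with rfl | rfl
        · exact Or.inr (mul_one _)
        · exact Or.inl ht
      · rcases ha with rfl | rfl
        · rw [one_mul, one_mul]
        · rw [← mul_assoc, ← mul_assoc, hc]
  induction hw using Subgroup.closure_induction_left with
  | one => exact ⟨1, 1, Or.inl rfl, Or.inl rfl, (one_mul 1).symm⟩
  | mul_left x hx y _ ih => exact key x hx y ih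
  | inv_mul_cancel x hx y _ ih =>
    have : x⁻¹ = x := by
      rcases hx with rfl | rfl
      · exact M.toCoxeterSystem.inv_simple s
      · exact M.toCoxeterSystem.inv_simple t
    rw [this]
    exact key x hx y ih

/-- The braid relation keeps products of this shape stable under left multiplication by both
generators. Trivial factors are allowed, so that one normal form covers all six elements. -/
theorem mem_closure_of_three {s t : S} (h : M s t = 3) {w : M.Group}
    (hw : w ∈ Subgroup.closure {M.simple s, M.simple t}) :
    ∃ a b c : M.Group, (a = 1 ∨ a = M.simple s) ∧ (b = 1 ∨ b = M.simple t) ∧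
      (c = 1 ∨ c = M.simple s) ∧ w = a * (b * c) := by
  have ht : ∀ w, M.simple t * (M.simple t * w) = w := fun w =>
    M.toCoxeterSystem.simple_mul_simple_cancel_left t
  have ht' : M.simple t * M.simple t = 1 := M.toCoxeterSystem.simple_mul_simple_self t
  have hs' : M.simple s * M.simple s = 1 := M.toCoxeterSystem.simple_mul_simple_self s
  have hc := CoxeterSystem.braid_three h
  have key : ∀ x ∈ ({M.simple s, M.simple t} : Set M.Group), ∀ w : M.Group,
      (∃ a b c : M.Group, (a = 1 ∨ a = M.simple s) ∧ (b = 1 ∨ b = M.simple t) ∧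
        (c = 1 ∨ c = M.simple s) ∧ w = a * (b * c)) →
      ∃ a b c : M.Group, (a = 1 ∨ a = M.simple s) ∧ (b = 1 ∨ b = M.simple t) ∧
        (c = 1 ∨ c = M.simple s) ∧ x * w = a * (b * c) := by
    rintro x (rfl | rfl) w ⟨a, b, c, ha, hb, hc', rfl⟩
    · refine ⟨M.simple s * a, b, c, ?_, hb, hc', (mul_assoc _ _ _).symm⟩
      rcases ha with rfl | rfl
      · exact Or.inr (mul_one _)
      · exact Or.inl hs'
    · rcases ha with rfl | rfl
      · refine ⟨1, M.simple t * b, c, Or.inl rfl, ?_, hc', by simp [mul_assoc]⟩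
        rcases hb with rfl | rfl
        · exact Or.inr (mul_one _)
        · exact Or.inl ht'
      · rcases hb with rfl | rfl
        · rcases hc' with rfl | rfl
          · exact ⟨1, M.simple t, M.simple s, Or.inl rfl, Or.inr rfl, Or.inr rfl, by simp⟩
          · exact ⟨1, M.simple t, 1, Or.inl rfl, Or.inr rfl, Or.inl rfl, by simp [hs']⟩
        · rcases hc' with rfl | rfl
          · exact ⟨M.simple s, M.simple t, M.simple s, Or.inr rfl, Or.inr rfl, Or.inr rfl, by
              rw [mul_one, hc]⟩
          · exact ⟨M.simple s, M.simple t, 1, Or.inr rfl, Or.inr rfl, Or.inl rfl, by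
              rw [hc, ht, mul_one]⟩
  induction hw using Subgroup.closure_induction_left with
  | one => exact ⟨1, 1, 1, Or.inl rfl, Or.inl rfl, Or.inl rfl, by simp⟩
  | mul_left x hx y _ ih => exact key x hx y ih
  | inv_mul_cancel x hx y _ ih =>
    have : x⁻¹ = x := by
      rcases hx with rfl | rfl
      · exact M.toCoxeterSystem.inv_simple s
      · exact M.toCoxeterSystem.inv_simple t
    rw [this]
    exact key x hx y ih

theorem exists_adj_of_dist_eq_mul {s : S} {C D : Δ.Chamber} {a w : M.Group}
    (ha : a = 1 ∨ a = M.simple s) (h : Δ.dist C D = a * w) :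
    ∃ E, Δ.Adj s C E ∧ Δ.dist E D = w := by
  rcases ha with rfl | rfl
  · exact ⟨C, adj_refl s C, by rw [h, one_mul]⟩
  · obtain ⟨E, h1, h2⟩ := Δ.exists_dist_eq s C D
    refine ⟨E, Or.inr (dist_simple_symm h1), ?_⟩
    rw [h2, h]
    exact M.toCoxeterSystem.simple_mul_simple_cancel_left s

theorem exists_path_of_two {s t : S} (h : M s t = 2) {C D : Δ.Chamber} (hD : D ∈ Δ.residue s t C) :
    ∃ E, Δ.Adj s C E ∧ Δ.Adj t E D := by
  obtain ⟨a, b, ha, hb, hw⟩ := mem_closure_of_two h hD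
  obtain ⟨E, h1, h2⟩ := exists_adj_of_dist_eq_mul ha hw
  refine ⟨E, h1, ?_⟩
  rcases hb with rfl | rfl
  · exact Or.inl h2
  · exact Or.inr h2

theorem exists_path_of_three {s t : S} (h : M s t = 3) {C D : Δ.Chamber}
    (hD : D ∈ Δ.residue s t C) : ∃ E F, Δ.Adj s C E ∧ Δ.Adj t E F ∧ Δ.Adj s F D := by
  obtain ⟨a, b, c, ha, hb, hc, hw⟩ := mem_closure_of_three h hD
  obtain ⟨E, h1, h2⟩ := exists_adj_of_dist_eq_mul ha hw
  obtain ⟨F, h3, h4⟩ := exists_adj_of_dist_eq_mul hb h2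
  refine ⟨E, F, h1, h3, ?_⟩
  rcases hc with rfl | rfl
  · exact Or.inl h4
  · exact Or.inr h4

theorem residue_eq_of_adj_left {s t : S} {C D : Δ.Chamber} (h : Δ.Adj s C D ∨ Δ.Adj t C D) :
    Δ.residue s t C = Δ.residue s t D := by
  have hs : M.simple s ∈ Subgroup.closure {M.simple s, M.simple t} :=
    Subgroup.subset_closure (Or.inl rfl)
  have ht : M.simple t ∈ Subgroup.closure {M.simple s, M.simple t} :=
    Subgroup.subset_closure (Or.inr rfl)
  ext E
  change Δ.dist C E ∈ Subgroup.closure _ ↔ Δ.dist D E ∈ Subgroup.closure _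
  rcases h with h | h <;> rcases dist_mem_of_adj h E with h1 | h1 <;> rw [h1]
  · exact Subgroup.mul_mem_cancel_left _ hs
  · exact Subgroup.mul_mem_cancel_left _ ht

theorem smul_residue (γ : Γ) (s t : S) (C : Δ.Chamber) :
    γ • Δ.residue s t C = Δ.residue s t (γ • C) := by
  ext D
  rw [Set.mem_smul_set_iff_inv_smul_mem]
  have h1 : Δ.dist (γ • C) (γ • γ⁻¹ • D) = Δ.dist C (γ⁻¹ • D) := γ.1.2 C (γ⁻¹ • D)
  rw [smul_inv_smul] at h1
  change Δ.dist C (γ⁻¹ • D) ∈ Subgroup.closure _ ↔ Δ.dist (γ • C) D ∈ Subgroup.closure _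
  rw [h1]

theorem eq_of_adj_of_adj (hM : M.IsTwoThreeInfty) {s t : S} (hst : s ≠ t) {C D : Δ.Chamber}
    (hs : Δ.Adj s C D) (ht : Δ.Adj t C D) : C = D := by
  rcases hs with hs | hs
  · exact (Δ.dist_eq_one_iff C D).1 hs
  · rcases ht with ht | ht
    · exact (Δ.dist_eq_one_iff C D).1 ht
    · exact absurd (hs.symm.trans ht) (CoxeterMatrix.simple_ne_simple hM hst)

/-- In a projective plane, two distinct points are on at most one line. -/
theorem eq_and_eq_of_three (hM : M.IsTwoThreeInfty) {s t : S} (hst : s ≠ t) (h : M s t = 3)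
    {C C' E E' : Δ.Chamber} (h1 : Δ.Adj s C E) (h2 : Δ.Adj t C C') (h3 : Δ.Adj t E E')
    (h4 : Δ.Adj s C' E') (hn : ¬ Δ.Adj s C C') : C = E ∧ C' = E' := by
  by_cases hCE : C = E
  · subst hCE
    exact ⟨rfl, eq_of_adj_of_adj hM hst h4 (adj_trans (adj_symm h2) h3)⟩
  exfalso
  have lst := CoxeterSystem.length_simple_mul_simple hM hst
  have ltst := CoxeterSystem.length_simple_mul_simple_mul_simple hM hst.symm
    (show M t s = 3 by rw [M.symmetric, h])
  have lt : M.toCoxeterSystem.length (M.simple t) = 1 := M.toCoxeterSystem.length_simple t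
  have ls : M.toCoxeterSystem.length (M.simple s) = 1 := M.toCoxeterSystem.length_simple s
  have dEC : Δ.dist E C = M.simple s := by
    rcases adj_symm h1 with h5 | h5
    · exact absurd ((Δ.dist_eq_one_iff E C).1 h5).symm hCE
    · exact h5
  have dCC' : Δ.dist C C' = M.simple t := by
    rcases h2 with h5 | h5
    · exact absurd (Or.inl h5) hn
    · exact h5
  -- If `C ≠ E`, the distance from `E` to `C'` is `st`. The distance from the `t`-neighbour `E'` is
  -- then `st` or `tst`, of length at least 2, while `h4` bounds it by 1.
  have dEC' := dist_mul_of_length dEC dCC' (by rw [lst, lt])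
  have l1 : M.toCoxeterSystem.length (Δ.dist E' C') ≤ 1 := by
    rcases adj_symm h4 with h5 | h5 <;> rw [h5]
    · rw [M.toCoxeterSystem.length_one]; omega
    · rw [ls]
  rcases dist_mem_of_adj (adj_symm h3) C' with h5 | h5 <;> rw [h5, dEC'] at l1 <;> omega

end Residues

/-! ### Indexing panels by group elements; positions of orbits in a residue. -/

section Movers

variable (h : Δ.PanelRegular Γ)

/-- The element of `Γ` which moves the panel of type `s` of `C₀` to the one of `C`. -/
noncomputable def PanelRegular.mover (C₀ : Δ.Chamber) (s : S) (C : Δ.Chamber) : Γ :=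
  (h s C₀ C).choose

variable {C₀ : Δ.Chamber}

theorem PanelRegular.adj_mover (s : S) (C : Δ.Chamber) : Δ.Adj s (h.mover C₀ s C • C₀) C := by
  rw [← panel_eq_iff, ← smul_panel]
  exact (h s C₀ C).choose_spec.1

theorem PanelRegular.mover_eq {s : S} {C : Δ.Chamber} {γ : Γ} (hγ : Δ.Adj s (γ • C₀) C) :
    h.mover C₀ s C = γ := by
  refine (h s C₀ C).unique (h s C₀ C).choose_spec.1 ?_
  rw [smul_panel, panel_eq_iff]
  exact hγ

theorem PanelRegular.mover_eq_iff {s : S} {C D : Δ.Chamber} :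
    h.mover C₀ s C = h.mover C₀ s D ↔ Δ.Adj s C D := by
  constructor
  · intro h1
    have h2 := h.adj_mover (C₀ := C₀) s C
    rw [h1] at h2
    exact adj_trans (adj_symm h2) (h.adj_mover s D)
  · intro h1
    exact h.mover_eq (adj_trans (h.adj_mover s D) (adj_symm h1))

theorem PanelRegular.mover_smul (s : S) (γ : Γ) (C : Δ.Chamber) :
    h.mover C₀ s (γ • C) = γ * h.mover C₀ s C := by
  refine h.mover_eq ?_
  rw [mul_smul]
  exact adj_smul γ (h.adj_mover s C)

theorem PanelRegular.mover_self (s : S) : h.mover C₀ s C₀ = 1 :=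
  h.mover_eq (by rw [one_smul]; exact adj_refl s C₀)

/-- Both movers carry the residue of `C₀` to the residue of `C`. -/
theorem PanelRegular.mover_mul_mem (s t : S) (C : Δ.Chamber) :
    (h.mover C₀ s C)⁻¹ * h.mover C₀ t C ∈ MulAction.stabilizer Γ (Δ.residue s t C₀) := by
  have h1 : Δ.residue s t (h.mover C₀ s C • C₀) = Δ.residue s t C :=
    residue_eq_of_adj_left (Or.inl (h.adj_mover s C))
  have h2 : Δ.residue s t (h.mover C₀ t C • C₀) = Δ.residue s t C :=
    residue_eq_of_adj_left (Or.inr (h.adj_mover t C))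
  rw [MulAction.mem_stabilizer_iff, mul_smul, smul_residue, h2, ← h1, ← smul_residue,
    inv_smul_smul]

variable (C₀)

/-- The element of the stabilizer of the `{s, t}`-residue of `C₀` that classifies the position of
a `Γ`-orbit of chambers. -/
noncomputable def PanelRegular.position (s t : S) :
    MulAction.orbitRel.Quotient Γ Δ.Chamber → MulAction.stabilizer Γ (Δ.residue s t C₀) :=
  Quotient.lift (fun C => ⟨_, h.mover_mul_mem s t C⟩) (by
    rintro C D ⟨γ, rfl⟩
    refine Subtype.ext ?_
    change (h.mover C₀ s (γ • D))⁻¹ * h.mover C₀ t (γ • D) = _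
    rw [h.mover_smul, h.mover_smul, mul_inv_rev, mul_assoc, inv_mul_cancel_left])

variable {C₀}

theorem PanelRegular.coe_position (s t : S) (C : Δ.Chamber) :
    (h.position C₀ s t (Quotient.mk _ C) : Γ) = (h.mover C₀ s C)⁻¹ * h.mover C₀ t C := rfl

theorem PanelRegular.position_self (s t : S) : h.position C₀ s t (Quotient.mk _ C₀) = 1 := by
  refine Subtype.ext ?_
  rw [h.coe_position, h.mover_self, h.mover_self, inv_one, one_mul]
  rfl

/-- If the positions agree, one element of `Γ` moves both panels of `C` to those of `D`, and two
panels of different types share at most one chamber. -/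
theorem PanelRegular.position_injective (hM : M.IsTwoThreeInfty) {s t : S} (hst : s ≠ t) :
    Function.Injective (h.position C₀ s t) := by
  intro X Y hXY
  induction X using Quotient.inductionOn with
  | h C =>
  induction Y using Quotient.inductionOn with
  | h D =>
  have h1 := congrArg Subtype.val hXY
  rw [h.coe_position, h.coe_position] at h1
  have h2 : (h.mover C₀ s D * (h.mover C₀ s C)⁻¹) • C = D := by
    refine eq_of_adj_of_adj hM hst (h.mover_eq_iff (C₀ := C₀).1 ?_) (h.mover_eq_iff (C₀ := C₀).1 ?_)
    · rw [h.mover_smul, inv_mul_cancel_right]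
    · rw [h.mover_smul, mul_assoc, h1, mul_inv_cancel_left]
  rw [← h2]
  exact (orbit_mk_smul _ C).symm

/-- Adjacent chambers share a mover, so the product telescopes to the quotient of the `t`-movers of
the two ends. -/
theorem PanelRegular.adj_iff_four {s t : S} {C₁ C₂ C₃ C₄ : Δ.Chamber} (h₁ : Δ.Adj s C₁ C₂)
    (h₂ : Δ.Adj t C₂ C₃) (h₃ : Δ.Adj s C₃ C₄) :
    (h.position C₀ s t (Quotient.mk _ C₁))⁻¹ * h.position C₀ s t (Quotient.mk _ C₂) *
      ((h.position C₀ s t (Quotient.mk _ C₃))⁻¹ * h.position C₀ s t (Quotient.mk _ C₄)) = 1 ↔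
      Δ.Adj t C₄ C₁ := by
  rw [← h.mover_eq_iff (C₀ := C₀)] at h₁ h₂ h₃ ⊢
  rw [Subtype.ext_iff]
  simp only [Subgroup.coe_mul, Subgroup.coe_inv, h.coe_position, Subgroup.coe_one, h₁, h₂, h₃]
  have key : ∀ a b c d e : Γ, (a⁻¹ * b)⁻¹ * (a⁻¹ * c) * ((d⁻¹ * c)⁻¹ * (d⁻¹ * e)) = b⁻¹ * e :=
    fun a b c d e => by group
  rw [key, inv_mul_eq_one, eq_comm]

theorem PanelRegular.adj_iff_six {s t : S} {C₁ C₂ C₃ C₄ C₅ C₆ : Δ.Chamber} (h₁ : Δ.Adj s C₁ C₂)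
    (h₂ : Δ.Adj t C₂ C₃) (h₃ : Δ.Adj s C₃ C₄) (h₄ : Δ.Adj t C₄ C₅) (h₅ : Δ.Adj s C₅ C₆) :
    (h.position C₀ s t (Quotient.mk _ C₁))⁻¹ * h.position C₀ s t (Quotient.mk _ C₂) *
      ((h.position C₀ s t (Quotient.mk _ C₃))⁻¹ * h.position C₀ s t (Quotient.mk _ C₄)) *
      ((h.position C₀ s t (Quotient.mk _ C₅))⁻¹ * h.position C₀ s t (Quotient.mk _ C₆)) = 1 ↔
      Δ.Adj t C₆ C₁ := by
  rw [← h.mover_eq_iff (C₀ := C₀)] at h₁ h₂ h₃ h₄ h₅ ⊢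
  rw [Subtype.ext_iff]
  simp only [Subgroup.coe_mul, Subgroup.coe_inv, h.coe_position, Subgroup.coe_one, h₁, h₂, h₃, h₄,
    h₅]
  have key : ∀ a b c d e f g : Γ, (a⁻¹ * b)⁻¹ * (a⁻¹ * c) * ((d⁻¹ * c)⁻¹ * (d⁻¹ * e)) *
      ((f⁻¹ * e)⁻¹ * (f⁻¹ * g)) = b⁻¹ * g := fun a b c d e f g => by group
  rw [key, inv_mul_eq_one, eq_comm]

theorem smul_mem_residue {s t : S}
    (g : MulAction.stabilizer Γ (Δ.residue s t C₀)) : (g : Γ) • C₀ ∈ Δ.residue s t C₀ := by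
  have h1 : C₀ ∈ Δ.residue s t C₀ := by
    change Δ.dist C₀ C₀ ∈ Subgroup.closure {M.simple s, M.simple t}
    rw [dist_self]
    exact Subgroup.one_mem _
  have h2 := Set.smul_mem_smul_set (a := (g : Γ)) h1
  rwa [MulAction.mem_stabilizer_iff.1 g.2] at h2

/-- For surjectivity, `g • C₀` is reached from `C₀` by an `s`-step and a `t`-step; the chamber in
between has movers `1` and `g`. -/
theorem PanelRegular.position_bijective_of_two (hM : M.IsTwoThreeInfty) {s t : S} (hst : s ≠ t)
    (hm : M s t = 2) : Function.Bijective (h.position C₀ s t) := by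
  refine ⟨h.position_injective hM hst, fun g => ?_⟩
  obtain ⟨E, h1, h2⟩ := exists_path_of_two hm (smul_mem_residue g)
  refine ⟨Quotient.mk _ E, Subtype.ext ?_⟩
  rw [h.coe_position, h.mover_eq (γ := 1) (by rw [one_smul]; exact h1),
    h.mover_eq (γ := (g : Γ)) (adj_symm h2), inv_one, one_mul]

/-- Singer's argument: with panels of type `s` as points and panels of type `t` as lines, a
representation of `g` is a line through the points of `C₀` and `g • C₀`. These points are distinct
as `g ≠ 1`. -/
theorem PanelRegular.existsUnique_position_of_three (hM : M.IsTwoThreeInfty) {s t : S}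
    (hst : s ≠ t) (hm : M s t = 3) (g : MulAction.stabilizer Γ (Δ.residue s t C₀)) (hg : g ≠ 1) :
    ∃! p : MulAction.orbitRel.Quotient Γ Δ.Chamber × MulAction.orbitRel.Quotient Γ Δ.Chamber,
      h.position C₀ s t p.1 * (h.position C₀ s t p.2)⁻¹ = g := by
  -- With `C` chosen in the `s`-panel of `C₀` and `C'` in the `t`-panel of `C`, the quotient of
  -- positions collapses to the `s`-mover of `C'`.
  have key : ∀ p : MulAction.orbitRel.Quotient Γ Δ.Chamber ×
      MulAction.orbitRel.Quotient Γ Δ.Chamber,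
      h.position C₀ s t p.1 * (h.position C₀ s t p.2)⁻¹ = g →
      ∃ C C' : Δ.Chamber, Δ.Adj s C₀ C ∧ Δ.Adj t C C' ∧ Δ.Adj s C' ((g : Γ) • C₀) ∧
        p = (Quotient.mk _ C, Quotient.mk _ C') := by
    rintro ⟨X, Y⟩ hp
    obtain ⟨C, ⟨h1, rfl⟩, -⟩ := h.existsUnique_adj s C₀ X
    obtain ⟨C', ⟨h2, rfl⟩, -⟩ := h.existsUnique_adj t C Y
    refine ⟨C, C', h1, h2, ?_, rfl⟩
    have h3 := congrArg Subtype.val hp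
    rw [Subgroup.coe_mul, Subgroup.coe_inv, h.coe_position, h.coe_position,
      h.mover_eq_iff.2 h2, h.mover_eq (γ := 1) (by rw [one_smul]; exact h1), inv_one, one_mul,
      mul_inv_rev, inv_inv, mul_inv_cancel_left] at h3
    have h4 := h.adj_mover (C₀ := C₀) s C'
    rw [h3] at h4
    exact adj_symm h4
  obtain ⟨C, C', h1, h2, h3⟩ := exists_path_of_three hm (smul_mem_residue g)
  refine ⟨(Quotient.mk _ C, Quotient.mk _ C'), ?_, ?_⟩
  · refine Subtype.ext ?_
    rw [Subgroup.coe_mul, Subgroup.coe_inv, h.coe_position, h.coe_position,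
      h.mover_eq_iff.2 h2, h.mover_eq (γ := 1) (by rw [one_smul]; exact h1), inv_one, one_mul,
      mul_inv_rev, inv_inv, mul_inv_cancel_left]
    exact h.mover_eq (adj_symm h3)
  · intro p hp
    obtain ⟨E, E', h1', h2', h3', rfl⟩ := key p hp
    have hn : ¬ Δ.Adj s E E' := by
      intro hn
      apply hg
      refine Subtype.ext ?_
      have h4 : Δ.Adj s ((g : Γ) • C₀) C₀ :=
        adj_symm (adj_trans h1' (adj_trans hn h3'))
      rw [← h.mover_eq h4, h.mover_self]
      rfl
    obtain ⟨rfl, rfl⟩ := eq_and_eq_of_three hM hst hm (adj_trans (adj_symm h1') h1) h2' h2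
      (adj_trans h3' (adj_symm h3)) hn
    rfl

/-- Quotients of positions put ordered pairs of distinct orbits in bijection with the non-trivial
elements, giving `(q + 1) * q + 1`; finiteness of the stabilizer comes from the same bijection. -/
theorem PanelRegular.card_of_three (h : Δ.PanelRegular Γ) (hM : M.IsTwoThreeInfty) {s t : S}
    (hst : s ≠ t) (hm : M s t = 3) {q : ℕ}
    (hq : Nat.card (MulAction.orbitRel.Quotient Γ Δ.Chamber) = q + 1) :
    Nat.card (MulAction.stabilizer Γ (Δ.residue s t C₀)) = q ^ 2 + q + 1 := by
  classical
  set Q := MulAction.orbitRel.Quotient Γ Δ.Chamber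
  set G := MulAction.stabilizer Γ (Δ.residue s t C₀)
  have : Finite Q := Nat.finite_of_card_ne_zero (by omega)
  have := Fintype.ofFinite Q
  let F : {p : Q × Q // p.1 ≠ p.2} → {g : G // g ≠ 1} := fun p =>
    ⟨h.position C₀ s t p.1.1 * (h.position C₀ s t p.1.2)⁻¹, fun h1 => p.2
      (h.position_injective hM hst (mul_inv_eq_one.1 h1))⟩
  have hF : Function.Bijective F := by
    constructor
    · rintro ⟨p, hp⟩ ⟨p', hp'⟩ hpp
      have h1 := congrArg Subtype.val hpp
      exact Subtype.ext ((h.existsUnique_position_of_three hM hst hm _ (F ⟨p', hp'⟩).2).unique h1 rfl)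
    · rintro ⟨g, hg⟩
      obtain ⟨p, hp, -⟩ := h.existsUnique_position_of_three hM hst hm g hg
      refine ⟨⟨p, fun h1 => hg ?_⟩, Subtype.ext hp⟩
      rw [← hp, h1, mul_inv_cancel]
  have h1 : Nat.card {p : Q × Q // p.1 ≠ p.2} = (q + 1) * (q + 1) - (q + 1) := by
    rw [Nat.card_eq_fintype_card, Fintype.card_of_subtype (Finset.univ.offDiag : Finset (Q × Q))
      (fun p => by simp [Finset.mem_offDiag]), Finset.offDiag_card, Finset.card_univ,
      ← Nat.card_eq_fintype_card, hq]
  have : Finite {g : G // g ≠ 1} := Finite.of_surjective F hF.2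
  rw [← Nat.card_congr (Equiv.optionSubtypeNe (1 : G)), Finite.card_option,
    ← Nat.card_congr (Equiv.ofBijective F hF), h1]
  rw [← Nat.sub_one_mul, Nat.add_sub_cancel]
  ring

/-! ### Additive coordinates from the cyclic stabilizers. -/

section Coordinates

/-- A coordinate on the orbits of chambers, adapted to the labels `s` and `t`: the closing of
alternating galleries of length `4` and `6` is expressed by alternating sums. -/
structure IsCoordinate (Δ : Building.{u, v} M) (Γ : Subgroup Δ.Aut) (s t : S) {A : Type*}
    [AddCommGroup A] (c : MulAction.orbitRel.Quotient Γ Δ.Chamber → A) : Prop where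
  injective : Function.Injective c
  four : ∀ {C₁ C₂ C₃ C₄ : Δ.Chamber}, Δ.Adj s C₁ C₂ → Δ.Adj t C₂ C₃ → Δ.Adj s C₃ C₄ →
    (c (Quotient.mk _ C₁) - c (Quotient.mk _ C₂) + c (Quotient.mk _ C₃) -
      c (Quotient.mk _ C₄) = 0 ↔ Δ.Adj t C₄ C₁)
  six : ∀ {C₁ C₂ C₃ C₄ C₅ C₆ : Δ.Chamber}, Δ.Adj s C₁ C₂ → Δ.Adj t C₂ C₃ → Δ.Adj s C₃ C₄ →
    Δ.Adj t C₄ C₅ → Δ.Adj s C₅ C₆ →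
    (c (Quotient.mk _ C₁) - c (Quotient.mk _ C₂) + c (Quotient.mk _ C₃) -
      c (Quotient.mk _ C₄) + c (Quotient.mk _ C₅) - c (Quotient.mk _ C₆) = 0 ↔ Δ.Adj t C₆ C₁)

/-- The logarithm of the telescoping product is the negative of the alternating sum. -/
theorem PanelRegular.isCoordinate (hM : M.IsTwoThreeInfty) {s t : S} (hst : s ≠ t) {A : Type*}
    [AddCommGroup A] (L : MulAction.stabilizer Γ (Δ.residue s t C₀) ≃* Multiplicative A) :
    IsCoordinate Δ Γ s t fun X => (L (h.position C₀ s t X)).toAdd where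
  injective X Y hXY := h.position_injective hM hst (L.injective hXY)
  four h₁ h₂ h₃ := by
    rw [← h.adj_iff_four (C₀ := C₀) h₁ h₂ h₃, ← L.map_eq_one_iff, ← toAdd_eq_zero, ← neg_eq_zero]
    simp only [map_mul, map_inv, toAdd_mul, toAdd_inv]
    refine Eq.congr ?_ rfl
    abel
  six h₁ h₂ h₃ h₄ h₅ := by
    rw [← h.adj_iff_six (C₀ := C₀) h₁ h₂ h₃ h₄ h₅, ← L.map_eq_one_iff, ← toAdd_eq_zero,
      ← neg_eq_zero]
    simp only [map_mul, map_inv, toAdd_mul, toAdd_inv]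
    refine Eq.congr ?_ rfl
    abel

theorem exists_logarithm {G : Type*} [Group G] (hG : IsCyclic G) {n : ℕ} (hn : Nat.card G = n) :
    Nonempty (G ≃* Multiplicative (ZMod n)) := by
  subst hn
  exact ⟨(zmodCyclicMulEquiv hG).symm⟩

theorem IsSingerCyclicLattice.exists_coordinate_of_two (hM : M.IsTwoThreeInfty) {q : ℕ}
    (hΓ : Δ.IsSingerCyclicLattice Γ q) {s t : S} (hst : s ≠ t) (hm : M s t = 2) (C₀ : Δ.Chamber) :
    ∃ c : MulAction.orbitRel.Quotient Γ Δ.Chamber → ZMod (q + 1),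
      IsCoordinate Δ Γ s t c ∧ c (Quotient.mk _ C₀) = 0 ∧ Function.Surjective c := by
  have h := hΓ.panelRegular
  have hb := h.position_bijective_of_two (C₀ := C₀) hM hst hm
  obtain ⟨L⟩ := exists_logarithm (hΓ.isCyclic_stabilizer s t C₀ hst (by omega))
    ((Nat.card_congr (Equiv.ofBijective _ hb)).symm.trans hΓ.card_quotient)
  refine ⟨_, h.isCoordinate hM hst L, ?_, L.surjective.comp hb.2⟩
  rw [h.position_self, map_one]
  rfl

theorem IsSingerCyclicLattice.exists_coordinate_of_three (hM : M.IsTwoThreeInfty) {q : ℕ}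
    (hΓ : Δ.IsSingerCyclicLattice Γ q) {s t : S} (hst : s ≠ t) (hm : M s t = 3) (C₀ : Δ.Chamber) :
    ∃ c : MulAction.orbitRel.Quotient Γ Δ.Chamber → ZMod (q ^ 2 + q + 1),
      IsCoordinate Δ Γ s t c ∧ c (Quotient.mk _ C₀) = 0 ∧ IsDifferenceSet q (Set.range c) := by
  have h := hΓ.panelRegular
  obtain ⟨L⟩ := exists_logarithm (hΓ.isCyclic_stabilizer s t C₀ hst (by omega))
    (h.card_of_three hM hst hm hΓ.card_quotient)
  refine ⟨_, h.isCoordinate hM hst L, ?_, ?_⟩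
  · rw [h.position_self, map_one]
    rfl
  · intro n hn
    obtain ⟨g, hg⟩ := L.surjective (Multiplicative.ofAdd n)
    have hg1 : g ≠ 1 := by
      rintro rfl
      rw [map_one] at hg
      exact hn (ofAdd_eq_one.1 hg.symm)
    -- The logarithm turns the quotients of positions representing `g` into the differences
    -- representing `n`.
    have key : ∀ X Y, h.position C₀ s t X * (h.position C₀ s t Y)⁻¹ = g ↔
        (L (h.position C₀ s t X)).toAdd - (L (h.position C₀ s t Y)).toAdd = n := by
      intro X Y
      rw [← L.injective.eq_iff, hg, map_mul, map_inv, ← toAdd_ofAdd n,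
        ← Multiplicative.toAdd.injective.eq_iff, toAdd_mul, toAdd_inv, sub_eq_add_neg]
      rfl
    obtain ⟨⟨X, Y⟩, h1, h2⟩ := h.existsUnique_position_of_three hM hst hm g hg1
    refine ⟨((L (h.position C₀ s t X)).toAdd, (L (h.position C₀ s t Y)).toAdd),
      ⟨⟨X, rfl⟩, ⟨Y, rfl⟩, (key X Y).1 h1⟩, ?_⟩
    rintro ⟨_, _⟩ ⟨⟨X', rfl⟩, ⟨Y', rfl⟩, h3⟩
    have h4 := h2 (X', Y') ((key X' Y').2 h3)
    obtain ⟨rfl, rfl⟩ := Prod.mk.inj h4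
    rfl

end Coordinates

end Movers

end Building

/-! ### Transport of suites through a model of a residue. -/

namespace WeylData

open PanelSystem

section ThroughResidue

variable {S : Type u} {Q : WeylData.{u, v, w} S} {W : WeylData.{u, v', w'} S} {s t : S}
  {Z : WeylData.{0, 0, 0} (Fin 2)}

/-- The suite contracts in the residue, hence in the model `Z`, and that contraction is carried to
`W`. The condition `H` asks about every `k` with the stated inverse property, so that its user need
not know which inverse of the chamber map is chosen. -/
theorem homotopic_nil_through_residue (hQ : Q.Full) (hW : W.Full) (hZ : Z.Full)
    (F : (Q.residue s t).Iso Z) (ι : Q.Chamber ≃ W.Chamber)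
    (H : ∀ (k : Z.Chamber → W.Chamber), (∀ z, F.chamber (ι.symm (k z)) = z) →
      ∀ (z : Z.Chamber) (g : Z.Gallery z z), Z.IsSuite g →
        W.Homotopic (g.map hW ![s, t] k) (Gallery.nil (k z)))
    {X : Q.Chamber} (g : Q.Gallery X X) (l : List (Fin 2)) (hl : l.map ![s, t] = g.types)
    (hg : Q.IsSuite g) : W.Homotopic (g.map hW id ι) (Gallery.nil (ι X)) := by
  obtain ⟨g', h1, h2⟩ := Gallery.exists_relabel (P := Q.toPanelSystem)
    (P' := (Q.residue s t).toPanelSystem) (residue_full hQ s t) id g l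
    (by rw [← hl, List.length_map])
  have h2' : g'.chambers = g.chambers := h2.trans (List.map_id _)
  have h3 : Q.toPanelSystem.unrestrict ![s, t] g' = g :=
    Gallery.ext_of_full hQ _ _
      ((types_unrestrict (P := Q.toPanelSystem) ![s, t] g').trans ((congrArg _ h1).trans hl))
      ((chambers_unrestrict (P := Q.toPanelSystem) ![s, t] g').trans h2')
  have h4 : (Q.residue s t).IsSuite g' := by
    change Q.IsSuite (Q.toPanelSystem.unrestrict ![s, t] g')
    rw [h3]
    exact hg
  let e : (Q.residue s t).Chamber ≃ Z.Chamber := Equiv.ofBijective F.chamber F.chamber_bijective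
  let k : Z.Chamber → W.Chamber := fun z => ι (e.symm z)
  have hk : ∀ z, F.chamber (ι.symm (k z)) = z := fun z =>
    (congrArg e (ι.symm_apply_apply (e.symm z))).trans (e.apply_symm_apply z)
  have h5 := (F.homotopic_map_iff hZ _ _).2 (Homotopic.suite g' h4)
  have h6 := homotopic_map hW ![s, t] k (H k hk) h5
  have h6 : W.Homotopic (g'.map hW (![s, t] ∘ id) (k ∘ F.chamber)) (Gallery.nil (k (F.chamber X))) :=
    (congrArg (fun a => W.Homotopic a (Gallery.nil (k (F.chamber X))))
      (Gallery.map_map (P := (Q.residue s t).toPanelSystem) hZ id F.chamber hW ![s, t] k g')).mp h6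
  -- The composite `k ∘ F.chamber` equals `ι` only propositionally, so the map is generalized before
  -- the endpoints are compared.
  have h7 : ∀ k' : (Q.residue s t).Chamber → W.Chamber, k' = ι →
      W.Homotopic (g'.map hW (![s, t] ∘ id) k') (Gallery.nil (k' X)) →
      W.Homotopic (g.map hW id ι) (Gallery.nil (ι X)) := by
    rintro _ rfl h
    have h8 : g'.map hW (![s, t] ∘ id) ι = g.map hW id ι := by
      refine Gallery.ext_of_full hW _ _ ?_ ?_
      · refine (Gallery.types_map hW _ _ g').trans ?_
        rw [Gallery.types_map_id, h1, ← hl]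
        rfl
      · refine (Gallery.chambers_map hW _ _ g').trans ?_
        rw [Gallery.chambers_map, h2']
        rfl
    rwa [h8] at h
  refine h7 _ (funext fun X => congrArg ι (e.symm_apply_apply X)) h6

/-- The opposite direction: a gallery whose image in the model is a suite contracts there, and the
isomorphism brings the contraction back into the residue of `Q`. -/
theorem homotopic_nil_of_residue (hQ : Q.Full) (hZ : Z.Full)
    (F : (Q.residue s t).Iso Z) (ι : Q.Chamber ≃ W.Chamber) {x : W.Chamber} (g : W.Gallery x x) (l : List (Fin 2))
    (hl : l.map ![s, t] = g.types)
    (H : ∀ (z : Z.Chamber) (g' : Z.Gallery z z), g'.types = l →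
      g'.chambers = g.chambers.map (fun x => F.chamber (ι.symm x)) → Z.IsSuite g') :
    Q.Homotopic (g.map hQ id ι.symm) (Gallery.nil (ι.symm x)) := by
  obtain ⟨g', h1, h2⟩ := Gallery.exists_relabel (P := W.toPanelSystem) hZ
    (fun x => F.chamber (ι.symm x)) g l (by rw [← hl, List.length_map])
  let e : (Q.residue s t).Chamber ≃ Z.Chamber := Equiv.ofBijective F.chamber F.chamber_bijective
  have h3 := F.homotopic_map_inverse (residue_full hQ s t) hZ (k := e.symm)
    (fun z => e.apply_symm_apply z) (Homotopic.suite g' (H _ g' h1 h2))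
  have h4 := homotopic_of_residue hQ h3
  have h5 : ∀ y : Q.Chamber, y = ι.symm x → ∀ g'' : Q.Gallery y y,
      g''.types = g.types → g''.chambers = g.chambers.map ι.symm →
      Q.Homotopic g'' (Gallery.nil y) →
      Q.Homotopic (g.map hQ id ι.symm) (Gallery.nil (ι.symm x)) := by
    rintro _ rfl g'' h6 h7 h8
    have h9 : g'' = g.map hQ id ι.symm := Gallery.ext_of_full hQ _ _
      (h6.trans (Gallery.types_map_id hQ _ g).symm) (h7.trans (Gallery.chambers_map hQ id _ g).symm)
    rwa [h9] at h8
  refine h5 _ (e.symm_apply_apply (ι.symm x)) _ ?_ ?_ h4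
  · refine (Gallery.types_map (P := (Q.residue s t).toPanelSystem) hQ _ _ _).trans ?_
    rw [Gallery.types_map_id, h1, hl]
  · refine (Gallery.chambers_map (P := (Q.residue s t).toPanelSystem) hQ _ _ _).trans ?_
    rw [Gallery.chambers_map, h2, List.map_map]
    refine (List.map_id _).trans (List.map_congr_left fun y _ => ?_)
    exact e.symm_apply_apply (ι.symm y)

end ThroughResidue

end WeylData

/-- A building suite using only the labels `s`, `t` must be a suite of that pair, starting with
either label; its length is thus governed by `M s t`. -/
theorem alternatingWord_eq_map {S : Type u} {M : CoxeterMatrix S} (hM : M.IsTwoThreeInfty)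
    {s t s' t' : S} (hst' : s' ≠ t') (hm : M s' t' ≠ 0) {l : List (Fin 2)}
    (hl : CoxeterSystem.alternatingWord s' t' (2 * M s' t') = l.map ![s, t]) :
    (M s t = 2 ∧ (l = [0, 1, 0, 1] ∨ l = [1, 0, 1, 0])) ∨
      (M s t = 3 ∧ (l = [0, 1, 0, 1, 0, 1] ∨ l = [1, 0, 1, 0, 1, 0])) := by
  have key : ∀ i j : Fin 2, ![s, t] i = s' → ![s, t] j = t' →
      (i = 0 ∧ j = 1 ∧ s' = s ∧ t' = t) ∨ (i = 1 ∧ j = 0 ∧ s' = t ∧ t' = s) := by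
    intro i j hi hj
    fin_cases i <;> fin_cases j
    · exact absurd (hi.symm.trans hj) hst'
    · exact Or.inl ⟨rfl, rfl, hi.symm, hj.symm⟩
    · exact Or.inr ⟨rfl, rfl, hi.symm, hj.symm⟩
    · exact absurd (hi.symm.trans hj) hst'
  rcases hM s' t' hst' with h | h | h
  · left
    rw [h, show CoxeterSystem.alternatingWord s' t' (2 * 2) = [s', t', s', t'] from rfl,
      eq_comm] at hl
    simp only [List.map_eq_cons_iff, List.map_eq_nil_iff] at hl
    obtain ⟨a, _, rfl, ha, b, _, rfl, hb, c, _, rfl, hc, d, _, rfl, hd, rfl⟩ := hl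
    rcases key a b ha hb with ⟨rfl, rfl, rfl, rfl⟩ | ⟨rfl, rfl, rfl, rfl⟩ <;>
    rcases key c d hc hd with ⟨rfl, rfl, h1, h2⟩ | ⟨rfl, rfl, h1, h2⟩
    · exact ⟨h, Or.inl rfl⟩
    · exact absurd h1 hst'
    · exact absurd h1 hst'
    · exact ⟨by rw [M.symmetric]; exact h, Or.inr rfl⟩
  · right
    rw [h, show CoxeterSystem.alternatingWord s' t' (2 * 3) = [s', t', s', t', s', t'] from rfl,
      eq_comm] at hl
    simp only [List.map_eq_cons_iff, List.map_eq_nil_iff] at hl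
    obtain ⟨a, _, rfl, ha, b, _, rfl, hb, c, _, rfl, hc, d, _, rfl, hd, a', _, rfl, ha', b', _, rfl,
      hb', rfl⟩ := hl
    rcases key a b ha hb with ⟨rfl, rfl, rfl, rfl⟩ | ⟨rfl, rfl, rfl, rfl⟩ <;>
    rcases key c d hc hd with ⟨rfl, rfl, h1, h2⟩ | ⟨rfl, rfl, h1, h2⟩ <;>
    rcases key a' b' ha' hb' with ⟨rfl, rfl, h3, h4⟩ | ⟨rfl, rfl, h3, h4⟩
    · exact ⟨h, Or.inl rfl⟩
    · exact absurd h3 hst'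
    · exact absurd h1 hst'
    · exact absurd h1 hst'
    · exact absurd h1 hst'
    · exact absurd h1 hst'
    · exact absurd h3 hst'
    · exact ⟨by rw [M.symmetric]; exact h, Or.inr rfl⟩
  · exact absurd h hm

/-! ### Suites of the quotient in coordinates. -/

namespace Building

open PanelSystem WeylData

variable {S : Type u} {M : CoxeterMatrix S} {Δ : Building.{u, v} M} {Γ : Subgroup Δ.Aut}

section Suites

theorem exists_chambers_four {a b c d : S} {C D : Δ.toPanelSystem.Chamber}
    (g : Δ.toPanelSystem.Gallery C D) (hg : g.types = [a, b, c, d]) :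
    ∃ C₁ C₂ C₃ : Δ.Chamber, Δ.Adj a C C₁ ∧ Δ.Adj b C₁ C₂ ∧ Δ.Adj c C₂ C₃ ∧ Δ.Adj d C₃ D ∧
      g.chambers = [C, C₁, C₂, C₃, D] := by
  rcases g with _ | @⟨_, C₁, _, _, e₁, _ | @⟨_, C₂, _, _, e₂, _ | @⟨_, C₃, _, _, e₃,
    _ | @⟨_, C₄, _, _, e₄, _ | _⟩⟩⟩⟩ <;>
    simp only [Gallery.types, List.cons.injEq, reduceCtorEq, and_false, and_true] at hg
  obtain ⟨rfl, rfl, rfl, rfl⟩ := hg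
  exact ⟨C₁, C₂, C₃, e₁.down, e₂.down, e₃.down, e₄.down, rfl⟩

theorem exists_chambers_six {a b c d a' b' : S} {C D : Δ.toPanelSystem.Chamber}
    (g : Δ.toPanelSystem.Gallery C D) (hg : g.types = [a, b, c, d, a', b']) :
    ∃ C₁ C₂ C₃ C₄ C₅ : Δ.Chamber, Δ.Adj a C C₁ ∧ Δ.Adj b C₁ C₂ ∧ Δ.Adj c C₂ C₃ ∧ Δ.Adj d C₃ C₄ ∧
      Δ.Adj a' C₄ C₅ ∧ Δ.Adj b' C₅ D ∧ g.chambers = [C, C₁, C₂, C₃, C₄, C₅, D] := by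
  rcases g with _ | @⟨_, C₁, _, _, e₁, _ | @⟨_, C₂, _, _, e₂, _ | @⟨_, C₃, _, _, e₃,
    _ | @⟨_, C₄, _, _, e₄, _ | @⟨_, C₅, _, _, e₅, _ | @⟨_, C₆, _, _, e₆, _ | _⟩⟩⟩⟩⟩⟩ <;>
    simp only [Gallery.types, List.cons.injEq, reduceCtorEq, and_false, and_true] at hg
  obtain ⟨rfl, rfl, rfl, rfl, rfl, rfl⟩ := hg
  exact ⟨C₁, C₂, C₃, C₄, C₅, e₁.down, e₂.down, e₃.down, e₄.down, e₅.down, e₆.down, rfl⟩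

variable {hfree : Δ.ChamberFree Γ}

theorem IsQuotientSuite.exists_lift {X : (Δ.quotient Γ hfree).Chamber}
    {g : (Δ.quotient Γ hfree).Gallery X X} (hg : (Δ.quotient Γ hfree).IsSuite g) :
    ∃ (C : Δ.toPanelSystem.Chamber) (g' : Δ.toPanelSystem.Gallery C C), Δ.IsSuite g' ∧
      g'.types = g.types ∧ g'.chambers.map (Quotient.mk _) = g.chambers := by
  obtain ⟨g', hg'⟩ := hg
  exact ⟨_, g', hg', ((Δ.quotientMap Γ hfree).types_gallery g').symm,
    ((Δ.quotientMap Γ hfree).chambers_gallery g').symm⟩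

theorem isSuite_quotient_of_lift (h : Δ.PanelRegular Γ) {X : (Δ.quotient Γ hfree).Chamber}
    (g : (Δ.quotient Γ hfree).Gallery X X) {C : Δ.toPanelSystem.Chamber}
    (hC : Quotient.mk _ C = X) (g' : Δ.toPanelSystem.Gallery C C) (hg' : Δ.IsSuite g')
    (ht : g'.types = g.types) (hc : g'.chambers.map (Quotient.mk _) = g.chambers) :
    (Δ.quotient Γ hfree).IsSuite g := by
  subst hC
  have h1 : (Δ.quotientMap Γ hfree).gallery g' = g := Gallery.ext_of_full (h.quotient_full hfree) _ _
    (((Δ.quotientMap Γ hfree).types_gallery g').trans ht)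
    (((Δ.quotientMap Γ hfree).chambers_gallery g').trans hc)
  rw [← h1]
  exact IsQuotientSuite.mk g' hg'

end Suites

end Building

namespace Building

open PanelSystem WeylData

variable {S : Type u} {M : CoxeterMatrix S} {Δ : Building.{u, v} M} {Γ : Subgroup Δ.Aut}

section ResidueSuites

variable {hfree : Δ.ChamberFree Γ} {s t : S} {A : Type*} [AddCommGroup A]
  {c : MulAction.orbitRel.Quotient Γ Δ.Chamber → A}

/-- A suite of the quotient lifts to a closed gallery of the building, where closing up is the
vanishing of the alternating sum. -/
theorem exists_alternatingSum_four (hM : M.IsTwoThreeInfty) (hm : M s t = 2)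
    (hc : IsCoordinate Δ Γ s t c) {X : ((Δ.quotient Γ hfree).residue s t).Chamber}
    (g : ((Δ.quotient Γ hfree).residue s t).Gallery X X)
    (hg : ((Δ.quotient Γ hfree).residue s t).IsSuite g) :
    ∃ X₀ X₁ X₂ X₃ : MulAction.orbitRel.Quotient Γ Δ.Chamber, g.chambers = [X₀, X₁, X₂, X₃, X₀] ∧
      (g.types = [0, 1, 0, 1] ∨ g.types = [1, 0, 1, 0]) ∧ c X₀ - c X₁ + c X₂ - c X₃ = 0 := by
  obtain ⟨C, g', ⟨s', t', hne, hm', ht, -⟩, h1, h2⟩ :=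
    IsQuotientSuite.exists_lift (hfree := hfree)
      (g := (Δ.quotient Γ hfree).toPanelSystem.unrestrict ![s, t] g) hg
  have h2' : g'.chambers.map (Quotient.mk _) = g.chambers :=
    h2.trans (chambers_unrestrict (P := (Δ.quotient Γ hfree).toPanelSystem) ![s, t] g)
  have h3 : g'.types = g.types.map ![s, t] :=
    h1.trans (types_unrestrict (P := (Δ.quotient Γ hfree).toPanelSystem) ![s, t] g)
  rcases alternatingWord_eq_map hM hne hm' (ht.symm.trans h3) with ⟨-, h4⟩ | ⟨h4, -⟩
  · rcases h4 with h4 | h4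
    · rw [h4] at h3
      obtain ⟨C₁, C₂, C₃, a₁, a₂, a₃, a₄, h5⟩ := exists_chambers_four g' h3
      rw [h5] at h2'
      exact ⟨_, _, _, _, h2'.symm, Or.inl h4, (hc.four a₁ a₂ a₃).2 a₄⟩
    · rw [h4] at h3
      obtain ⟨C₁, C₂, C₃, a₁, a₂, a₃, a₄, h5⟩ := exists_chambers_four g' h3
      rw [h5] at h2'
      refine ⟨_, _, _, _, h2'.symm, Or.inr h4, ?_⟩
      -- A suite starting with `t` is read cyclically from its second chamber, which reverses the
      -- sign of the sum.
      have key : ∀ x y z w : A, y - z + w - x = 0 → x - y + z - w = 0 := by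
        intro x y z w h
        rw [← neg_eq_zero, ← h]
        abel
      exact key _ _ _ _ ((hc.four a₂ a₃ a₄).2 a₁)
  · omega

theorem exists_alternatingSum_six (hM : M.IsTwoThreeInfty) (hm : M s t = 3)
    (hc : IsCoordinate Δ Γ s t c) {X : ((Δ.quotient Γ hfree).residue s t).Chamber}
    (g : ((Δ.quotient Γ hfree).residue s t).Gallery X X)
    (hg : ((Δ.quotient Γ hfree).residue s t).IsSuite g) :
    ∃ X₀ X₁ X₂ X₃ X₄ X₅ : MulAction.orbitRel.Quotient Γ Δ.Chamber,
      g.chambers = [X₀, X₁, X₂, X₃, X₄, X₅, X₀] ∧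
      (g.types = [0, 1, 0, 1, 0, 1] ∨ g.types = [1, 0, 1, 0, 1, 0]) ∧
      c X₀ - c X₁ + c X₂ - c X₃ + c X₄ - c X₅ = 0 := by
  obtain ⟨C, g', ⟨s', t', hne, hm', ht, -⟩, h1, h2⟩ :=
    IsQuotientSuite.exists_lift (hfree := hfree)
      (g := (Δ.quotient Γ hfree).toPanelSystem.unrestrict ![s, t] g) hg
  have h2' : g'.chambers.map (Quotient.mk _) = g.chambers :=
    h2.trans (chambers_unrestrict (P := (Δ.quotient Γ hfree).toPanelSystem) ![s, t] g)
  have h3 : g'.types = g.types.map ![s, t] :=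
    h1.trans (types_unrestrict (P := (Δ.quotient Γ hfree).toPanelSystem) ![s, t] g)
  rcases alternatingWord_eq_map hM hne hm' (ht.symm.trans h3) with ⟨h4, -⟩ | ⟨-, h4⟩
  · omega
  · rcases h4 with h4 | h4
    · rw [h4] at h3
      obtain ⟨C₁, C₂, C₃, C₄, C₅, a₁, a₂, a₃, a₄, a₅, a₆, h5⟩ := exists_chambers_six g' h3
      rw [h5] at h2'
      exact ⟨_, _, _, _, _, _, h2'.symm, Or.inl h4, (hc.six a₁ a₂ a₃ a₄ a₅).2 a₆⟩
    · rw [h4] at h3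
      obtain ⟨C₁, C₂, C₃, C₄, C₅, a₁, a₂, a₃, a₄, a₅, a₆, h5⟩ := exists_chambers_six g' h3
      rw [h5] at h2'
      refine ⟨_, _, _, _, _, _, h2'.symm, Or.inr h4, ?_⟩
      have key : ∀ x y z w u v : A, y - z + w - u + v - x = 0 → x - y + z - w + u - v = 0 := by
        intro x y z w u v h
        rw [← neg_eq_zero, ← h]
        abel
      exact key _ _ _ _ _ _ ((hc.six a₂ a₃ a₄ a₅ a₆).2 a₁)

/-- The first three edges are lifted by panel-regularity; the vanishing sum says exactly that a last
edge of type `t` closes the lift. -/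
theorem isSuite_of_alternatingSum_four (h : Δ.PanelRegular Γ) (hst : s ≠ t) (hm : M s t = 2)
    (hc : IsCoordinate Δ Γ s t c) {X : ((Δ.quotient Γ hfree).residue s t).Chamber}
    (g : ((Δ.quotient Γ hfree).residue s t).Gallery X X) (ht : g.types = [0, 1, 0, 1])
    {X₀ X₁ X₂ X₃ : MulAction.orbitRel.Quotient Γ Δ.Chamber} (hg : g.chambers = [X₀, X₁, X₂, X₃, X₀])
    (hsum : c X₀ - c X₁ + c X₂ - c X₃ = 0) (h₁ : c X₀ ≠ c X₁) (h₂ : c X₁ ≠ c X₂) (h₃ : c X₂ ≠ c X₃)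
    (h₄ : c X₃ ≠ c X₀) : ((Δ.quotient Γ hfree).residue s t).IsSuite g := by
  have hX : X = X₀ := by
    obtain ⟨l, hl⟩ := g.chambers_eq_cons
    exact (List.cons.inj (hl.symm.trans hg)).1
  obtain ⟨C, rfl⟩ : ∃ C : Δ.Chamber, Quotient.mk _ C = X₀ := Quotient.exists_rep X₀
  obtain ⟨C₁, ⟨a₁, rfl⟩, -⟩ := h.existsUnique_adj s C X₁
  obtain ⟨C₂, ⟨a₂, rfl⟩, -⟩ := h.existsUnique_adj t C₁ X₂
  obtain ⟨C₃, ⟨a₃, rfl⟩, -⟩ := h.existsUnique_adj s C₂ X₃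
  have a₄ := (hc.four a₁ a₂ a₃).1 hsum
  have hne : ∀ {D E : Δ.Chamber}, c (Quotient.mk _ D) ≠ c (Quotient.mk _ E) → D ≠ E :=
    fun h e => h (by rw [e])
  refine isSuite_quotient_of_lift h _ (C := C) hX.symm
    (Gallery.cons (P := Δ.toPanelSystem) (y := C₁) s ⟨a₁⟩
      (Gallery.cons (P := Δ.toPanelSystem) (y := C₂) t ⟨a₂⟩
        (Gallery.cons (P := Δ.toPanelSystem) (y := C₃) s ⟨a₃⟩
          (Gallery.single (P := Δ.toPanelSystem) t ⟨a₄⟩)))) ⟨s, t, hst, by omega, ?_, ?_⟩ ?_ ?_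
  · rw [hm]
    rfl
  · exact isChain_five (hne h₁) (hne h₂) (hne h₃) (hne h₄)
  · exact (congrArg (List.map ![s, t]) ht).symm.trans
      (types_unrestrict (P := (Δ.quotient Γ hfree).toPanelSystem) ![s, t] g).symm
  · exact hg.symm.trans
      (chambers_unrestrict (P := (Δ.quotient Γ hfree).toPanelSystem) ![s, t] g).symm

theorem isSuite_of_alternatingSum_six (h : Δ.PanelRegular Γ) (hst : s ≠ t) (hm : M s t = 3)
    (hc : IsCoordinate Δ Γ s t c) {X : ((Δ.quotient Γ hfree).residue s t).Chamber}
    (g : ((Δ.quotient Γ hfree).residue s t).Gallery X X) (ht : g.types = [0, 1, 0, 1, 0, 1])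
    {X₀ X₁ X₂ X₃ X₄ X₅ : MulAction.orbitRel.Quotient Γ Δ.Chamber}
    (hg : g.chambers = [X₀, X₁, X₂, X₃, X₄, X₅, X₀])
    (hsum : c X₀ - c X₁ + c X₂ - c X₃ + c X₄ - c X₅ = 0) (h₁ : c X₀ ≠ c X₁) (h₂ : c X₁ ≠ c X₂)
    (h₃ : c X₂ ≠ c X₃) (h₄ : c X₃ ≠ c X₄) (h₅ : c X₄ ≠ c X₅) (h₆ : c X₅ ≠ c X₀) :
    ((Δ.quotient Γ hfree).residue s t).IsSuite g := by
  have hX : X = X₀ := by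
    obtain ⟨l, hl⟩ := g.chambers_eq_cons
    exact (List.cons.inj (hl.symm.trans hg)).1
  obtain ⟨C, rfl⟩ : ∃ C : Δ.Chamber, Quotient.mk _ C = X₀ := Quotient.exists_rep X₀
  obtain ⟨C₁, ⟨a₁, rfl⟩, -⟩ := h.existsUnique_adj s C X₁
  obtain ⟨C₂, ⟨a₂, rfl⟩, -⟩ := h.existsUnique_adj t C₁ X₂
  obtain ⟨C₃, ⟨a₃, rfl⟩, -⟩ := h.existsUnique_adj s C₂ X₃
  obtain ⟨C₄, ⟨a₄, rfl⟩, -⟩ := h.existsUnique_adj t C₃ X₄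
  obtain ⟨C₅, ⟨a₅, rfl⟩, -⟩ := h.existsUnique_adj s C₄ X₅
  have a₆ := (hc.six a₁ a₂ a₃ a₄ a₅).1 hsum
  have hne : ∀ {D E : Δ.Chamber}, c (Quotient.mk _ D) ≠ c (Quotient.mk _ E) → D ≠ E :=
    fun h e => h (by rw [e])
  refine isSuite_quotient_of_lift h _ (C := C) hX.symm
    (Gallery.cons (P := Δ.toPanelSystem) (y := C₁) s ⟨a₁⟩
      (Gallery.cons (P := Δ.toPanelSystem) (y := C₂) t ⟨a₂⟩
        (Gallery.cons (P := Δ.toPanelSystem) (y := C₃) s ⟨a₃⟩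
          (Gallery.cons (P := Δ.toPanelSystem) (y := C₄) t ⟨a₄⟩
            (Gallery.cons (P := Δ.toPanelSystem) (y := C₅) s ⟨a₅⟩
              (Gallery.single (P := Δ.toPanelSystem) t ⟨a₆⟩)))))) ⟨s, t, hst, by omega, ?_, ?_⟩ ?_ ?_
  · rw [hm]
    rfl
  · exact isChain_seven (hne h₁) (hne h₂) (hne h₃) (hne h₄) (hne h₅) (hne h₆)
  · exact (congrArg (List.map ![s, t]) ht).symm.trans
      (types_unrestrict (P := (Δ.quotient Γ hfree).toPanelSystem) ![s, t] g).symm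
  · exact hg.symm.trans
      (chambers_unrestrict (P := (Δ.quotient Γ hfree).toPanelSystem) ![s, t] g).symm

end ResidueSuites

/-! ### Residues of the quotient are Singer cyclic digons and triangles. -/

section ResidueIso

variable {hfree : Δ.ChamberFree Γ} {s t : S} {q : ℕ}

/-- Suites of the residue have alternating sum zero and contract in the digon; defining suites of
the digon have alternating sum zero and distinct neighbours, hence are suites of the residue. -/
theorem exists_residue_iso_digon (hM : M.IsTwoThreeInfty) (h : Δ.PanelRegular Γ) (hst : s ≠ t)
    (hm : M s t = 2) {c : MulAction.orbitRel.Quotient Γ Δ.Chamber → ZMod (q + 1)}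
    (hc : IsCoordinate Δ Γ s t c) (hsurj : Function.Surjective c) :
    ∃ F : ((Δ.quotient Γ hfree).residue s t).Iso (singerDigon q),
      ∀ X : (Δ.quotient Γ hfree).Chamber, (F.chamber X : ZMod (q + 1)) = c X := by
  let k : ((Δ.quotient Γ hfree).residue s t).Chamber ≃ (singerDigon q).Chamber :=
    Equiv.ofBijective (β := ZMod (q + 1)) c ⟨hc.injective, hsurj⟩
  have hk : ∀ z : ZMod (q + 1), c (k.symm z) = z := k.apply_symm_apply
  have hfull := residue_full (h.quotient_full hfree) s t
  refine exists_iso hfull (singerDigon_full q) k (fun X g hg => ?_) (fun x g hg => ?_)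
  · obtain ⟨X₀, X₁, X₂, X₃, h1, h2, h3⟩ := exists_alternatingSum_four hM hm hc g hg
    refine singerDigon_homotopic_nil _ ?_ ((Gallery.chambers_map _ _ _ g).trans
      (congrArg (List.map k) h1)) h3
    rwa [Gallery.types_map_id]
  · obtain ⟨h1, y, z, hy, hyz, h2⟩ := hg
    refine Homotopic.suite _ (isSuite_of_alternatingSum_four h hst hm hc _
      ((Gallery.types_map_id hfull _ g).trans h1) ((Gallery.chambers_map hfull _ _ g).trans
        (congrArg (List.map k.symm) h2)) ?_ ?_ ?_ ?_ ?_)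
    · rw [hk, hk, hk, hk]
      ring
    · rw [hk, hk]
      exact hy
    · rw [hk, hk]
      exact hyz
    · rw [hk, hk]
      exact fun h => hy (by linear_combination -h)
    · rw [hk, hk]
      exact fun h => hyz (by linear_combination -h)

theorem exists_residue_iso_triangle (hM : M.IsTwoThreeInfty) (h : Δ.PanelRegular Γ) (hst : s ≠ t)
    (hm : M s t = 3) {c : MulAction.orbitRel.Quotient Γ Δ.Chamber → ZMod (q ^ 2 + q + 1)}
    (hc : IsCoordinate Δ Γ s t c) {D : Set (ZMod (q ^ 2 + q + 1))} (hD : IsDifferenceSet q D)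
    (zero_mem : 0 ∈ D) (hrange : Set.range c = D) :
    ∃ F : ((Δ.quotient Γ hfree).residue s t).Iso (singerTriangle q D),
      ∀ X : (Δ.quotient Γ hfree).Chamber, (show D from F.chamber X).1 = c X := by
  subst hrange
  let k₀ : MulAction.orbitRel.Quotient Γ Δ.Chamber ≃ Set.range c := Equiv.ofInjective c hc.injective
  let k : ((Δ.quotient Γ hfree).residue s t).Chamber ≃ (singerTriangle q (Set.range c)).Chamber := k₀
  have hk : ∀ z : Set.range c, c (k₀.symm z) = z := fun z => congrArg Subtype.val (k₀.apply_symm_apply z)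
  have hfull := residue_full (h.quotient_full hfree) s t
  -- Uniqueness of differences provides the distinct neighbours that are not part of the definition
  -- of a triangle suite.
  have uniq : ∀ a b d e : ZMod (q ^ 2 + q + 1), a ∈ Set.range c → b ∈ Set.range c →
      d ∈ Set.range c → e ∈ Set.range c → a - b = d - e → a ≠ b → a = d ∧ b = e := by
    intro a b d e ha hb hd he hab hne
    exact Prod.mk.inj ((hD (a - b) (sub_ne_zero.2 hne)).unique
      (y₁ := (a, b)) (y₂ := (d, e)) ⟨ha, hb, rfl⟩ ⟨hd, he, hab.symm⟩)
  suffices H : ∃ F : ((Δ.quotient Γ hfree).residue s t).Iso (singerTriangle q (Set.range c)),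
      ∀ X, F.chamber X = k X by
    obtain ⟨F, hF⟩ := H
    exact ⟨F, fun X => congrArg Subtype.val (hF X)⟩
  refine exists_iso hfull (singerTriangle_full q (Set.range c)) k (fun X g hg => ?_)
    (fun x g hg => ?_)
  · obtain ⟨X₀, X₁, X₂, X₃, X₄, X₅, h1, h2, h3⟩ := exists_alternatingSum_six hM hm hc g hg
    refine singerTriangle_homotopic_nil hD zero_mem _ (x₀ := k₀ X₀) (x₁ := k₀ X₁) (x₂ := k₀ X₂)
      (x₃ := k₀ X₃) (x₄ := k₀ X₄) (x₅ := k₀ X₅) ?_ ((Gallery.chambers_map _ _ _ g).trans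
      (congrArg (List.map k) h1)) h3
    rwa [Gallery.types_map_id]
  · obtain ⟨h1, x', y', z', v', w', hx, hxy, hyz, hsum, h2⟩ := hg
    have split : ∀ m : List (Set.range c),
        m.map (fun d : Set.range c => (d : ZMod (q ^ 2 + q + 1))) = [0, x', y', z', v', w', 0] →
      ∃ x₀ x₁ x₂ x₃ x₄ x₅ x₆ : Set.range c, m = [x₀, x₁, x₂, x₃, x₄, x₅, x₆] ∧
      (x₀ : ZMod (q ^ 2 + q + 1)) = 0 ∧ (x₁ : ZMod (q ^ 2 + q + 1)) = x' ∧
      (x₂ : ZMod (q ^ 2 + q + 1)) = y' ∧ (x₃ : ZMod (q ^ 2 + q + 1)) = z' ∧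
      (x₄ : ZMod (q ^ 2 + q + 1)) = v' ∧ (x₅ : ZMod (q ^ 2 + q + 1)) = w' ∧
      (x₆ : ZMod (q ^ 2 + q + 1)) = 0 := by
      intro m h2
      simp only [List.map_eq_cons_iff, List.map_eq_nil_iff] at h2
      obtain ⟨a₀, _, h2, b₀, a₁, _, rfl, b₁, a₂, _, rfl, b₂, a₃, _, rfl, b₃, a₄, _, rfl, b₄,
        a₅, _, rfl, b₅, a₆, _, rfl, b₆, rfl⟩ := h2
      exact ⟨a₀, a₁, a₂, a₃, a₄, a₅, a₆, h2, b₀, b₁, b₂, b₃, b₄, b₅, b₆⟩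
    obtain ⟨x₀, x₁, x₂, x₃, x₄, x₅, x₆, h4, h00, rfl, rfl, rfl, rfl, rfl, h06⟩ := split _ h2
    obtain rfl : x₀ = x₆ := Subtype.ext (h00.trans h06.symm)
    refine Homotopic.suite _ (isSuite_of_alternatingSum_six h hst hm hc (X₀ := k₀.symm x₀)
      (X₁ := k₀.symm x₁) (X₂ := k₀.symm x₂) (X₃ := k₀.symm x₃) (X₄ := k₀.symm x₄)
      (X₅ := k₀.symm x₅) _
      ((Gallery.types_map_id hfull _ g).trans h1) ((Gallery.chambers_map hfull _ _ g).trans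
        (congrArg (List.map k.symm) h4)) ?_ ?_ ?_ ?_ ?_ ?_ ?_) <;> simp only [hk, h00]
    · linear_combination hsum
    · exact hx
    · exact hxy
    · exact hyz
    -- Each of the three remaining coincidences rewrites `x - y` as another difference of members of
    -- the difference set, forcing `x = 0` or `y = z`.
    · exact fun h => hx
        (uniq _ _ _ _ x₁.2 x₂.2 zero_mem x₅.2 (by linear_combination -hsum - h) hxy).1.symm
    · exact fun h => hx
        (uniq _ _ _ _ x₁.2 x₂.2 zero_mem x₃.2 (by linear_combination h - hsum) hxy).1.symm
    · exact fun h => hyz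
        (uniq _ _ _ _ x₁.2 x₂.2 x₄.2 x₃.2 (by linear_combination -hsum - h) hxy).2

end ResidueIso

end Building

/-! ### Existence of an associated gluing matrix. -/

namespace GluingMatrix

variable {S : Type u} {M : CoxeterMatrix S} {E : DefiningOrientation M} {q : ℕ}

theorem Omega_eq (A : GluingMatrix M E q) {N : ℕ} [NeZero N] {e : E.edges} {c : ZMod (q + 1) → ZMod N}
    (h₀ : c 0 = 0) (hc : ∀ n, A.entry n e = (c n).val) : A.Omega N e = c := by
  funext x
  by_cases hx : x = 0
  · rw [Omega, dif_neg (not_not.2 hx), hx, h₀]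
  · rw [Omega, dif_pos hx, hc, ZMod.natCast_zmod_val]

end GluingMatrix

theorem injective_val_comp {X : Type*} {N : ℕ} [NeZero N] {c : X → ZMod N} (hc : Function.Injective c)
    (p : X → Prop) : Function.Injective fun n : {n // p n} => (c n).val :=
  fun _ _ h => Subtype.ext (hc (ZMod.val_injective N h))

theorem range_val_comp {X : Type*} [Zero X] {N : ℕ} [NeZero N] {c : X → ZMod N}
    (hc : Function.Injective c) (h₀ : c 0 = 0) :
    Set.range (fun n : {n : X // n ≠ 0} => (c n).val) = ZMod.val '' (Set.range c \ {0}) := by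
  ext m
  constructor
  · rintro ⟨n, rfl⟩
    exact ⟨_, ⟨⟨n, rfl⟩, fun h => n.2 (hc (h.trans h₀.symm))⟩, rfl⟩
  · rintro ⟨_, ⟨⟨n, rfl⟩, hn⟩, rfl⟩
    exact ⟨⟨n, fun h => hn (by rw [h, h₀]; rfl)⟩, rfl⟩

theorem val_image_compl_zero (q : ℕ) :
    ZMod.val '' ((Set.univ : Set (ZMod (q + 1))) \ {0}) = Set.Icc 1 q := by
  ext m
  constructor
  · rintro ⟨n, ⟨-, hn⟩, rfl⟩
    exact ⟨Nat.one_le_iff_ne_zero.2 fun h => hn ((ZMod.val_eq_zero n).1 h),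
      Nat.lt_succ_iff.1 (ZMod.val_lt n)⟩
  · rintro ⟨h1, h2⟩
    have h3 : ((m : ZMod (q + 1))).val = m := ZMod.val_natCast_of_lt (Nat.lt_succ_iff.2 h2)
    refine ⟨m, ⟨trivial, fun h => ?_⟩, h3⟩
    have h4 : (m : ZMod (q + 1)) = 0 := h
    rw [h4, ZMod.val_zero] at h3
    omega

namespace Building

open PanelSystem WeylData

variable {S : Type u} {M : CoxeterMatrix S} {Δ : Building.{u, v} M} {Γ : Subgroup Δ.Aut}

theorem IsSingerCyclicLattice.exists_isAssociated (hM : M.IsTwoThreeInfty) {q : ℕ}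
    (hΓ : Δ.IsSingerCyclicLattice Γ q) (hfree : Δ.ChamberFree Γ) (E : DefiningOrientation M)
    (ι : (Δ.quotient Γ hfree).Chamber ≃ ZMod (q + 1)) :
    ∃ A : GluingMatrix M E q, A.IsAssociated (Δ.quotient Γ hfree) ι := by
  classical
  let j : MulAction.orbitRel.Quotient Γ Δ.Chamber ≃ ZMod (q + 1) := ι
  -- All coordinates are based at one chamber over `0`, so that they all vanish at `0`.
  obtain ⟨C₀, hC₀⟩ : ∃ C : Δ.Chamber, Quotient.mk _ C = j.symm 0 := Quotient.exists_rep _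
  have h2 := fun (e : E.edges) (h : M e.1.1 e.1.2 = 2) =>
    hΓ.exists_coordinate_of_two hM (E.adj_of_mem _ _ e.2).1 h C₀
  have h3 := fun (e : E.edges) (h : M e.1.1 e.1.2 = 3) =>
    hΓ.exists_coordinate_of_three hM (E.adj_of_mem _ _ e.2).1 h C₀
  rw [hC₀] at h2 h3
  choose c₂ h2c h20 h2s using h2
  choose c₃ h3c h30 h3s using h3
  -- The default `1` keeps the entries positive without excluding other values of `M` at this point.
  let entry : {n : ZMod (q + 1) // n ≠ 0} → E.edges → ℕ := fun n e =>
    if h : M e.1.1 e.1.2 = 2 then (c₂ e h (j.symm n)).val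
    else if h : M e.1.1 e.1.2 = 3 then (c₃ e h (j.symm n)).val else 1
  have entry_two : ∀ (e : E.edges) (h : M e.1.1 e.1.2 = 2),
      (fun n => entry n e) = fun n : {n : ZMod (q + 1) // n ≠ 0} => ((c₂ e h ∘ j.symm) n).val :=
    fun e h => funext fun n => dif_pos h
  have entry_three : ∀ (e : E.edges) (h : M e.1.1 e.1.2 = 3),
      (fun n => entry n e) = fun n : {n : ZMod (q + 1) // n ≠ 0} => ((c₃ e h ∘ j.symm) n).val :=
    fun e h => funext fun n => (dif_neg (by omega)).trans (dif_pos h)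
  have inj₂ := fun e h => (h2c e h).injective.comp j.symm.injective
  have inj₃ := fun e h => (h3c e h).injective.comp j.symm.injective
  have val_pos : ∀ {N : ℕ} {c : ZMod (q + 1) → ZMod N}, Function.Injective c → c 0 = 0 →
      ∀ n, n ≠ 0 → 1 ≤ (c n).val := fun hc h₀ n hn =>
    Nat.one_le_iff_ne_zero.2 fun h => hn (hc (((ZMod.val_eq_zero _).1 h).trans h₀.symm))
  let A : GluingMatrix M E q :=
    { entry := entry
      entry_pos := fun n e => by
        by_cases h : M e.1.1 e.1.2 = 2
        · exact (val_pos (inj₂ e h) (h20 e h) n n.2).trans_eq (congrFun (entry_two e h) n).symm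
        by_cases h' : M e.1.1 e.1.2 = 3
        · exact (val_pos (inj₃ e h') (h30 e h') n n.2).trans_eq (congrFun (entry_three e h') n).symm
        · exact ((dif_neg h).trans (dif_neg h')).ge
      digon := fun e h => by
        rw [entry_two e h, range_val_comp (inj₂ e h) (h20 e h),
          ((h2s e h).comp j.symm.surjective).range_eq, val_image_compl_zero]
        exact ⟨injective_val_comp (inj₂ e h) _, rfl⟩
      triangle := fun e h => by
        rw [entry_three e h, range_val_comp (inj₃ e h) (h30 e h)]
        exact ⟨Set.range (c₃ e h ∘ j.symm), by
          rw [j.symm.surjective.range_comp]; exact h3s e h, ⟨0, h30 e h⟩,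
          injective_val_comp (inj₃ e h) _, rfl⟩ }
  refine ⟨A, fun e h => ?_, fun e h => ?_⟩
  · have hO : A.Omega (q + 1) e = c₂ e h ∘ j.symm :=
      A.Omega_eq (h20 e h) (congrFun (entry_two e h))
    obtain ⟨F, hF⟩ := exists_residue_iso_digon (hfree := hfree) hM hΓ.panelRegular
      (E.adj_of_mem _ _ e.2).1 h (h2c e h) (h2s e h)
    refine ⟨F, fun X => (hF X).trans ?_⟩
    rw [hO]
    exact (congrArg (c₂ e h) (j.symm_apply_apply X)).symm
  · have hO : A.Omega (q ^ 2 + q + 1) e = c₃ e h ∘ j.symm :=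
      A.Omega_eq (h30 e h) (congrFun (entry_three e h))
    have hr : Set.range (c₃ e h) = A.diffSet e := by
      rw [GluingMatrix.diffSet, hO, j.symm.surjective.range_comp]
    obtain ⟨F, hF⟩ := exists_residue_iso_triangle (hfree := hfree) hM hΓ.panelRegular
      (E.adj_of_mem _ _ e.2).1 h (h3c e h) (D := A.diffSet e) (hr ▸ h3s e h)
      (hr ▸ ⟨_, h30 e h⟩) hr
    refine ⟨F, fun X => (hF X).trans ?_⟩
    rw [hO]
    exact (congrArg (c₃ e h) (j.symm_apply_apply X)).symm

end Building

/-! ### Comparison of the quotient with the Weyl graph of an associated matrix. -/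

namespace GluingMatrix

open PanelSystem

variable {S : Type u} {M : CoxeterMatrix S} {E : DefiningOrientation M} {q : ℕ}

theorem weylGraph_full (A : GluingMatrix M E q) : A.weylGraph.Full := connectedSetoid_full _ _

end GluingMatrix

namespace Building

open PanelSystem WeylData

variable {S : Type u} {M : CoxeterMatrix S} {Δ : Building.{u, v} M} {Γ : Subgroup Δ.Aut}
  {E : DefiningOrientation M} {q : ℕ} {hfree : Δ.ChamberFree Γ} {A : GluingMatrix M E q}
  {ι : (Δ.quotient Γ hfree).Chamber ≃ ZMod (q + 1)}

/-- The orientation contains one order of each finite pair; suites of the opposite order are words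
starting with the label `1`. -/
theorem exists_labels (hM : M.IsTwoThreeInfty) (E : DefiningOrientation M) {s t : S} (hst : s ≠ t)
    (hm : M s t ≠ 0) : ∃ e : E.edges, ∃ l : List (Fin 2),
      l.map ![e.1.1, e.1.2] = CoxeterSystem.alternatingWord s t (2 * M s t) ∧
      (M e.1.1 e.1.2 = 2 ∨ M e.1.1 e.1.2 = 3) := by
  have h : M s t = 2 ∨ M s t = 3 := (or_assoc.2 (hM s t hst)).resolve_right hm
  rcases (E.xor_mem s t ⟨hst, hm⟩).or with he | he
  · refine ⟨⟨_, he⟩, ?_⟩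
    rcases h with h | h
    · exact ⟨[0, 1, 0, 1], by rw [h]; rfl, Or.inl h⟩
    · exact ⟨[0, 1, 0, 1, 0, 1], by rw [h]; rfl, Or.inr h⟩
  · refine ⟨⟨_, he⟩, ?_⟩
    have hs : M t s = M s t := M.symmetric _ _
    rcases h with h | h
    · exact ⟨[1, 0, 1, 0], by rw [h]; rfl, Or.inl (hs.trans h)⟩
    · exact ⟨[1, 0, 1, 0, 1, 0], by rw [h]; rfl, Or.inr (hs.trans h)⟩

/-- The suite passes through the Singer model of its residue, whose defining suites pull back under
`Omega` to defining suites of the Weyl graph. -/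
theorem homotopic_nil_of_quotient_suite (hM : M.IsTwoThreeInfty) (h : Δ.PanelRegular Γ)
    (hA : A.IsAssociated (Δ.quotient Γ hfree) ι) {X : (Δ.quotient Γ hfree).Chamber}
    (g : (Δ.quotient Γ hfree).Gallery X X) (hg : (Δ.quotient Γ hfree).IsSuite g) :
    A.weylGraph.Homotopic (g.map A.weylGraph_full id ι)
      (Gallery.nil (P := A.weylGraph.toPanelSystem) (ι X)) := by
  obtain ⟨C, g', ⟨s, t, hne, hm, ht, -⟩, h1, -⟩ := IsQuotientSuite.exists_lift hg
  obtain ⟨e, l, hl, hm' | hm'⟩ := exists_labels hM E hne hm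
  · obtain ⟨F, hF⟩ := hA.digon e hm'
    refine homotopic_nil_through_residue (h.quotient_full hfree) A.weylGraph_full
      (singerDigon_full q) F ι (fun k hk z f hf => ?_) g l (hl.trans (ht.symm.trans h1)) hg
    have hO : ∀ z, A.Omega (q + 1) e (k z) = z := fun z =>
      (congrArg (A.Omega (q + 1) e) (ι.apply_symm_apply (k z))).symm.trans
        ((hF (ι.symm (k z))).symm.trans (hk z))
    refine Homotopic.suite _ ⟨e, Or.inl ⟨hm', ?_, ?_⟩⟩
    · exact (Gallery.types_map A.weylGraph_full _ k f).trans (congrArg (List.map _) hf.1)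
    · have hc : (f.map A.weylGraph_full ![e.1.1, e.1.2] k).chambers.map (A.Omega (q + 1) e) =
          f.chambers :=
        (congrArg _ (Gallery.chambers_map A.weylGraph_full _ k f)).trans ((List.map_map ..).trans
          ((List.map_congr_left fun z _ => hO z).trans (List.map_id _)))
      exact (congrArg (IsDigonCycle q) hc).mpr hf.2
  · obtain ⟨F, hF⟩ := hA.triangle e hm'
    refine homotopic_nil_through_residue (h.quotient_full hfree) A.weylGraph_full
      (singerTriangle_full q _) F ι (fun k hk z f hf => ?_) g l (hl.trans (ht.symm.trans h1)) hg
    have hO : ∀ z : A.diffSet e, A.Omega (q ^ 2 + q + 1) e (k z) = z := fun z =>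
      (congrArg (A.Omega (q ^ 2 + q + 1) e) (ι.apply_symm_apply (k z))).symm.trans
        ((hF (ι.symm (k z))).symm.trans (congrArg Subtype.val (hk z)))
    refine Homotopic.suite _ ⟨e, Or.inr ⟨hm', ?_, ?_⟩⟩
    · exact (Gallery.types_map A.weylGraph_full _ k f).trans (congrArg (List.map _) hf.1)
    · have hc : (f.map A.weylGraph_full ![e.1.1, e.1.2] k).chambers.map
          (A.Omega (q ^ 2 + q + 1) e) =
          List.map (fun d : A.diffSet e => (d : ZMod (q ^ 2 + q + 1))) f.chambers :=
        (congrArg _ (Gallery.chambers_map A.weylGraph_full _ k f)).trans ((List.map_map ..).trans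
          (List.map_congr_left fun z _ => hO z))
      exact (congrArg (IsTriangleCycle q) hc).mpr hf.2

/-- By definition the suite is the preimage of a Singer suite, which contracts in the corresponding
residue of the quotient. -/
theorem homotopic_nil_of_weylGraph_suite (h : Δ.PanelRegular Γ)
    (hA : A.IsAssociated (Δ.quotient Γ hfree) ι) {x : A.weylGraph.Chamber}
    (g : A.weylGraph.Gallery x x) (hg : A.weylGraph.IsSuite g) :
    (Δ.quotient Γ hfree).Homotopic (g.map (h.quotient_full hfree) id ι.symm)
      (Gallery.nil (P := (Δ.quotient Γ hfree).toPanelSystem) (ι.symm x)) := by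
  obtain ⟨e, ⟨hm, ht, hc⟩ | ⟨hm, ht, hc⟩⟩ := hg
  · obtain ⟨F, hF⟩ := hA.digon e hm
    refine homotopic_nil_of_residue (W := A.weylGraph) (h.quotient_full hfree) (singerDigon_full q)
      F ι g [0, 1, 0, 1] ht.symm fun z g' h1 h2 => ⟨h1, ?_⟩
    refine (congrArg (IsDigonCycle q) (h2.trans (List.map_congr_left fun y _ => ?_))).mpr hc
    exact (hF (ι.symm y)).trans (congrArg (A.Omega (q + 1) e) (ι.apply_symm_apply y))
  · obtain ⟨F, hF⟩ := hA.triangle e hm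
    refine homotopic_nil_of_residue (W := A.weylGraph) (h.quotient_full hfree)
      (singerTriangle_full q _) F ι g [0, 1, 0, 1, 0, 1] ht.symm fun z g' h1 h2 => ⟨h1, ?_⟩
    refine (congrArg (IsTriangleCycle q) ((congrArg _ h2).trans ((List.map_map ..).trans
      (List.map_congr_left fun y _ => ?_)))).mpr hc
    exact (hF (ι.symm y)).trans (congrArg (A.Omega (q ^ 2 + q + 1) e) (ι.apply_symm_apply y))

theorem PanelRegular.isPanelBijective_mk (h : Δ.PanelRegular Γ) :
    Δ.IsPanelBijective (X := (Δ.quotient Γ hfree).Chamber) fun C => Quotient.mk _ C :=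
  h.existsUnique_adj

/-- A quotient suite comes from a closed gallery at some chamber; its translates are the lifts at
all other chambers of that orbit. -/
theorem PanelRegular.dev_eq_of_quotient_suite (h : Δ.PanelRegular Γ)
    {X : (Δ.quotient Γ hfree).Chamber} (g : (Δ.quotient Γ hfree).Gallery X X)
    (hg : (Δ.quotient Γ hfree).IsSuite g) {C : Δ.Chamber} (hC : Quotient.mk _ C = X) :
    (h.isPanelBijective_mk (hfree := hfree)).dev g C = C := by
  obtain ⟨C', g', -, h1, h2⟩ := IsQuotientSuite.exists_lift hg
  have h3 := (h.isPanelBijective_mk (hfree := hfree)).dev_eq_of_lift g g' h1 h2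
  have h4 : Quotient.mk _ C' = X := by
    obtain ⟨l, hl⟩ := g.chambers_eq_cons
    obtain ⟨l', hl'⟩ := g'.chambers_eq_cons
    rw [hl, hl'] at h2
    exact (List.cons.inj h2).1
  obtain ⟨γ, rfl⟩ := orbit_mk_eq (hC.trans h4.symm)
  have h5 := (h.isPanelBijective_mk (hfree := hfree)).dev_smul
    (fun γ C => orbit_mk_smul γ C) γ g C'
  exact h5.trans (congrArg (γ • ·) h3)

theorem PanelRegular.isPanelBijective (h : Δ.PanelRegular Γ) {Y : Type w}
    (ι : (Δ.quotient Γ hfree).Chamber ≃ Y) : Δ.IsPanelBijective fun C => ι (Quotient.mk _ C) := by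
  intro s C x
  obtain ⟨D, ⟨h1, h2⟩, h3⟩ := h.existsUnique_adj s C (ι.symm x)
  exact ⟨D, ⟨h1, (congrArg ι h2).trans (ι.apply_symm_apply x)⟩,
    fun D' h' => h3 D' ⟨h'.1, (ι.symm_apply_apply _).symm.trans (congrArg ι.symm h'.2)⟩⟩

/-- One direction uses that suites of the Weyl graph contract in the quotient, so their lifts close;
the other uses that suites of `Δ` project to null-homotopic galleries and that `Δ` is simply
connected. -/
theorem homotopic_iff_dev_eq (hM : M.IsTwoThreeInfty) (h : Δ.PanelRegular Γ)
    (hA : A.IsAssociated (Δ.quotient Γ hfree) ι)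
    (hκ : Δ.IsPanelBijective (X := A.weylGraph.Chamber) fun C => ι (Quotient.mk _ C))
    {x y : A.weylGraph.Chamber} (g g' : A.weylGraph.Gallery x y) (C : Δ.Chamber)
    (hC : ι (Quotient.mk _ C) = x) :
    A.weylGraph.Homotopic g g' ↔ hκ.dev g C = hκ.dev g' C := by
  constructor
  · intro H
    refine hκ.dev_eq_of_homotopic (fun x g hg C hC => ?_) H hC
    have hQ := h.isPanelBijective_mk (hfree := hfree)
    have h1 : (Quotient.mk _ C : (Δ.quotient Γ hfree).Chamber) = ι.symm x :=
      (ι.symm_apply_apply _).symm.trans (congrArg ι.symm hC)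
    have h2 := hQ.dev_eq_of_homotopic (fun X f hf D hD => h.dev_eq_of_quotient_suite f hf hD)
      (homotopic_nil_of_weylGraph_suite h hA g hg) h1
    -- Since `ι` only renames chambers, a lift for the quotient map is also a lift for the map to
    -- the Weyl graph.
    obtain ⟨f, h3, h4⟩ := hQ.exists_lift (g.map (h.quotient_full hfree) id ι.symm) h1
    refine (hκ.dev_eq_of_lift g f ?_ ?_).trans h2
    · exact h3.trans (Gallery.types_map_id _ _ g)
    · have h5 := congrArg (List.map ι) (h4.trans (Gallery.chambers_map _ _ _ g))
      refine (List.map_map ..).symm.trans (h5.trans ((List.map_map ..).trans ?_))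
      exact (List.map_congr_left fun y _ => ι.apply_symm_apply y).trans (List.map_id _)
  · refine hκ.homotopic_of_dev_eq hM A.weylGraph_full (fun D f hf => ?_) hC
    have h1 := homotopic_nil_of_quotient_suite hM h hA _ (IsQuotientSuite.mk (hfree := hfree) f hf)
    have h2 : ((Δ.quotientMap Γ hfree).gallery f).map A.weylGraph_full id ι =
        f.map A.weylGraph_full id fun C => ι (Quotient.mk _ C) := by
      refine Gallery.ext_of_full A.weylGraph_full _ _ ?_ ?_
      · exact (Gallery.types_map_id _ _ _).trans (((Δ.quotientMap Γ hfree).types_gallery f).trans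
          (Gallery.types_map_id _ _ f).symm)
      · exact (Gallery.chambers_map _ _ _ _).trans ((congrArg (List.map ι)
          ((Δ.quotientMap Γ hfree).chambers_gallery f)).trans ((List.map_map ..).trans
            (Gallery.chambers_map A.weylGraph_full _ _ f).symm))
    exact (congrArg (fun a => A.weylGraph.Homotopic a _) h2).mp h1

end Building

theorem mainTheorem2 {S : Type u} (M : CoxeterMatrix S)
    (hM : ∀ s t : S, s ≠ t → M s t = 2 ∨ M s t = 3 ∨ M s t = 0)
    (hL : (definingGraph M).Connected)
    (Δ : Building.{u, v} M) (hΔ : Δ.LocallyFinite)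
    (Γ : Subgroup Δ.Aut) (q : ℕ) (hΓ : Δ.IsSingerCyclicLattice Γ q)
    (E : DefiningOrientation M)
    (ι : (Δ.quotient Γ (hΓ.panelRegular.chamberFree hL.nonempty)).Chamber ≃ ZMod (q + 1)) :
    (∃ A : GluingMatrix M E q,
      A.IsAssociated (Δ.quotient Γ (hΓ.panelRegular.chamberFree hL.nonempty)) ι) ∧
    ∀ A : GluingMatrix M E q,
      A.IsAssociated (Δ.quotient Γ (hΓ.panelRegular.chamberFree hL.nonempty)) ι →
        Nonempty ((Δ.quotient Γ (hΓ.panelRegular.chamberFree hL.nonempty)).Iso A.weylGraph) ∧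
        ∃ (φ : Γ ≃* A.weylGraph.FundamentalGroup A.base)
          (f : Δ.Chamber ≃ A.weylGraph.UniversalCover A.base),
          (∀ (s : S) (C D : Δ.Chamber),
            Δ.Adj s C D ↔ WeylData.UniversalCover.Adj A.weylGraph s (f C) (f D)) ∧
          ∀ (γ : Γ) (C : Δ.Chamber), f (γ • C) = φ γ • f C := by
  have h := hΓ.panelRegular
  have hfree := h.chamberFree hL.nonempty
  refine ⟨hΓ.exists_isAssociated hM hfree E ι, fun A hA => ⟨?_, ?_⟩⟩
  · obtain ⟨F, -⟩ := WeylData.exists_iso (W' := A.weylGraph) (h.quotient_full hfree)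
      A.weylGraph_full ι (fun X g hg => Building.homotopic_nil_of_quotient_suite hM h hA g hg)
      (fun x g hg => Building.homotopic_nil_of_weylGraph_suite h hA g hg)
    exact ⟨F⟩
  · have hκ : Δ.IsPanelBijective (X := A.weylGraph.Chamber) fun C => ι (Quotient.mk _ C) :=
      h.isPanelBijective ι
    -- A chamber lying over the base chamber `0`, from which galleries are lifted.
    obtain ⟨C₀, hC₀⟩ : ∃ C : Δ.Chamber, Quotient.mk _ C = ι.symm 0 := Quotient.exists_rep _
    refine hκ.exists_universalCover hfree A.weylGraph_full (fun C D => ⟨fun H => ?_, ?_⟩)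
      (Building.homotopic_iff_dev_eq hM h hA hκ) C₀ A.base
      ((congrArg ι hC₀).trans (ι.apply_symm_apply 0))
    · exact Building.orbit_mk_eq (ι.injective H.symm)
    · rintro ⟨γ, rfl⟩
      exact congrArg ι (Building.orbit_mk_smul γ C).symm
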